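/- **Theorem 3.3.** Let $j\ge 1$ be an integer and $m=2j+1$. For a tempered distribution $u$ on $\mathbb R^2$ whose space-time Fourier transform $\widehat u(\xi,\tau)=\int\!\!\int e^{-i(\xi x+\tau t)}u(x,t)\,dx\,dt$ is a function, put, for real $s,b,\alpha$, $$\|u\|_{X^{s,b}}^2=\int_{\mathbb R}\int_{\mathbb R}(1+|\xi|)^{2s}(1+|\tau-\xi^m|)^{2b}|\widehat u(\xi,\tau)|^2\,d\xi\,d\tau,$$ $$\|u\|_{X^{s,b,\alpha}}^2=\|u\|_{X^{s,b}}^2+\int_{\mathbb R}\int_{-1}^{1}(1+|\tau|)^{2\alpha}|\widehat u(\xi,\tau)|^2\,d\xi\,d\tau,$$ $$\|u\|_{Y^{s,b}}^2=\int_{\mathbb R}\int_{\mathbb R}(1+|\tau|)^{2s/m}(1+|\tau-\xi^m|)^{2b}|\widehat u(\xi,\tau)|^2\,d\xi\,d\tau,$$ and for a tempered distribution $g$ on $\mathbb R$ whose Fourier transform is a function, $\|g\|_{H^\mu(\mathbb R)}^2=\int_{\mathbb R}(1+|\tau|)^{2\mu}|\widehat g(\tau)|^2\,d\tau$. A *cutoff*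 is a function $\psi\in C_0^\infty(-1,1)$ with $0\le\psi\le1$ and $\psi(t)=1$ for $|t|\le\frac12$. For $w\in X^{s,-b}$ with $0<b<\frac12$, let $W=S[0;w]$ be the solution of the forced linear problem $\partial_tW+(-1)^{j+1}\partial_x^{m}W=w$, $W(x,0)=0$, $(x,t)\in\mathbb R^2$, that is given by Duhamel's formula $$S[0;w](x,t)=\frac1{2\pi}\int_{\mathbb R}e^{i\xi x}\int_0^t e^{i\xi^m(t-t')}\,\widehat w^{\,x}(\xi,t')\,dt'\,d\xi .$$ Here $\widehat w^{\,x}$ is the Fourier transform of $w$ in $x$ only, the inner integral is understood as $\frac1{2\pi}\int_{\mathbb R}\widehat w(\xi,\tau)\int_0^te^{i\xi^m(t-t')}e^{i\tau t'}dt'\,d\tau$ (absolutely convergent for almost every $\xi$ and all $t$), and the $\xi$-integral as the inverse Fourier transform of tempered distributions. 1. *(Bourgain space estimate.)* There are numbers $c_\psi\ge 0$, depending only on the cutoff $\psi$, such that for all $j\ge1$, all $s\in\mathbb R$ and all $0<b<\frac12<\alpha<1$ there is a constant $C$, depending only on $j,s,b,\alpha$, such that for every cutoff $\psi$ and every $w\in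 X^{s,-b,\alpha-1}$ the solution $S[0;w]$ is well defined and $$\|\psi(t)\,S[0;w]\|_{X^{s,b,\alpha}}\le C\,c_\psi\,\|w\|_{X^{s,-b,\alpha-1}} .$$ 2. *(Time estimate.)* Let $j\ge1$, let $\psi$ be a cutoff, $\ell\in\{0,1,\dots,j-1\}$, $s\in\mathbb R$ and $0<b<\frac12$. There is a constant $C$, depending only on $j$, $\psi$, $\ell$, $s$, $b$, such that: (a) if $-1\le s\le\frac12$ and $w\in X^{s,-b}$, then $S[0;w]$ is well defined, the traces $\partial_x^\ell S[0;w](x,\cdot)$ exist for every $x\in\mathbb R$ as tempered distributions in $t$ that depend weakly continuously on $x$, and $$\sup_{x\in\mathbb R}\big\|\psi(t)\,\partial_x^\ell S[0;w](x,t)\big\|_{H_t^{(s+j-\ell)/m}(\mathbb R)}\le C\,\|w\|_{X^{s,-b}};$$ (b) for any real $s$ and $w\in X^{s,-b}\cap Y^{s,-b}$, $S[0;w]$ and the traces exist in the same sense, and $$\sup_{x\in\mathbb R}\big\|\psi(t)\,\partial_x^\ell S[0;w](x,t)\big\|_{H_t^{(s+j-\ell)/m}(\mathbb R)}\le C\,\big(\|w\|_{X^{s,-b}}+\|w\|_{Y^{s,-b}}\big).$$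 -/

import Mathlib

open MeasureTheory SchwartzMap Set
open scoped ENNReal NNReal

namespace KdVm

noncomputable section

/-! ### Fourier transforms

Conventions: `û(ξ,τ) = ∫∫ e^{-i(ξx+τt)} u(x,t) dx dt`, and points of `ℝ × ℝ` are `(x,t)` in physical
space and `(ξ,τ)` in frequency space. All distributions are complex valued. -/

/-- The integral `∫∫ e^{i(ξx+τt)} φ(x,t) dx dt` of a test function `φ`, at `p = (ξ,τ)`. -/
def conjFourier₂ (φ : 𝓢(ℝ × ℝ, ℂ)) (p : ℝ × ℝ) : ℂ :=
  ∫ q : ℝ × ℝ, Complex.exp (Complex.I * ((p.1 * q.1 + p.2 * q.2 : ℝ) : ℂ)) * φ q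

/-- The integral `∫ e^{iτt} φ(t) dt` of a test function `φ`. -/
def conjFourier₁ (φ : 𝓢(ℝ, ℂ)) (τ : ℝ) : ℂ :=
  ∫ t : ℝ, Complex.exp (Complex.I * ((τ * t : ℝ) : ℂ)) * φ t

/-- The integral `∫ e^{iξx} φ(x,t) dx` of a test function `φ`, in the space variable only. -/
def conjFourierSpace (φ : 𝓢(ℝ × ℝ, ℂ)) (ξ t : ℝ) : ℂ :=
  ∫ x : ℝ, Complex.exp (Complex.I * ((ξ * x : ℝ) : ℂ)) * φ (x, t)

/-- The space-time Fourier transform of the tempered distribution `u` is the function `uh`, that is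
`u = (2π)⁻² ∫∫ e^{i(ξx+τt)} uh(ξ,τ) dξ dτ` as a tempered distribution.
Such a `uh` is unique up to a null set. -/
def HasFourier₂ (u : 𝓢'(ℝ × ℝ, ℂ)) (uh : ℝ × ℝ → ℂ) : Prop :=
  AEStronglyMeasurable uh volume ∧
  ∀ φ : 𝓢(ℝ × ℝ, ℂ),
    Integrable (fun p => uh p * conjFourier₂ φ p) volume ∧
    u φ = ((2 * Real.pi : ℝ) : ℂ)⁻¹ ^ 2 * ∫ p, uh p * conjFourier₂ φ p

/-- The Fourier transform of the tempered distribution `u` on the line is the function `uh`. -/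
def HasFourier₁ (u : 𝓢'(ℝ, ℂ)) (uh : ℝ → ℂ) : Prop :=
  AEStronglyMeasurable uh volume ∧
  ∀ φ : 𝓢(ℝ, ℂ),
    Integrable (fun τ => uh τ * conjFourier₁ φ τ) volume ∧
    u φ = ((2 * Real.pi : ℝ) : ℂ)⁻¹ * ∫ τ, uh τ * conjFourier₁ φ τ

/-- The Fourier transform in `x` of the tempered distribution `u` on space-time is the function
`(ξ,t) ↦ g ξ t`, that is `u(x,t) = (2π)⁻¹ ∫ e^{iξx} g(ξ,t) dξ` as a tempered distribution. -/
def HasSpaceFourier (u : 𝓢'(ℝ × ℝ, ℂ)) (g : ℝ → ℝ → ℂ) : Prop :=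
  AEStronglyMeasurable (fun p : ℝ × ℝ => g p.1 p.2) volume ∧
  ∀ φ : 𝓢(ℝ × ℝ, ℂ),
    Integrable (fun p : ℝ × ℝ => g p.1 p.2 * conjFourierSpace φ p.1 p.2) volume ∧
    u φ = ((2 * Real.pi : ℝ) : ℂ)⁻¹ * ∫ p : ℝ × ℝ, g p.1 p.2 * conjFourierSpace φ p.1 p.2

/-! ### Norms

The norms take values in `[0,∞]`. The Fourier transform being unique up to null sets, each infimum
below is over a single value, or is `∞` if the Fourier transform is not a function. -/

/-- `(∫∫ ω(ξ,τ) |û(ξ,τ)|² dξ dτ)^{1/2}`. -/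
def weightedNorm₂ (ω : ℝ × ℝ → ℝ) (u : 𝓢'(ℝ × ℝ, ℂ)) : ℝ≥0∞ :=
  ⨅ (uh : ℝ × ℝ → ℂ) (_ : HasFourier₂ u uh),
    (∫⁻ p, ENNReal.ofReal (ω p) * ‖uh p‖ₑ ^ 2) ^ (1 / 2 : ℝ)

/-- The Bourgain norm of `X^{s,b}`, for the dispersion relation `τ = ξ^m`. -/
def XNorm (m : ℕ) (s b : ℝ) : 𝓢'(ℝ × ℝ, ℂ) → ℝ≥0∞ :=
  weightedNorm₂ fun p => (1 + |p.1|) ^ (2 * s) * (1 + |p.2 - p.1 ^ m|) ^ (2 * b)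

/-- The modified Bourgain norm of `X^{s,b,α}`. -/
def XModNorm (m : ℕ) (s b α : ℝ) : 𝓢'(ℝ × ℝ, ℂ) → ℝ≥0∞ :=
  weightedNorm₂ fun p => (1 + |p.1|) ^ (2 * s) * (1 + |p.2 - p.1 ^ m|) ^ (2 * b)
    + (Icc (-1 : ℝ) 1).indicator (fun _ => (1 + |p.2|) ^ (2 * α)) p.1

/-- The temporal Bourgain norm of `Y^{s,b}`. -/
def YNorm (m : ℕ) (s b : ℝ) : 𝓢'(ℝ × ℝ, ℂ) → ℝ≥0∞ :=
  weightedNorm₂ fun p => (1 + |p.2|) ^ (2 * s / m) * (1 + |p.2 - p.1 ^ m|) ^ (2 * b)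

/-- The Sobolev norm of `H^μ(ℝ)`. -/
def sobolevNorm (μ : ℝ) (u : 𝓢'(ℝ, ℂ)) : ℝ≥0∞ :=
  ⨅ (uh : ℝ → ℂ) (_ : HasFourier₁ u uh),
    (∫⁻ τ, ENNReal.ofReal ((1 + |τ|) ^ (2 * μ)) * ‖uh τ‖ₑ ^ 2) ^ (1 / 2 : ℝ)

/-! ### The Duhamel solution -/

/-- `∫₀ᵗ e^{iξ^m(t-t')} e^{iτt'} dt'`, the response of the mode `ξ` to the forcing `e^{iτt'}`. -/
def duhamelKernel (m : ℕ) (ξ τ t : ℝ) : ℂ :=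
  ∫ t' in (0 : ℝ)..t, Complex.exp (Complex.I * ((ξ ^ m * (t - t') : ℝ) : ℂ)) *
    Complex.exp (Complex.I * ((τ * t' : ℝ) : ℂ))

/-- The Duhamel integral `∫₀ᵗ e^{iξ^m(t-t')} ŵˣ(ξ,t') dt'`, where
`ŵˣ(ξ,t') = (2π)⁻¹ ∫ e^{iτt'} ŵ(ξ,τ) dτ` is the Fourier transform of `w` in `x` only.
When `ŵ(ξ,·)` is integrable this is literally so, see `duhamelHat_eq`. For `w` in `X^{s,-b}`,
`b < 1/2`, the function `ŵ(ξ,·)` need not be integrable and `ŵˣ(ξ,·)` is only a distribution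
in `t'`, which is paired with the function `t' ↦ 1_{[0,t]}(t') e^{iξ^m(t-t')}`: the `t'`-integral
is carried out before the `τ`-integral. -/
def duhamelHat (m : ℕ) (wh : ℝ × ℝ → ℂ) (ξ t : ℝ) : ℂ :=
  ((2 * Real.pi : ℝ) : ℂ)⁻¹ * ∫ τ : ℝ, wh (ξ, τ) * duhamelKernel m ξ τ t

theorem duhamelHat_eq (m : ℕ) (wh : ℝ × ℝ → ℂ) (ξ t : ℝ)
    (h : Integrable (fun τ : ℝ => wh (ξ, τ)) volume) :
    duhamelHat m wh ξ t =
      ∫ t' in (0 : ℝ)..t, Complex.exp (Complex.I * ((ξ ^ m * (t - t') : ℝ) : ℂ)) *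
        (((2 * Real.pi : ℝ) : ℂ)⁻¹ *
          ∫ τ : ℝ, Complex.exp (Complex.I * ((τ * t' : ℝ) : ℂ)) * wh (ξ, τ)) := by
  have : IsFiniteMeasure ((volume : Measure ℝ).restrict (uIoc 0 t)) :=
    ⟨by simp [uIoc]⟩
  have hF : Integrable (Function.uncurry fun τ t' : ℝ => wh (ξ, τ) *
      (Complex.exp (Complex.I * ((ξ ^ m * (t - t') : ℝ) : ℂ)) *
        Complex.exp (Complex.I * ((τ * t' : ℝ) : ℂ))))
      ((volume : Measure ℝ).prod (volume.restrict (uIoc 0 t))) := by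
    have h1 : Integrable (fun p : ℝ × ℝ => wh (ξ, p.1) * (1 : ℂ))
        ((volume : Measure ℝ).prod (volume.restrict (uIoc 0 t))) :=
      h.mul_prod (integrable_const (1 : ℂ))
    simp only [mul_one] at h1
    refine h1.mono (h1.aestronglyMeasurable.mul (Continuous.aestronglyMeasurable ?_)) ?_
    · fun_prop
    · refine Filter.Eventually.of_forall fun p => le_of_eq ?_
      simp only [Function.uncurry, norm_mul, mul_comm Complex.I, Complex.norm_exp_ofReal_mul_I,
        mul_one]
  simp only [duhamelHat, duhamelKernel, intervalIntegral.intervalIntegral_eq_integral_uIoc]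
  simp only [mul_smul_comm, integral_smul]
  congr 1
  simp only [← integral_const_mul]
  rw [integral_integral_swap (by simpa [Function.uncurry_def, integral_const_mul, mul_assoc] using hF.const_mul (((2 * Real.pi : ℝ) : ℂ)⁻¹))]
  congr 1
  ext t'
  congr 1
  ext τ
  ring

/-- `W` is the Duhamel solution `S[0;w]` of `∂ₜW + (-1)^{j+1} ∂ₓ^m W = w`, `W(·,0) = 0`, `m = 2j+1`:
`W(x,t) = (2π)⁻¹ ∫ ∫₀ᵗ e^{iξx + iξ^m(t-t')} ŵˣ(ξ,t') dt' dξ`.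
At most one `W` has this property, as the Fourier transform of `w` is unique up to a null set. -/
def IsDuhamel (m : ℕ) (w W : 𝓢'(ℝ × ℝ, ℂ)) : Prop :=
  ∃ wh : ℝ × ℝ → ℂ, HasFourier₂ w wh ∧
    (∀ᵐ ξ : ℝ, ∀ t : ℝ, Integrable (fun τ : ℝ => wh (ξ, τ) * duhamelKernel m ξ τ t) volume) ∧
    HasSpaceFourier W (duhamelHat m wh)

/-! ### Cut-offs, derivatives and traces -/

/-- `ψ ∈ C₀^∞(-1,1)`, `0 ≤ ψ ≤ 1` and `ψ = 1` on `[-1/2,1/2]`. -/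
structure IsCutoff (ψ : ℝ → ℝ) : Prop where
  contDiff : ContDiff ℝ (⊤ : ℕ∞) ψ
  tsupport_subset : tsupport ψ ⊆ Ioo (-1) 1
  nonneg : ∀ t, 0 ≤ ψ t
  le_one : ∀ t, ψ t ≤ 1
  eq_one : ∀ t, |t| ≤ 1 / 2 → ψ t = 1

/-- The product `ψ(t) u(x,t)`. -/
def cutTime₂ (ψ : ℝ → ℝ) (u : 𝓢'(ℝ × ℝ, ℂ)) : 𝓢'(ℝ × ℝ, ℂ) :=
  TemperedDistribution.smulLeftCLM ℂ (fun p : ℝ × ℝ => (ψ p.2 : ℂ)) u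

/-- The product `ψ(t) u(t)`. -/
def cutTime₁ (ψ : ℝ → ℝ) (u : 𝓢'(ℝ, ℂ)) : 𝓢'(ℝ, ℂ) :=
  TemperedDistribution.smulLeftCLM ℂ (fun t : ℝ => (ψ t : ℂ)) u

/-- The distributional derivative `∂ₓ^ℓ u`. -/
def xDeriv (ℓ : ℕ) (u : 𝓢'(ℝ × ℝ, ℂ)) : 𝓢'(ℝ × ℝ, ℂ) :=
  (LineDeriv.lineDerivOp ((1 : ℝ), (0 : ℝ)) : 𝓢'(ℝ × ℝ, ℂ) → 𝓢'(ℝ × ℝ, ℂ))^[ℓ] u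

/-- `T x` is the trace `V(x,·)`, a distribution in `t`, for every `x`: the distribution `V` is the
weakly continuous function `x ↦ T x` with values in the tempered distributions in `t`.
There is at most one such `T`. -/
def IsTrace (V : 𝓢'(ℝ × ℝ, ℂ)) (T : ℝ → 𝓢'(ℝ, ℂ)) : Prop :=
  (∀ φ : 𝓢(ℝ, ℂ), Continuous fun x => T x φ) ∧
  ∀ (χ φ : 𝓢(ℝ, ℂ)) (Φ : 𝓢(ℝ × ℝ, ℂ)), HasCompactSupport χ →
    (∀ x t, Φ (x, t) = χ x * φ t) → V Φ = ∫ x, χ x * T x φ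

end

end KdVm

/-! Write ⟨x⟩ = 1 + |x|. The forcing e^{iτt} drives the space mode ξ to (e^{iτt} - e^{iξ^m t}) /
(i(τ - ξ^m)). After multiplication by a Schwartz function φ(t), the transform of this at the time
frequency λ is a difference quotient of the transform of φ with nodes τ - λ and ξ^m - λ. Hence
(`exists_response_le`) it is at most q(φ) (⟨λ-τ⟩^{-r} + ⟨λ-ξ^m⟩^{-r}) ⟨τ-ξ^m⟩^{-1} for any r, with q
continuous on Schwartz space: a forced wave near λ = τ, a free wave near λ = ξ^m, and a gain of one
power of the distance to the dispersion curve. What remains are L² bounds for positive kernels.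

Space estimate: for fixed η = ξ^m, `Weight.exists_duhamel_le` passes from the weight ⟨τ-η⟩^{-a} to
⟨λ-η⟩^β whenever 0 ≤ a < 1/2 and a + β ≤ 1. The pair (b, b) gives the Bourgain part. The pair (1-α,
α) gives the low frequency part, because |ξ| ≤ 1 makes ⟨λ⟩ and ⟨λ-ξ^m⟩ comparable. The cutoff enters
only through q, taken with r = 3.

Time estimate: the transform in t of the cut-off trace at x is an integral over ξ containing x only
in the factor e^{iξx}, so absolute values give a bound uniform in x. For the forced wave,
Cauchy-Schwarz leaves ∫ ⟨ξ⟩^{2(ℓ-s')} ⟨τ-ξ^m⟩^{2b-2} dξ, and the substitution η = ξ^m bounds this by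
⟨τ⟩^{-θ} with θ = 2(s'+j-ℓ)/m, provided 0 ≤ θ ≤ 1. This is the origin of -1 ≤ s' ≤ 1/2. The forcing
is measured with ⟨ξ⟩^{s'} ⟨τ⟩^{(s-s')/m}: s' = s gives (a) and s' = 0 gives (b). The free wave
decays in λ - ξ^m as fast as desired and puts no restriction on s
(`Weight.exists_trace_pointwise_le`).

Fubini and Fourier inversion, mode by mode, identify these integrals with the transforms of the
distributions in the statement; uniqueness of transforms and of traces extends the bounds to every
solution and every trace. -/

open scoped FourierTransform LineDeriv

/-! ### Weights `1 + |x|` -/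

namespace Weight

lemma pos (x : ℝ) : 0 < 1 + |x| := by positivity

lemma one_le (x : ℝ) : 1 ≤ 1 + |x| := by linarith [abs_nonneg x]

lemma add_le (x y : ℝ) : 1 + |x + y| ≤ (1 + |x|) * (1 + |y|) := by
  nlinarith [abs_add_le x y, abs_nonneg x, abs_nonneg y, mul_nonneg (abs_nonneg x) (abs_nonneg y)]

lemma sub_le (x y : ℝ) : 1 + |x - y| ≤ (1 + |x|) * (1 + |y|) := by
  simpa [sub_eq_add_neg] using add_le x (-y)

/-- Peetre's inequality. -/
lemma peetre (r x y : ℝ) : (1 + |x|) ^ r ≤ (1 + |y|) ^ r * (1 + |x - y|) ^ |r| := by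
  rcases le_total 0 r with hr | hr
  · rw [abs_of_nonneg hr, ← Real.mul_rpow (pos y).le (pos _).le]
    refine Real.rpow_le_rpow (pos x).le ?_ hr
    simpa using add_le y (x - y)
  · have h : (1 + |y|) ≤ (1 + |x|) * (1 + |x - y|) := by simpa using sub_le x (x - y)
    have h2 : ((1 + |x|) * (1 + |x - y|)) ^ r ≤ (1 + |y|) ^ r :=
      Real.rpow_le_rpow_of_nonpos (pos y) h hr
    rw [Real.mul_rpow (pos x).le (pos _).le] at h2
    rw [abs_of_nonpos hr]
    have h3 : (0 : ℝ) < (1 + |x - y|) ^ (-r) := Real.rpow_pos_of_pos (pos _) _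
    have h4 : (1 + |x - y|) ^ r * (1 + |x - y|) ^ (-r) = 1 := by
      rw [← Real.rpow_add (pos _)]; simp
    calc (1 + |x|) ^ r = (1 + |x|) ^ r * (1 + |x - y|) ^ r * (1 + |x - y|) ^ (-r) := by
          rw [mul_assoc, h4, mul_one]
      _ ≤ _ := mul_le_mul_of_nonneg_right h2 h3.le

lemma lintegral_lt_top {κ : ℝ} (hκ : 1 < κ) :
    ∫⁻ x : ℝ, ENNReal.ofReal ((1 + |x|) ^ (-κ)) < ∞ := by
  have := finite_integral_one_add_norm (E := ℝ) (μ := volume) (r := κ) (by simpa using hκ)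
  simpa using this

lemma exists_lintegral_le {κ : ℝ} (hκ : 1 < κ) : ∃ C : ℝ≥0, ∀ a : ℝ,
    ∫⁻ x : ℝ, ENNReal.ofReal ((1 + |x - a|) ^ (-κ)) ≤ C ∧
    ∫⁻ x : ℝ, ENNReal.ofReal ((1 + |a - x|) ^ (-κ)) ≤ C := by
  lift ∫⁻ x : ℝ, ENNReal.ofReal ((1 + |x|) ^ (-κ)) to ℝ≥0 using (lintegral_lt_top hκ).ne with C hC
  refine ⟨C, fun a => ?_⟩
  have h : ∫⁻ x : ℝ, ENNReal.ofReal ((1 + |x - a|) ^ (-κ)) ≤ C := by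
    rw [hC]
    exact (lintegral_sub_right_eq_self (fun x : ℝ => ENNReal.ofReal ((1 + |x|) ^ (-κ))) a).le
  refine ⟨h, ?_⟩
  simpa only [abs_sub_comm a] using h

lemma measurable_rpow (r : ℝ) : Measurable fun x : ℝ => (1 + |x|) ^ r := by
  have : Measurable fun x : ℝ => 1 + |x| := by fun_prop
  exact this.pow_const r

end Weight

/-- Cauchy-Schwarz. -/
lemma ENNReal.sq_lintegral_mul_le {α : Type*} [MeasurableSpace α] {μ : Measure α}
    {F G : α → ℝ≥0∞} (hF : AEMeasurable F μ) (hG : AEMeasurable G μ) :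
    (∫⁻ x, F x * G x ∂μ) ^ 2 ≤ (∫⁻ x, F x ^ 2 ∂μ) * ∫⁻ x, G x ^ 2 ∂μ := by
  have h := ENNReal.lintegral_mul_le_Lp_mul_Lq μ Real.HolderConjugate.two_two hF hG
  simp only [Pi.mul_apply, ENNReal.rpow_ofNat] at h
  calc (∫⁻ x, F x * G x ∂μ) ^ 2 ≤ _ := pow_le_pow_left₀ (zero_le) h 2
    _ = _ := by
      rw [mul_pow, ← ENNReal.rpow_natCast, ← ENNReal.rpow_natCast, ← ENNReal.rpow_mul,
        ← ENNReal.rpow_mul]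
      norm_num

/-- Cauchy-Schwarz with weights. -/
lemma sq_lintegral_mul_weight_le {α : Type*} [MeasurableSpace α] {μ : Measure α}
    {F : α → ℝ≥0∞} {a u v : α → ℝ} (hF : Measurable F) (hu : Measurable u) (hv : Measurable v)
    (hu0 : ∀ x, 0 ≤ u x) (h : ∀ x, a x ≤ u x * v x) :
    (∫⁻ x, F x * ENNReal.ofReal (a x) ∂μ) ^ 2 ≤
      (∫⁻ x, ENNReal.ofReal (u x ^ 2) * F x ^ 2 ∂μ) * ∫⁻ x, ENNReal.ofReal (v x) ^ 2 ∂μ := by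
  calc (∫⁻ x, F x * ENNReal.ofReal (a x) ∂μ) ^ 2
      ≤ (∫⁻ x, (ENNReal.ofReal (u x) * F x) * ENNReal.ofReal (v x) ∂μ) ^ 2 := by
        refine pow_le_pow_left₀ zero_le (lintegral_mono fun x => ?_) 2
        calc F x * ENNReal.ofReal (a x) ≤ F x * ENNReal.ofReal (u x * v x) := by
              gcongr; exact h x
          _ = _ := by rw [ENNReal.ofReal_mul (hu0 x)]; ring
    _ ≤ _ := by
        refine (ENNReal.sq_lintegral_mul_le (hu.ennreal_ofReal.mul hF).aemeasurable
          hv.ennreal_ofReal.aemeasurable).trans (le_of_eq ?_)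
        congr 2
        ext x
        rw [Pi.mul_apply, mul_pow, ENNReal.ofReal_pow (hu0 x)]

/-! ### Integrals of weights along the dispersion curve -/

namespace Weight

lemma one_add_abs_pow_le (m : ℕ) (ξ : ℝ) : 1 + |ξ ^ m| ≤ 2 * (1 + |ξ|) ^ m := by
  have h1 : |ξ| ^ m ≤ (1 + |ξ|) ^ m := by gcongr; linarith
  have h2 : 1 ≤ (1 + |ξ|) ^ m := one_le_pow₀ (one_le ξ)
  rw [abs_pow]; linarith

lemma pow_le_one_add_abs_pow (m : ℕ) (ξ : ℝ) : (1 + |ξ|) ^ m ≤ 2 ^ m * (1 + |ξ ^ m|) := by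
  rw [abs_pow]
  rcases le_total |ξ| 1 with h | h
  · calc (1 + |ξ|) ^ m ≤ 2 ^ m := by gcongr; linarith
      _ ≤ _ := le_mul_of_one_le_right (by positivity) (by linarith [pow_nonneg (abs_nonneg ξ) m])
  · calc (1 + |ξ|) ^ m ≤ (2 * |ξ|) ^ m := by gcongr; linarith
      _ ≤ _ := by rw [mul_pow]; gcongr; linarith

/-- `(1 + |ξ|)^m` and `1 + |ξ^m|` are comparable. -/
lemma exists_rpow_le (m : ℕ) (θ : ℝ) : ∃ C : ℝ≥0, ∀ ξ : ℝ,
    (1 + |ξ|) ^ (m * θ) ≤ C * (1 + |ξ ^ m|) ^ θ := by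
  rcases le_total 0 θ with h | h
  · refine ⟨(2 ^ m : ℝ≥0) ^ θ, fun ξ => ?_⟩
    rw [Real.rpow_mul (pos ξ).le, Real.rpow_natCast, NNReal.coe_rpow,
      ← Real.mul_rpow (by positivity) (by positivity)]
    push_cast
    exact Real.rpow_le_rpow (by positivity) (pow_le_one_add_abs_pow m ξ) h
  · refine ⟨(2⁻¹ : ℝ≥0) ^ θ, fun ξ => ?_⟩
    rw [Real.rpow_mul (pos ξ).le, Real.rpow_natCast, NNReal.coe_rpow,
      ← Real.mul_rpow (by positivity) (by positivity)]
    refine Real.rpow_le_rpow_of_nonpos (by positivity) ?_ h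
    push_cast
    linarith [one_add_abs_pow_le m ξ]

/-- Under the substitution η = ξ^{2j+1} the weight is absorbed by the Jacobian (2j+1) ξ^{2j}. The
Jacobian degenerates only at ξ = 0, and on [-1,1] the integrand is bounded. -/
lemma exists_lintegral_dispersion_le (j : ℕ) {κ : ℝ} (hκ : 1 < κ) : ∃ C : ℝ≥0, ∀ τ : ℝ,
    ∫⁻ ξ : ℝ, ENNReal.ofReal ((1 + |ξ|) ^ (2 * j : ℝ) * (1 + |τ - ξ ^ (2 * j + 1)|) ^ (-κ)) ≤ C := by
  obtain ⟨C, hC⟩ := exists_lintegral_le hκ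
  -- The summand 2 is the length of [-1,1]; the factor 2^{2j} comes from 1 + |ξ| ≤ 2 max(1, |ξ|).
  refine ⟨2 ^ (2 * j) * (2 + C), fun τ => ?_⟩
  have hpt : ∀ ξ : ℝ,
      ENNReal.ofReal ((1 + |ξ|) ^ (2 * j : ℝ) * (1 + |τ - ξ ^ (2 * j + 1)|) ^ (-κ)) ≤
      2 ^ (2 * j) * ((Icc (-1 : ℝ) 1).indicator 1 ξ +
        ENNReal.ofReal |((2 * j + 1 : ℕ) : ℝ) * ξ ^ (2 * j)| *
          ENNReal.ofReal ((1 + |τ - ξ ^ (2 * j + 1)|) ^ (-κ))) := by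
    intro ξ
    have e : (1 + |ξ|) ^ (2 * j : ℝ) = (1 + |ξ|) ^ (2 * j) := by
      rw [← Real.rpow_natCast]; push_cast; rfl
    rw [e]
    have h1 : (1 + |τ - ξ ^ (2 * j + 1)|) ^ (-κ) ≤ 1 :=
      Real.rpow_le_one_of_one_le_of_nonpos (one_le _) (by linarith)
    have h0 : 0 ≤ (1 + |τ - ξ ^ (2 * j + 1)|) ^ (-κ) := by positivity
    have e2 : (2 : ℝ≥0∞) ^ (2 * j) = ENNReal.ofReal (2 ^ (2 * j)) := by
      rw [ENNReal.ofReal_pow (by norm_num)]; norm_num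
    by_cases h : |ξ| ≤ 1
    · have : ξ ∈ Icc (-1 : ℝ) 1 := abs_le.mp h
      rw [indicator_of_mem this, Pi.one_apply, mul_add, mul_one, e2]
      refine le_add_right (ENNReal.ofReal_le_ofReal ?_)
      calc _ ≤ (1 + |ξ|) ^ (2 * j) * 1 := by gcongr
        _ ≤ _ := by rw [mul_one]; gcongr; linarith
    · push Not at h
      rw [mul_add]
      refine le_add_left ?_
      rw [e2, ← ENNReal.ofReal_mul (abs_nonneg _), ← ENNReal.ofReal_mul (by positivity), ← mul_assoc]
      refine ENNReal.ofReal_le_ofReal (mul_le_mul_of_nonneg_right ?_ h0)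
      calc (1 + |ξ|) ^ (2 * j) ≤ (2 * |ξ|) ^ (2 * j) := by gcongr; linarith
        _ = 2 ^ (2 * j) * (1 * |ξ ^ (2 * j)|) := by rw [mul_pow, abs_pow, one_mul]
        _ ≤ _ := by
          rw [abs_mul]; gcongr
          rw [Nat.abs_cast]; push_cast; linarith [Nat.cast_nonneg (α := ℝ) j]
  have hsub : ∫⁻ ξ : ℝ, ENNReal.ofReal |((2 * j + 1 : ℕ) : ℝ) * ξ ^ (2 * j)| *
          ENNReal.ofReal ((1 + |τ - ξ ^ (2 * j + 1)|) ^ (-κ)) ≤ C := by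
    have hinj : InjOn (fun x : ℝ => x ^ (2 * j + 1)) univ :=
      (Odd.strictMono_pow ⟨j, rfl⟩).injective.injOn
    have := lintegral_image_eq_lintegral_abs_deriv_mul (s := univ) (f := fun x : ℝ => x ^ (2 * j + 1))
      (f' := fun x => ((2 * j + 1 : ℕ) : ℝ) * x ^ (2 * j)) MeasurableSet.univ
      (fun x _ => (hasDerivAt_pow (2 * j + 1) x).hasDerivWithinAt) hinj
      (fun η => ENNReal.ofReal ((1 + |τ - η|) ^ (-κ)))
    rw [setLIntegral_univ] at this
    rw [← this]
    exact (setLIntegral_le_lintegral _ _).trans (hC τ).2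
  refine (lintegral_mono hpt).trans ?_
  rw [lintegral_const_mul', lintegral_add_left]
  · rw [lintegral_indicator_one measurableSet_Icc, Real.volume_Icc]
    rw [ENNReal.coe_mul, ENNReal.coe_add]
    gcongr
    · norm_num
    · norm_num
  · exact measurable_one.indicator measurableSet_Icc
  · finiteness

/-- With η = ξ^{2j+1} the extra factor is comparable to ⟨η⟩^{-θ}. Since η and τ - η cannot both be
small compared with τ, one of the two decaying factors yields ⟨τ⟩^{-θ}. Only κ > 1 is needed because
θ ≤ 1; this suits the forced wave, where κ = 2 - 2b. -/
lemma exists_lintegral_dispersion_le_rpow (j : ℕ) {κ θ : ℝ} (hκ : 1 < κ) (h0 : 0 ≤ θ) (h1 : θ ≤ 1) :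
    ∃ C : ℝ≥0, ∀ τ : ℝ,
      ∫⁻ ξ : ℝ, ENNReal.ofReal ((1 + |ξ|) ^ (2 * j - (2 * j + 1 : ℕ) * θ) *
        (1 + |τ - ξ ^ (2 * j + 1)|) ^ (-κ)) ≤ C * ENNReal.ofReal ((1 + |τ|) ^ (-θ)) := by
  obtain ⟨C, hC⟩ := exists_lintegral_dispersion_le j hκ
  obtain ⟨D, hD⟩ := exists_rpow_le (2 * j + 1) (-θ)
  have h2 : (0 : ℝ) ≤ 2 ^ κ := by positivity
  have key : ∀ τ η : ℝ, (1 + |η|) ^ (-θ) * (1 + |τ - η|) ^ (-κ) ≤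
      2 ^ κ * (1 + |τ|) ^ (-θ) * ((1 + |τ - η|) ^ (-κ) + (1 + |0 - η|) ^ (-κ)) := by
    intro τ η
    have a1 := pos η
    have a2 := pos τ
    have a3 := pos (τ - η)
    have p1 : 0 < (1 + |τ - η|) ^ (-κ) := Real.rpow_pos_of_pos a3 _
    have p2 : 0 < (1 + |0 - η|) ^ (-κ) := Real.rpow_pos_of_pos (pos _) _
    have p3 : 0 < (1 + |τ|) ^ (-θ) := Real.rpow_pos_of_pos a2 _
    have hhalf : ∀ x r : ℝ, (1 + |τ|) / 2 ≤ 1 + |x| → 0 ≤ r → r ≤ κ →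
        (1 + |x|) ^ (-r) ≤ 2 ^ κ * (1 + |τ|) ^ (-r) := by
      intro x r hx hr hrκ
      calc (1 + |x|) ^ (-r) ≤ ((1 + |τ|) / 2) ^ (-r) :=
            Real.rpow_le_rpow_of_nonpos (by positivity) hx (by linarith)
        _ = 2 ^ r * (1 + |τ|) ^ (-r) := by
            rw [Real.div_rpow a2.le (by norm_num), Real.rpow_neg (by norm_num : (0:ℝ) ≤ 2)]
            field_simp
        _ ≤ _ := by
            refine mul_le_mul_of_nonneg_right ?_ (by positivity)
            exact Real.rpow_le_rpow_of_exponent_le (by norm_num) hrκ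
    by_cases h : (1 + |τ|) / 2 ≤ 1 + |η|
    · have := hhalf η θ h h0 (by linarith)
      calc _ ≤ 2 ^ κ * (1 + |τ|) ^ (-θ) * (1 + |τ - η|) ^ (-κ) := by gcongr
        _ ≤ _ := by gcongr; linarith
    · push Not at h
      have hx : (1 + |τ|) / 2 ≤ 1 + |τ - η| := by
        have := abs_sub_abs_le_abs_sub τ η
        linarith
      have := hhalf _ κ hx (by linarith) le_rfl
      -- Here η is the smaller frequency, so the surplus decay κ - θ may be moved from τ to η. This
      -- makes up the exponent -κ in η, that is, the dispersion integral at τ = 0.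
      have e : (1 + |τ|) ^ (-κ) = (1 + |τ|) ^ (-θ) * (1 + |τ|) ^ (θ - κ) := by
        rw [← Real.rpow_add a2]; ring_nf
      have e' : (1 + |0 - η|) ^ (-κ) = (1 + |η|) ^ (-θ) * (1 + |η|) ^ (θ - κ) := by
        rw [← Real.rpow_add a1]; simp only [zero_sub, abs_neg]; ring_nf
      have hmono : (1 + |τ|) ^ (θ - κ) ≤ (1 + |η|) ^ (θ - κ) :=
        Real.rpow_le_rpow_of_nonpos a1 (by linarith) (by linarith)
      calc _ ≤ (1 + |η|) ^ (-θ) * (2 ^ κ * ((1 + |τ|) ^ (-θ) * (1 + |η|) ^ (θ - κ))) := by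
            gcongr; rw [e] at this; exact this.trans (by gcongr)
        _ = 2 ^ κ * (1 + |τ|) ^ (-θ) * (1 + |0 - η|) ^ (-κ) := by rw [e']; ring
        _ ≤ _ := by gcongr; linarith
  refine ⟨D * 2 ^ κ * (2 * C), fun τ => ?_⟩
  set W : ℝ → ℝ → ℝ≥0∞ := fun τ ξ =>
    ENNReal.ofReal ((1 + |ξ|) ^ (2 * j : ℝ) * (1 + |τ - ξ ^ (2 * j + 1)|) ^ (-κ)) with hW
  have hWm : Measurable (W τ) := by
    refine Measurable.ennreal_ofReal ((measurable_rpow _).mul ?_)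
    exact (measurable_rpow (-κ)).comp (by fun_prop)
  calc _ ≤ ∫⁻ ξ : ℝ, ENNReal.ofReal (D * 2 ^ κ * (1 + |τ|) ^ (-θ)) * (W τ ξ + W 0 ξ) := by
        refine lintegral_mono fun ξ => ?_
        simp only [hW]
        rw [← ENNReal.ofReal_add (by positivity) (by positivity), ← ENNReal.ofReal_mul (by positivity)]
        refine ENNReal.ofReal_le_ofReal ?_
        calc _ = (1 + |ξ|) ^ (2 * j : ℝ) * ((1 + |ξ|) ^ ((2 * j + 1 : ℕ) * -θ) *
                (1 + |τ - ξ ^ (2 * j + 1)|) ^ (-κ)) := by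
              rw [← mul_assoc, ← Real.rpow_add (pos ξ)]; ring_nf
          _ ≤ (1 + |ξ|) ^ (2 * j : ℝ) * (D * (1 + |ξ ^ (2 * j + 1)|) ^ (-θ) *
                (1 + |τ - ξ ^ (2 * j + 1)|) ^ (-κ)) := by
              gcongr; exact hD ξ
          _ ≤ (1 + |ξ|) ^ (2 * j : ℝ) * (D * (2 ^ κ * (1 + |τ|) ^ (-θ) *
                ((1 + |τ - ξ ^ (2 * j + 1)|) ^ (-κ) + (1 + |0 - ξ ^ (2 * j + 1)|) ^ (-κ)))) := by
              rw [mul_assoc (D : ℝ)]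
              exact mul_le_mul_of_nonneg_left (mul_le_mul_of_nonneg_left (key _ _) D.2) (by positivity)
          _ = _ := by ring
    _ = ENNReal.ofReal (D * 2 ^ κ * (1 + |τ|) ^ (-θ)) * ((∫⁻ ξ, W τ ξ) + ∫⁻ ξ, W 0 ξ) := by
        rw [lintegral_const_mul' _ _ (by finiteness), lintegral_add_left hWm]
    _ ≤ ENNReal.ofReal (D * 2 ^ κ * (1 + |τ|) ^ (-θ)) * (C + C) := by gcongr <;> exact hC _
    _ = _ := by
        rw [ENNReal.ofReal_mul (by positivity), ENNReal.ofReal_mul (by positivity)]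
        have : ENNReal.ofReal (2 ^ κ) = ((2 ^ κ : ℝ≥0) : ℝ≥0∞) := by
          rw [← ENNReal.ofReal_coe_nnreal, NNReal.coe_rpow]; rfl
        rw [this, ENNReal.ofReal_coe_nnreal]; push_cast; ring

/-- Peetre's inequality moves the weight from ξ^m to τ at the price of |θ| powers of ⟨τ-ξ^m⟩. Any
real θ is allowed if κ is large, which suits the free wave. -/
lemma exists_lintegral_dispersion_le_rpow' (j : ℕ) {κ : ℝ} (θ : ℝ) (hκ : 1 + |θ| < κ) :
    ∃ C : ℝ≥0, ∀ τ : ℝ,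
      ∫⁻ ξ : ℝ, ENNReal.ofReal ((1 + |ξ|) ^ (2 * j - (2 * j + 1 : ℕ) * θ) *
        (1 + |τ - ξ ^ (2 * j + 1)|) ^ (-κ)) ≤ C * ENNReal.ofReal ((1 + |τ|) ^ (-θ)) := by
  obtain ⟨C, hC⟩ := exists_lintegral_dispersion_le j (κ := κ - |θ|) (by linarith)
  obtain ⟨D, hD⟩ := exists_rpow_le (2 * j + 1) (-θ)
  refine ⟨D * C, fun τ => ?_⟩
  calc _ ≤ ∫⁻ ξ : ℝ, ENNReal.ofReal (D * (1 + |τ|) ^ (-θ)) *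
        ENNReal.ofReal ((1 + |ξ|) ^ (2 * j : ℝ) * (1 + |τ - ξ ^ (2 * j + 1)|) ^ (-(κ - |θ|))) := by
        refine lintegral_mono fun ξ => ?_
        rw [← ENNReal.ofReal_mul (by positivity)]
        refine ENNReal.ofReal_le_ofReal ?_
        have hp := peetre (-θ) (ξ ^ (2 * j + 1)) τ
        rw [abs_neg, abs_sub_comm] at hp
        calc _ = (1 + |ξ|) ^ (2 * j : ℝ) * ((1 + |ξ|) ^ ((2 * j + 1 : ℕ) * -θ) *
                (1 + |τ - ξ ^ (2 * j + 1)|) ^ (-κ)) := by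
              rw [← mul_assoc, ← Real.rpow_add (pos ξ)]; ring_nf
          _ ≤ (1 + |ξ|) ^ (2 * j : ℝ) * (D * ((1 + |τ|) ^ (-θ) * (1 + |τ - ξ ^ (2 * j + 1)|) ^ |θ|) *
                (1 + |τ - ξ ^ (2 * j + 1)|) ^ (-κ)) := by
              gcongr; exact (hD ξ).trans (by gcongr)
          _ = _ := by
              have e : (1 + |τ - ξ ^ (2 * j + 1)|) ^ (-(κ - |θ|)) =
                  (1 + |τ - ξ ^ (2 * j + 1)|) ^ |θ| * (1 + |τ - ξ ^ (2 * j + 1)|) ^ (-κ) := by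
                rw [← Real.rpow_add (pos _)]; ring_nf
              rw [e]; ring
    _ ≤ ENNReal.ofReal (D * (1 + |τ|) ^ (-θ)) * C := by
        rw [lintegral_const_mul' _ _ (by finiteness)]; gcongr; exact hC τ
    _ = _ := by
        rw [ENNReal.ofReal_mul (by positivity), ENNReal.ofReal_coe_nnreal]; push_cast; ring

end Weight

/-- Cauchy-Schwarz with a kernel dominated by a sum of two products. -/
lemma sq_lintegral_mul_two_weights_le {α : Type*} [MeasurableSpace α] {μ : Measure α}
    {F : α → ℝ≥0∞} {a u₁ u₂ v₁ v₂ : α → ℝ} (hF : Measurable F) (hu₁ : Measurable u₁)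
    (hu₂ : Measurable u₂) (hv₁ : Measurable v₁) (hv₂ : Measurable v₂)
    (hu₁' : ∀ x, 0 ≤ u₁ x) (hu₂' : ∀ x, 0 ≤ u₂ x) (hv₁' : ∀ x, 0 ≤ v₁ x) (hv₂' : ∀ x, 0 ≤ v₂ x)
    (h : ∀ x, a x ≤ u₁ x * v₁ x + u₂ x * v₂ x) :
    (∫⁻ x, F x * ENNReal.ofReal (a x) ∂μ) ^ 2 ≤
      4 * (∫⁻ x, ENNReal.ofReal (u₁ x ^ 2 + u₂ x ^ 2) * F x ^ 2 ∂μ) *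
        (∫⁻ x, ENNReal.ofReal (v₁ x ^ 2) ∂μ + ∫⁻ x, ENNReal.ofReal (v₂ x ^ 2) ∂μ) := by
  have h2 : ∀ x y : ℝ, (x + y) ^ 2 ≤ 2 * (x ^ 2 + y ^ 2) := fun x y => by nlinarith [sq_nonneg (x - y)]
  refine (sq_lintegral_mul_weight_le (u := fun x => u₁ x + u₂ x) (v := fun x => v₁ x + v₂ x) hF
    (hu₁.add hu₂) (hv₁.add hv₂) (fun x => add_nonneg (hu₁' x) (hu₂' x)) (fun x => ?_)).trans ?_
  -- The sum of the two products is at most (u₁ + u₂)(v₁ + v₂), the cross terms being nonnegative;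
  -- squaring each sum then costs a factor 2, hence the constant 4.
  · nlinarith [h x, mul_nonneg (hu₁' x) (hv₂' x), mul_nonneg (hu₂' x) (hv₁' x)]
  · have e1 : ∫⁻ x, ENNReal.ofReal ((u₁ x + u₂ x) ^ 2) * F x ^ 2 ∂μ ≤
        2 * ∫⁻ x, ENNReal.ofReal (u₁ x ^ 2 + u₂ x ^ 2) * F x ^ 2 ∂μ := by
      rw [← lintegral_const_mul' _ _ (by finiteness)]
      refine lintegral_mono fun x => ?_
      rw [← mul_assoc]
      gcongr
      calc _ ≤ ENNReal.ofReal (2 * (u₁ x ^ 2 + u₂ x ^ 2)) := ENNReal.ofReal_le_ofReal (h2 _ _)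
        _ = _ := by rw [ENNReal.ofReal_mul (by norm_num)]; norm_num
    have e2 : ∫⁻ x, ENNReal.ofReal (v₁ x + v₂ x) ^ 2 ∂μ ≤
        2 * (∫⁻ x, ENNReal.ofReal (v₁ x ^ 2) ∂μ + ∫⁻ x, ENNReal.ofReal (v₂ x ^ 2) ∂μ) := by
      rw [← lintegral_add_left (hv₁.pow_const 2).ennreal_ofReal,
        ← lintegral_const_mul' _ _ (by finiteness)]
      refine lintegral_mono fun x => ?_
      rw [← ENNReal.ofReal_pow (add_nonneg (hv₁' x) (hv₂' x))]
      calc _ ≤ ENNReal.ofReal (2 * (v₁ x ^ 2 + v₂ x ^ 2)) := ENNReal.ofReal_le_ofReal (h2 _ _)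
        _ = _ := by
          rw [ENNReal.ofReal_mul (by norm_num), ENNReal.ofReal_add (by positivity) (by positivity)]
          norm_num
    calc _ ≤ _ := mul_le_mul' e1 e2
      _ = _ := by ring

/-! ### The positive Duhamel kernel in one space mode -/

namespace Weight

lemma sq_rpow (x r : ℝ) : ((1 + |x|) ^ r) ^ 2 = (1 + |x|) ^ (2 * r) := by
  rw [← Real.rpow_natCast, ← Real.rpow_mul (pos x).le]; push_cast; ring_nf

lemma rpow_mul_rpow (x r t : ℝ) : (1 + |x|) ^ r * (1 + |x|) ^ t = (1 + |x|) ^ (r + t) :=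
  (Real.rpow_add (pos x) r t).symm

lemma measurable_rpow_comp {α : Type*} [MeasurableSpace α] {g : α → ℝ} (hg : Measurable g) (r : ℝ) :
    Measurable fun x => (1 + |g x|) ^ r := (measurable_rpow r).comp hg

lemma rpow_mono {x r t : ℝ} (h : r ≤ t) : (1 + |x|) ^ r ≤ (1 + |x|) ^ t :=
  Real.rpow_le_rpow_of_exponent_le (one_le x) h

lemma ofReal_rpow_neg_mul {x r : ℝ} {A : ℝ≥0∞} :
    ENNReal.ofReal ((1 + |x|) ^ r) * (A * ENNReal.ofReal ((1 + |x|) ^ (-r))) = A := by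
  rw [mul_left_comm, ← ENNReal.ofReal_mul (by positivity), rpow_mul_rpow]; simp

/-- The `L²` bound, pointwise in the output frequency `lam`, for the time cut-off Duhamel operator at
a fixed space frequency with `ξ^m = η`. -/
lemma exists_duhamel_pointwise_le {a β : ℝ} (ha0 : 0 ≤ a) (ha : a < 1 / 2) (hab : a + β ≤ 1) : ∃ C : ℝ≥0, ∀ (F : ℝ → ℝ≥0∞), Measurable F → ∀ η lam : ℝ,
      ENNReal.ofReal ((1 + |lam - η|) ^ (2 * β)) * (∫⁻ τ, F τ * ENNReal.ofReal
        (((1 + |lam - τ|) ^ (-3 : ℝ) + (1 + |lam - η|) ^ (-3 : ℝ)) * (1 + |τ - η|) ^ (-1 : ℝ))) ^ 2 ≤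
      C * ∫⁻ τ, ENNReal.ofReal ((1 + |τ - η|) ^ (2 * -a) *
        ((1 + |lam - τ|) ^ (-2 : ℝ) + (1 + |lam - η|) ^ (-2 : ℝ))) * F τ ^ 2 := by
  obtain ⟨C₁, hC₁⟩ := exists_lintegral_le (κ := 2 + 2 * a) (by linarith)
  obtain ⟨C₂, hC₂⟩ := exists_lintegral_le (κ := 2 - 2 * a) (by linarith)
  refine ⟨4 * (C₁ + C₂), fun F hF η lam => ?_⟩
  -- The exponent -1 of ⟨τ-η⟩ is split into -a, the weight of the input, and a - 1. The exponent -3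
  -- is split as -1 - 2, so that the squared `u` factors keep an exponent -2, integrable in `lam`.
  have hcs := sq_lintegral_mul_two_weights_le (μ := volume)
    (a := fun τ => ((1 + |lam - τ|) ^ (-3 : ℝ) + (1 + |lam - η|) ^ (-3 : ℝ)) * (1 + |τ - η|) ^ (-1 : ℝ))
    (u₁ := fun τ => (1 + |τ - η|) ^ (-a) * (1 + |lam - τ|) ^ (-1 : ℝ))
    (u₂ := fun τ => (1 + |τ - η|) ^ (-a) * (1 + |lam - η|) ^ (-1 : ℝ))
    (v₁ := fun τ => (1 + |τ - η|) ^ (a - 1) * (1 + |lam - τ|) ^ (-2 : ℝ))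
    (v₂ := fun τ => (1 + |τ - η|) ^ (a - 1) * (1 + |lam - η|) ^ (-2 : ℝ)) hF
    ((measurable_rpow_comp (by fun_prop) _).mul (measurable_rpow_comp (by fun_prop) _))
    ((measurable_rpow_comp (by fun_prop) _).mul (measurable_rpow_comp (by fun_prop) _))
    ((measurable_rpow_comp (by fun_prop) _).mul (measurable_rpow_comp (by fun_prop) _))
    ((measurable_rpow_comp (by fun_prop) _).mul (measurable_rpow_comp (by fun_prop) _))
    (fun _ => by positivity) (fun _ => by positivity) (fun _ => by positivity)
    (fun _ => by positivity) (fun τ => by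
      have e1 := rpow_mul_rpow (τ - η) (-a) (a - 1)
      have e2 := rpow_mul_rpow (lam - τ) (-1) (-2)
      have e3 := rpow_mul_rpow (lam - η) (-1) (-2)
      ring_nf at e1 e2 e3 ⊢
      rw [← e1, ← e2, ← e3]
      ring_nf
      rfl)
  have hv1 : ∫⁻ τ, ENNReal.ofReal (((1 + |τ - η|) ^ (a - 1) * (1 + |lam - τ|) ^ (-2 : ℝ)) ^ 2) ≤
      C₁ * ENNReal.ofReal ((1 + |lam - η|) ^ (-(2 * β))) := by
    calc _ ≤ ∫⁻ τ, ENNReal.ofReal ((1 + |lam - η|) ^ (-(2 * β))) *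
          ENNReal.ofReal ((1 + |lam - τ|) ^ (-(2 + 2 * a))) := by
          refine lintegral_mono fun τ => ?_
          rw [← ENNReal.ofReal_mul (by positivity)]
          refine ENNReal.ofReal_le_ofReal ?_
          rw [mul_pow, sq_rpow, sq_rpow]
          -- Replacing τ by `lam` in ⟨τ-η⟩^{2(a-1)} uses 2 - 2a of the four powers of ⟨lam-τ⟩; the
          -- other 2 + 2a make the τ-integral converge. The hypothesis a + β ≤ 1 then gives 2(a-1) ≤
          -- -2β.
          have hp := peetre (2 * (a - 1)) (τ - η) (lam - η)
          rw [show τ - η - (lam - η) = -(lam - τ) by ring, abs_neg, abs_of_nonpos (a := 2 * (a - 1)) (by linarith)] at hp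
          calc _ ≤ (1 + |lam - η|) ^ (2 * (a - 1)) * (1 + |lam - τ|) ^ (-(2 * (a - 1))) *
                (1 + |lam - τ|) ^ (2 * (-2) : ℝ) := by gcongr
            _ = (1 + |lam - η|) ^ (2 * (a - 1)) * (1 + |lam - τ|) ^ (-(2 + 2 * a)) := by
                rw [mul_assoc, rpow_mul_rpow]; ring_nf
            _ ≤ _ := by
                refine mul_le_mul_of_nonneg_right (rpow_mono (by linarith)) (by positivity)
      _ ≤ _ := by
          rw [lintegral_const_mul' _ _ (by finiteness), mul_comm]
          gcongr
          exact (hC₁ lam).2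
  -- For the free wave the τ-integral is that of ⟨τ-η⟩^{2a-2}, which converges precisely because a <
  -- 1/2.
  have hv2 : ∫⁻ τ, ENNReal.ofReal (((1 + |τ - η|) ^ (a - 1) * (1 + |lam - η|) ^ (-2 : ℝ)) ^ 2) ≤
      C₂ * ENNReal.ofReal ((1 + |lam - η|) ^ (-(2 * β))) := by
    calc _ ≤ ∫⁻ τ, ENNReal.ofReal ((1 + |lam - η|) ^ (-(2 * β))) *
          ENNReal.ofReal ((1 + |τ - η|) ^ (-(2 - 2 * a))) := by
          refine lintegral_mono fun τ => ?_
          rw [← ENNReal.ofReal_mul (by positivity)]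
          refine ENNReal.ofReal_le_ofReal ?_
          rw [mul_pow, sq_rpow, sq_rpow, mul_comm, show 2 * (a - 1) = -(2 - 2 * a) by ring]
          exact mul_le_mul_of_nonneg_right (rpow_mono (by linarith)) (by positivity)
      _ ≤ _ := by
          rw [lintegral_const_mul' _ _ (by finiteness), mul_comm]
          gcongr
          exact (hC₂ η).1
  have hu : ∀ τ, ((1 + |τ - η|) ^ (-a) * (1 + |lam - τ|) ^ (-1 : ℝ)) ^ 2 +
      ((1 + |τ - η|) ^ (-a) * (1 + |lam - η|) ^ (-1 : ℝ)) ^ 2 =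
      (1 + |τ - η|) ^ (2 * -a) * ((1 + |lam - τ|) ^ (-2 : ℝ) + (1 + |lam - η|) ^ (-2 : ℝ)) := by
    intro τ
    rw [mul_pow, mul_pow, sq_rpow, sq_rpow, sq_rpow, ← mul_add]
    norm_num
  simp only [hu] at hcs
  set I := ∫⁻ τ, ENNReal.ofReal ((1 + |τ - η|) ^ (2 * -a) *
        ((1 + |lam - τ|) ^ (-2 : ℝ) + (1 + |lam - η|) ^ (-2 : ℝ))) * F τ ^ 2 with hI
  calc _ ≤ ENNReal.ofReal ((1 + |lam - η|) ^ (2 * β)) *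
        (4 * I * (C₁ * ENNReal.ofReal ((1 + |lam - η|) ^ (-(2 * β))) +
          C₂ * ENNReal.ofReal ((1 + |lam - η|) ^ (-(2 * β))))) := by
        gcongr
        exact hcs.trans (by gcongr)
    _ = ENNReal.ofReal ((1 + |lam - η|) ^ (2 * β)) *
        ((4 * (C₁ + C₂) * I) * ENNReal.ofReal ((1 + |lam - η|) ^ (-(2 * β)))) := by ring
    _ = _ := by rw [ofReal_rpow_neg_mul]; push_cast; rfl

/-- In the pointwise bound `lam` survives only in two kernels whose integrals in `lam` are bounded
uniformly in τ and η, so Tonelli finishes. Uniformity in η makes the constant independent of the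
mode and of the dispersion relation. -/
lemma exists_duhamel_le {a β : ℝ} (ha0 : 0 ≤ a) (ha : a < 1 / 2) (hab : a + β ≤ 1) : ∃ C : ℝ≥0, ∀ (F : ℝ → ℝ≥0∞), Measurable F → ∀ η : ℝ,
      ∫⁻ lam, ENNReal.ofReal ((1 + |lam - η|) ^ (2 * β)) * (∫⁻ τ, F τ * ENNReal.ofReal
        (((1 + |lam - τ|) ^ (-3 : ℝ) + (1 + |lam - η|) ^ (-3 : ℝ)) * (1 + |τ - η|) ^ (-1 : ℝ))) ^ 2 ≤
      C * ∫⁻ τ, ENNReal.ofReal ((1 + |τ - η|) ^ (2 * -a)) * F τ ^ 2 := by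
  obtain ⟨C, hC⟩ := exists_duhamel_pointwise_le ha0 ha hab
  obtain ⟨D, hD⟩ := exists_lintegral_le (κ := 2) (by norm_num)
  refine ⟨C * (D + D), fun F hF η => (lintegral_mono (hC F hF η)).trans ?_⟩
  rw [lintegral_const_mul' _ _ (by finiteness), lintegral_lintegral_swap]
  · push_cast
    rw [mul_assoc]
    gcongr
    rw [← lintegral_const_mul' _ _ (by finiteness)]
    refine lintegral_mono fun τ => ?_
    calc _ = ∫⁻ lam, ENNReal.ofReal ((1 + |τ - η|) ^ (2 * -a)) * F τ ^ 2 *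
          (ENNReal.ofReal ((1 + |lam - τ|) ^ (-2 : ℝ)) + ENNReal.ofReal ((1 + |lam - η|) ^ (-2 : ℝ))) := by
          refine lintegral_congr fun lam => ?_
          rw [ENNReal.ofReal_mul (by positivity), ENNReal.ofReal_add (by positivity) (by positivity)]
          ring
      _ = ENNReal.ofReal ((1 + |τ - η|) ^ (2 * -a)) * F τ ^ 2 *
          ((∫⁻ lam, ENNReal.ofReal ((1 + |lam - τ|) ^ (-2 : ℝ))) +
            ∫⁻ lam, ENNReal.ofReal ((1 + |lam - η|) ^ (-2 : ℝ))) := by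
          have hm : ∀ y : ℝ, Measurable fun lam : ℝ => ENNReal.ofReal ((1 + |lam - y|) ^ (-2 : ℝ)) :=
            fun y => (measurable_rpow_comp (by fun_prop) _).ennreal_ofReal
          rw [← lintegral_add_left (hm τ)]
          exact lintegral_const_mul _ ((hm τ).add (hm η))
      _ ≤ _ := by
          rw [mul_comm]
          gcongr
          · exact (hD τ).1
          · exact (hD η).1
  · refine Measurable.aemeasurable ?_
    refine Measurable.mul (Measurable.ennreal_ofReal (Measurable.mul
      (measurable_rpow_comp (by fun_prop) _) (Measurable.add (measurable_rpow_comp (by fun_prop) _)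
      (measurable_rpow_comp (by fun_prop) _)))) ((hF.comp measurable_snd).pow_const 2)

end Weight

/-! ### The positive Duhamel kernel summed over the space modes -/

namespace Weight

/-- The `L²` bound, pointwise in the output frequency `lam`, for the space traces of the time cut-off
Duhamel operator. -/
lemma exists_trace_pointwise_le {j ℓ : ℕ} (hℓ : ℓ < j) {s s' b μ r : ℝ} (hb : b < 1 / 2)
    (hs1 : -1 ≤ s') (hs2 : s' ≤ 1 / 2) (hμ : μ = (s + j - ℓ) / (2 * j + 1)) (hr : r = |μ| + 3) :
    ∃ C : ℝ≥0, ∀ (F : ℝ × ℝ → ℝ≥0∞), Measurable F → ∀ lam : ℝ,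
      ENNReal.ofReal ((1 + |lam|) ^ (2 * μ)) * (∫⁻ p : ℝ × ℝ, F p * ENNReal.ofReal
        ((1 + |p.1|) ^ (ℓ : ℝ) * ((1 + |lam - p.2|) ^ (-r) + (1 + |lam - p.1 ^ (2 * j + 1)|) ^ (-r)) *
          (1 + |p.2 - p.1 ^ (2 * j + 1)|) ^ (-1 : ℝ))) ^ 2 ≤
      C * ∫⁻ p : ℝ × ℝ, ENNReal.ofReal
        ((1 + |p.1|) ^ (2 * s') * (1 + |p.2|) ^ (2 * (s - s') / (2 * j + 1)) *
          (1 + |p.2 - p.1 ^ (2 * j + 1)|) ^ (2 * -b) * (1 + |lam - p.2|) ^ (-2 : ℝ) +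
        (1 + |p.1|) ^ (2 * s) * (1 + |p.2 - p.1 ^ (2 * j + 1)|) ^ (2 * -b) *
          (1 + |lam - p.1 ^ (2 * j + 1)|) ^ (-2 : ℝ)) * F p ^ 2 := by
  have hm : (0 : ℝ) < 2 * j + 1 := by positivity
  have hjl : (ℓ : ℝ) + 1 ≤ j := by exact_mod_cast hℓ
  -- θ ≥ 0 follows from s' ≥ -1 and ℓ + 1 ≤ j; θ ≤ 1 follows from s' ≤ 1/2 and ℓ ≥ 0.
  obtain ⟨C₁, hC₁⟩ := exists_lintegral_dispersion_le_rpow j (κ := 2 - 2 * b)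
    (θ := 2 * (s' + j - ℓ) / (2 * j + 1)) (by linarith)
    (div_nonneg (by linarith) hm.le) ((div_le_one hm).2 (by linarith))
  obtain ⟨C₂, hC₂⟩ := exists_lintegral_dispersion_le_rpow' j (κ := 2 * r - 2) (2 * μ)
    (by rw [hr, abs_mul, abs_two]; linarith)
  obtain ⟨D₁, hD₁⟩ := exists_lintegral_le (κ := 4) (by norm_num)
  obtain ⟨D₂, hD₂⟩ := exists_lintegral_le (κ := 2 - 2 * b) (by linarith)
  refine ⟨4 * (C₁ * D₁ + C₂ * D₂), fun F hF lam => ?_⟩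
  have mpow : ∀ (g : ℝ × ℝ → ℝ) (t : ℝ), Measurable g → Measurable fun p => (1 + |g p|) ^ t :=
    fun g t hg => measurable_rpow_comp hg t
  have m1 := fun t => mpow (fun p => p.1) t (by fun_prop)
  have m2 := fun t => mpow (fun p => p.2) t (by fun_prop)
  have m3 := fun t => mpow (fun p => p.2 - p.1 ^ (2 * j + 1)) t (by fun_prop)
  have m4 := fun t => mpow (fun p => lam - p.2) t (by fun_prop)
  have m5 := fun t => mpow (fun p => lam - p.1 ^ (2 * j + 1)) t (by fun_prop)
  set t₀ : ℝ := (s - s') / (2 * j + 1) with ht₀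
  -- Index 1 is the forced wave, with input weight ⟨ξ⟩^{s'} ⟨τ⟩^{t₀}; index 2 is the free wave, with
  -- input weight ⟨ξ⟩^s. Both also carry ⟨τ-ξ^m⟩^{-b}.
  have hcs := sq_lintegral_mul_two_weights_le (μ := (volume : Measure (ℝ × ℝ)))
    (a := fun p => (1 + |p.1|) ^ (ℓ : ℝ) *
      ((1 + |lam - p.2|) ^ (-r) + (1 + |lam - p.1 ^ (2 * j + 1)|) ^ (-r)) *
          (1 + |p.2 - p.1 ^ (2 * j + 1)|) ^ (-1 : ℝ))
    (u₁ := fun p => (1 + |p.1|) ^ s' * (1 + |p.2|) ^ t₀ *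
      (1 + |p.2 - p.1 ^ (2 * j + 1)|) ^ (-b) * (1 + |lam - p.2|) ^ (-1 : ℝ))
    (u₂ := fun p => (1 + |p.1|) ^ s *
      (1 + |p.2 - p.1 ^ (2 * j + 1)|) ^ (-b) * (1 + |lam - p.1 ^ (2 * j + 1)|) ^ (-1 : ℝ))
    (v₁ := fun p => (1 + |p.1|) ^ (ℓ - s') * (1 + |p.2|) ^ (-t₀) *
      (1 + |p.2 - p.1 ^ (2 * j + 1)|) ^ (b - 1) * (1 + |lam - p.2|) ^ (1 - r))
    (v₂ := fun p => (1 + |p.1|) ^ (ℓ - s) *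
      (1 + |p.2 - p.1 ^ (2 * j + 1)|) ^ (b - 1) * (1 + |lam - p.1 ^ (2 * j + 1)|) ^ (1 - r)) hF
    ((((m1 _).mul (m2 _)).mul (m3 _)).mul (m4 _)) (((m1 _).mul (m3 _)).mul (m5 _))
    ((((m1 _).mul (m2 _)).mul (m3 _)).mul (m4 _)) (((m1 _).mul (m3 _)).mul (m5 _))
    (fun _ => by positivity) (fun _ => by positivity) (fun _ => by positivity)
    (fun _ => by positivity) (fun p => by
      have e1 := rpow_mul_rpow p.1 s' (ℓ - s')
      have e2 := rpow_mul_rpow p.2 t₀ (-t₀)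
      have e3 := rpow_mul_rpow (p.2 - p.1 ^ (2 * j + 1)) (-b) (b - 1)
      have e4 := rpow_mul_rpow (lam - p.2) (-1) (1 - r)
      have e5 := rpow_mul_rpow p.1 s (ℓ - s)
      have e6 := rpow_mul_rpow (lam - p.1 ^ (2 * j + 1)) (-1) (1 - r)
      rw [add_sub_cancel] at e1 e5
      rw [add_neg_cancel, Real.rpow_zero] at e2
      rw [show -b + (b - 1) = -1 by ring] at e3
      rw [show -1 + (1 - r) = -r by ring] at e4 e6
      have g4 : ∀ A B C D A' B' C' D' : ℝ, A * B * C * D * (A' * B' * C' * D') =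
        (A * A') * (B * B') * (C * C') * (D * D') := by intros; ring
      have g3 : ∀ A B C A' B' C' : ℝ, A * B * C * (A' * B' * C') =
        (A * A') * (B * B') * (C * C') := by intros; ring
      refine le_of_eq ?_
      rw [g4, g3, e1, e2, e3, e4, e5, e6]
      ring)
  have hv1 : ∫⁻ p : ℝ × ℝ, ENNReal.ofReal (((1 + |p.1|) ^ (ℓ - s') * (1 + |p.2|) ^ (-t₀) *
      (1 + |p.2 - p.1 ^ (2 * j + 1)|) ^ (b - 1) * (1 + |lam - p.2|) ^ (1 - r)) ^ 2) ≤
      (C₁ * D₁ : ℝ≥0) * ENNReal.ofReal ((1 + |lam|) ^ (-(2 * μ))) := by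
    have hmeas : Measurable fun p : ℝ × ℝ => ENNReal.ofReal (((1 + |p.1|) ^ (ℓ - s') *
      (1 + |p.2|) ^ (-t₀) * (1 + |p.2 - p.1 ^ (2 * j + 1)|) ^ (b - 1) *
      (1 + |lam - p.2|) ^ (1 - r)) ^ 2) :=
      (((((m1 _).mul (m2 _)).mul (m3 _)).mul (m4 _)).pow_const 2).ennreal_ofReal
    -- For the forced wave ξ is integrated first, at fixed τ, since the resulting ⟨τ⟩^{-2μ} still
    -- has to be moved to `lam`.
    rw [Measure.volume_eq_prod, lintegral_prod_symm _ hmeas.aemeasurable]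
    have hin : ∀ τ : ℝ, ∫⁻ ξ : ℝ, ENNReal.ofReal (((1 + |ξ|) ^ (ℓ - s') * (1 + |τ|) ^ (-t₀) *
        (1 + |τ - ξ ^ (2 * j + 1)|) ^ (b - 1) * (1 + |lam - τ|) ^ (1 - r)) ^ 2) ≤
        C₁ * ENNReal.ofReal ((1 + |lam|) ^ (-(2 * μ))) *
          ENNReal.ofReal ((1 + |lam - τ|) ^ (-4 : ℝ)) := by
      intro τ
      calc _ = ∫⁻ ξ : ℝ, ENNReal.ofReal ((1 + |τ|) ^ (2 * -t₀) * (1 + |lam - τ|) ^ (2 * (1 - r))) *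
            ENNReal.ofReal ((1 + |ξ|) ^ (2 * j - (2 * j + 1 : ℕ) * (2 * (s' + j - ℓ) / (2 * j + 1))) *
              (1 + |τ - ξ ^ (2 * j + 1)|) ^ (-(2 - 2 * b))) := by
            refine lintegral_congr fun ξ => ?_
            rw [← ENNReal.ofReal_mul (by positivity), mul_pow, mul_pow, mul_pow, sq_rpow, sq_rpow,
              sq_rpow, sq_rpow]
            rw [show (2 * j - (2 * j + 1 : ℕ) * (2 * (s' + j - ℓ) / (2 * j + 1)) : ℝ) = 2 * (ℓ - s') by
              push_cast; field_simp; ring, show -(2 - 2 * b) = 2 * (b - 1) by ring]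
            congr 1; ring
        _ ≤ ENNReal.ofReal ((1 + |τ|) ^ (2 * -t₀) * (1 + |lam - τ|) ^ (2 * (1 - r))) *
            (C₁ * ENNReal.ofReal ((1 + |τ|) ^ (-(2 * (s' + j - ℓ) / (2 * j + 1))))) := by
            rw [lintegral_const_mul' _ _ (by finiteness)]
            gcongr; exact hC₁ τ
        _ = C₁ * ENNReal.ofReal ((1 + |τ|) ^ (-(2 * μ)) * (1 + |lam - τ|) ^ (2 * (1 - r))) := by
            rw [mul_left_comm, ← ENNReal.ofReal_mul (by positivity), mul_right_comm, rpow_mul_rpow]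
            congr 5
            rw [hμ, ht₀]; field_simp; ring
        _ ≤ C₁ * ENNReal.ofReal ((1 + |lam|) ^ (-(2 * μ)) * (1 + |lam - τ|) ^ (-4 : ℝ)) := by
            refine mul_le_mul' le_rfl (ENNReal.ofReal_le_ofReal ?_)
            -- This costs 2|μ| powers of ⟨lam-τ⟩; as r = |μ| + 3, the exponent -4 is left.
            have hp := peetre (-(2 * μ)) τ lam
            rw [abs_neg, abs_sub_comm, abs_mul, abs_two] at hp
            calc _ ≤ (1 + |lam|) ^ (-(2 * μ)) * (1 + |lam - τ|) ^ (2 * |μ|) *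
                  (1 + |lam - τ|) ^ (2 * (1 - r)) := by gcongr
              _ = _ := by rw [mul_assoc, rpow_mul_rpow, hr]; congr 2; ring
        _ = _ := by rw [ENNReal.ofReal_mul (by positivity), mul_assoc]
    refine (lintegral_mono hin).trans ?_
    rw [lintegral_const_mul' _ _ (by finiteness), ENNReal.coe_mul]
    calc _ ≤ C₁ * ENNReal.ofReal ((1 + |lam|) ^ (-(2 * μ))) * D₁ := by gcongr; exact (hD₁ lam).2
      _ = _ := by ring
  have hv2 : ∫⁻ p : ℝ × ℝ, ENNReal.ofReal (((1 + |p.1|) ^ (ℓ - s) *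
      (1 + |p.2 - p.1 ^ (2 * j + 1)|) ^ (b - 1) * (1 + |lam - p.1 ^ (2 * j + 1)|) ^ (1 - r)) ^ 2) ≤
      (C₂ * D₂ : ℝ≥0) * ENNReal.ofReal ((1 + |lam|) ^ (-(2 * μ))) := by
    have hmeas : Measurable fun p : ℝ × ℝ => ENNReal.ofReal (((1 + |p.1|) ^ (ℓ - s) *
      (1 + |p.2 - p.1 ^ (2 * j + 1)|) ^ (b - 1) * (1 + |lam - p.1 ^ (2 * j + 1)|) ^ (1 - r)) ^ 2) :=
      ((((m1 _).mul (m3 _)).mul (m5 _)).pow_const 2).ennreal_ofReal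
    -- For the free wave τ occurs only in ⟨τ-ξ^m⟩^{2b-2} and is integrated first, using b < 1/2. The
    -- ξ-integral then produces the power of ⟨lam⟩ directly.
    rw [Measure.volume_eq_prod, lintegral_prod _ hmeas.aemeasurable]
    have hin : ∀ ξ : ℝ, ∫⁻ τ : ℝ, ENNReal.ofReal (((1 + |ξ|) ^ (ℓ - s) *
        (1 + |τ - ξ ^ (2 * j + 1)|) ^ (b - 1) * (1 + |lam - ξ ^ (2 * j + 1)|) ^ (1 - r)) ^ 2) ≤
        ENNReal.ofReal ((1 + |ξ|) ^ (2 * j - (2 * j + 1 : ℕ) * (2 * μ)) *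
          (1 + |lam - ξ ^ (2 * j + 1)|) ^ (-(2 * r - 2))) * D₂ := by
      intro ξ
      calc _ = ∫⁻ τ : ℝ, ENNReal.ofReal ((1 + |ξ|) ^ (2 * j - (2 * j + 1 : ℕ) * (2 * μ)) *
          (1 + |lam - ξ ^ (2 * j + 1)|) ^ (-(2 * r - 2))) *
            ENNReal.ofReal ((1 + |τ - ξ ^ (2 * j + 1)|) ^ (-(2 - 2 * b))) := by
            refine lintegral_congr fun τ => ?_
            rw [← ENNReal.ofReal_mul (by positivity), mul_pow, mul_pow, sq_rpow, sq_rpow,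
              sq_rpow]
            rw [show (2 * j - (2 * j + 1 : ℕ) * (2 * μ) : ℝ) = 2 * (ℓ - s) by
              rw [hμ]; push_cast; field_simp; ring, show -(2 - 2 * b) = 2 * (b - 1) by ring,
              show -(2 * r - 2) = 2 * (1 - r) by ring]
            congr 1; ring
        _ ≤ _ := by
            rw [lintegral_const_mul' _ _ (by finiteness)]
            gcongr; exact (hD₂ _).1
    refine (lintegral_mono hin).trans ?_
    rw [lintegral_mul_const' _ _ (by finiteness), ENNReal.coe_mul]
    calc _ ≤ C₂ * ENNReal.ofReal ((1 + |lam|) ^ (-(2 * μ))) * D₂ := by gcongr; exact hC₂ lam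
      _ = _ := by ring
  have hu : ∀ p : ℝ × ℝ, ((1 + |p.1|) ^ s' * (1 + |p.2|) ^ t₀ *
      (1 + |p.2 - p.1 ^ (2 * j + 1)|) ^ (-b) * (1 + |lam - p.2|) ^ (-1 : ℝ)) ^ 2 +
      ((1 + |p.1|) ^ s *
      (1 + |p.2 - p.1 ^ (2 * j + 1)|) ^ (-b) * (1 + |lam - p.1 ^ (2 * j + 1)|) ^ (-1 : ℝ)) ^ 2 =
      (1 + |p.1|) ^ (2 * s') * (1 + |p.2|) ^ (2 * (s - s') / (2 * j + 1)) *
          (1 + |p.2 - p.1 ^ (2 * j + 1)|) ^ (2 * -b) * (1 + |lam - p.2|) ^ (-2 : ℝ) +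
        (1 + |p.1|) ^ (2 * s) * (1 + |p.2 - p.1 ^ (2 * j + 1)|) ^ (2 * -b) *
          (1 + |lam - p.1 ^ (2 * j + 1)|) ^ (-2 : ℝ) := by
    intro p
    simp only [mul_pow, sq_rpow]
    rw [ht₀, mul_div_assoc]
    norm_num
  simp only [hu] at hcs
  set I := ∫⁻ p : ℝ × ℝ, ENNReal.ofReal ((1 + |p.1|) ^ (2 * s') *
          (1 + |p.2|) ^ (2 * (s - s') / (2 * j + 1)) *
          (1 + |p.2 - p.1 ^ (2 * j + 1)|) ^ (2 * -b) * (1 + |lam - p.2|) ^ (-2 : ℝ) +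
        (1 + |p.1|) ^ (2 * s) * (1 + |p.2 - p.1 ^ (2 * j + 1)|) ^ (2 * -b) *
          (1 + |lam - p.1 ^ (2 * j + 1)|) ^ (-2 : ℝ)) * F p ^ 2 with hI
  calc _ ≤ ENNReal.ofReal ((1 + |lam|) ^ (2 * μ)) *
        (4 * I * ((C₁ * D₁ : ℝ≥0) * ENNReal.ofReal ((1 + |lam|) ^ (-(2 * μ))) +
          (C₂ * D₂ : ℝ≥0) * ENNReal.ofReal ((1 + |lam|) ^ (-(2 * μ))))) := by
        gcongr
        exact hcs.trans (by gcongr)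
    _ = ENNReal.ofReal ((1 + |lam|) ^ (2 * μ)) *
        ((4 * ((C₁ * D₁ : ℝ≥0) + (C₂ * D₂ : ℝ≥0)) * I) *
          ENNReal.ofReal ((1 + |lam|) ^ (-(2 * μ)))) := by ring
    _ = _ := by rw [ofReal_rpow_neg_mul]; push_cast; rfl

/-- The kernel ⟨·⟩^{-2} left in the pointwise bound is both bounded and integrable. Boundedness
gives finiteness at every `lam`, needed at `lam = 0` to define the traces; integrability gives the
Sobolev bound. -/
lemma exists_trace_le {j ℓ : ℕ} (hℓ : ℓ < j) {s s' b μ r : ℝ} (hb : b < 1 / 2)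
    (hs1 : -1 ≤ s') (hs2 : s' ≤ 1 / 2) (hμ : μ = (s + j - ℓ) / (2 * j + 1)) (hr : r = |μ| + 3) :
    ∃ C : ℝ≥0, ∀ (F : ℝ × ℝ → ℝ≥0∞), Measurable F → ∀ N : ℝ≥0∞,
      N = (∫⁻ p : ℝ × ℝ, ENNReal.ofReal ((1 + |p.1|) ^ (2 * s') *
          (1 + |p.2|) ^ (2 * (s - s') / (2 * j + 1)) *
          (1 + |p.2 - p.1 ^ (2 * j + 1)|) ^ (2 * -b)) * F p ^ 2) +
        (∫⁻ p : ℝ × ℝ, ENNReal.ofReal ((1 + |p.1|) ^ (2 * s) *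
          (1 + |p.2 - p.1 ^ (2 * j + 1)|) ^ (2 * -b)) * F p ^ 2) →
      ∀ M : ℝ → ℝ≥0∞, (∀ lam, M lam = ∫⁻ p : ℝ × ℝ, F p * ENNReal.ofReal
        ((1 + |p.1|) ^ (ℓ : ℝ) * ((1 + |lam - p.2|) ^ (-r) + (1 + |lam - p.1 ^ (2 * j + 1)|) ^ (-r)) *
          (1 + |p.2 - p.1 ^ (2 * j + 1)|) ^ (-1 : ℝ))) →
      (∀ lam, ENNReal.ofReal ((1 + |lam|) ^ (2 * μ)) * M lam ^ 2 ≤ C * N) ∧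
        ∫⁻ lam, ENNReal.ofReal ((1 + |lam|) ^ (2 * μ)) * M lam ^ 2 ≤ C * N := by
  obtain ⟨C, hC⟩ := exists_trace_pointwise_le hℓ hb hs1 hs2 hμ hr
  obtain ⟨D, hD⟩ := exists_lintegral_le (κ := 2) (by norm_num)
  have m1 := fun t => measurable_rpow_comp (g := fun p : ℝ × ℝ => p.1) (by fun_prop) t
  have m2 := fun t => measurable_rpow_comp (g := fun p : ℝ × ℝ => p.2) (by fun_prop) t
  have m3 := fun t => measurable_rpow_comp (g := fun p : ℝ × ℝ => p.2 - p.1 ^ (2 * j + 1))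
    (by fun_prop) t
  refine ⟨C * (D + 1), fun F hF N hN M hM => ?_⟩
  set A : ℝ × ℝ → ℝ≥0∞ := fun p => ENNReal.ofReal ((1 + |p.1|) ^ (2 * s') *
          (1 + |p.2|) ^ (2 * (s - s') / (2 * j + 1)) *
          (1 + |p.2 - p.1 ^ (2 * j + 1)|) ^ (2 * -b)) * F p ^ 2 with hA
  set B : ℝ × ℝ → ℝ≥0∞ := fun p => ENNReal.ofReal ((1 + |p.1|) ^ (2 * s) *
          (1 + |p.2 - p.1 ^ (2 * j + 1)|) ^ (2 * -b)) * F p ^ 2 with hB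
  have hAm : Measurable A := (((m1 _).mul (m2 _)).mul (m3 _)).ennreal_ofReal.mul (hF.pow_const 2)
  have hBm : Measurable B := ((m1 _).mul (m3 _)).ennreal_ofReal.mul (hF.pow_const 2)
  set k : ℝ → ℝ≥0∞ := fun x => ENNReal.ofReal ((1 + |x|) ^ (-2 : ℝ)) with hk
  have hkm : Measurable k := (measurable_rpow _).ennreal_ofReal
  have hpt : ∀ lam, ENNReal.ofReal ((1 + |lam|) ^ (2 * μ)) * M lam ^ 2 ≤
      C * ∫⁻ p : ℝ × ℝ, (A p * k (lam - p.2) + B p * k (lam - p.1 ^ (2 * j + 1))) := by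
    intro lam
    rw [hM]
    refine (hC F hF lam).trans (le_of_eq ?_)
    congr 1
    refine lintegral_congr fun p => ?_
    rw [ENNReal.ofReal_add (by positivity) (by positivity), ENNReal.ofReal_mul (by positivity),
      ENNReal.ofReal_mul (p := (1 + |p.1|) ^ (2 * s) * _) (by positivity)]
    simp only [hA, hB, hk]; ring
  have hk1 : ∀ x, k x ≤ 1 := fun x => by
    rw [hk, ← ENNReal.ofReal_one]
    exact ENNReal.ofReal_le_ofReal (Real.rpow_le_one_of_one_le_of_nonpos (one_le _) (by norm_num))
  have hsum : N = ∫⁻ p, (A p + B p) := by rw [hN, lintegral_add_left hAm]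
  constructor
  · intro lam
    calc _ ≤ _ := hpt lam
      _ ≤ C * ∫⁻ p, (A p + B p) := by
        gcongr with p
        · exact mul_le_of_le_one_right' (hk1 _)
        · exact mul_le_of_le_one_right' (hk1 _)
      _ ≤ _ := by
        rw [hsum]; gcongr
        exact le_mul_of_one_le_right' (by simp)
  · refine (lintegral_mono hpt).trans ?_
    rw [lintegral_const_mul' _ _ (by finiteness), lintegral_lintegral_swap]
    · rw [hsum, ENNReal.coe_mul, mul_assoc, ENNReal.coe_add]
      gcongr
      calc _ ≤ ∫⁻ p, D * (A p + B p) := by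
            refine lintegral_mono fun p => ?_
            have h1 : Measurable fun lam => k (lam - p.2) := hkm.comp (by fun_prop)
            have h2 : Measurable fun lam => k (lam - p.1 ^ (2 * j + 1)) := hkm.comp (by fun_prop)
            rw [lintegral_add_left (h1.const_mul _), lintegral_const_mul _ h1,
              lintegral_const_mul _ h2, mul_add, mul_comm, mul_comm (B p)]
            gcongr
            · exact (hD _).1
            · exact (hD _).1
        _ = D * ∫⁻ p, (A p + B p) := lintegral_const_mul' _ _ (by finiteness)
        _ ≤ _ := by gcongr; simp
    · refine Measurable.aemeasurable ?_
      exact ((hAm.comp measurable_snd).mul (hkm.comp (by fun_prop))).add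
        ((hBm.comp measurable_snd).mul (hkm.comp (by fun_prop)))

end Weight

/-! ### Continuous bounds on Schwartz space -/

section SchwartzBound

variable {E : Type*} [NormedAddCommGroup E] [NormedSpace ℝ E]
variable {E' : Type*} [NormedAddCommGroup E'] [NormedSpace ℝ E']

/-- A nonnegative continuous function on Schwartz space that vanishes at zero. -/
structure IsSchwartzBound (q : 𝓢(E, ℂ) → ℝ) : Prop where
  continuous : Continuous q
  map_zero : q 0 = 0
  nonneg : ∀ φ, 0 ≤ q φ

namespace IsSchwartzBound

lemma comp {q : 𝓢(E, ℂ) → ℝ} (hq : IsSchwartzBound q) (L : 𝓢(E', ℂ) →L[ℂ] 𝓢(E, ℂ)) :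
    IsSchwartzBound fun φ => q (L φ) :=
  ⟨hq.continuous.comp L.continuous, by simp [hq.map_zero], fun _ => hq.nonneg _⟩

lemma const_mul {q : 𝓢(E, ℂ) → ℝ} (hq : IsSchwartzBound q) {c : ℝ} (hc : 0 ≤ c) :
    IsSchwartzBound fun φ => c * q φ :=
  ⟨hq.continuous.const_mul c, by simp [hq.map_zero], fun _ => mul_nonneg hc (hq.nonneg _)⟩

lemma add {q q' : 𝓢(E, ℂ) → ℝ} (hq : IsSchwartzBound q) (hq' : IsSchwartzBound q') :
    IsSchwartzBound fun φ => q φ + q' φ :=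
  ⟨hq.continuous.add hq'.continuous, by simp [hq.map_zero, hq'.map_zero],
    fun _ => add_nonneg (hq.nonneg _) (hq'.nonneg _)⟩

/-- A linear functional dominated by a Schwartz bound is a tempered distribution. -/
lemma exists_distribution {q : 𝓢(E, ℂ) → ℝ} (hq : IsSchwartzBound q) (L : 𝓢(E, ℂ) →ₗ[ℂ] ℂ)
    (h : ∀ φ, ‖L φ‖ ≤ q φ) : ∃ T : 𝓢'(E, ℂ), ∀ φ, T φ = L φ := by
  have hc : Continuous L := by
    refine continuous_of_continuousAt_zero L ?_
    rw [ContinuousAt, _root_.map_zero]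
    refine squeeze_zero_norm h ?_
    simpa [hq.map_zero] using hq.continuous.tendsto 0
  exact ⟨(⟨L, hc⟩ : 𝓢(E, ℂ) →L[ℂ] ℂ), fun _ => rfl⟩

/-- The continuity of the constant in φ is what makes the functionals constructed below tempered
distributions. -/
lemma exists_decay (E : Type*) [NormedAddCommGroup E] [NormedSpace ℝ E] (r : ℝ) :
    ∃ q : 𝓢(E, ℂ) → ℝ, IsSchwartzBound q ∧ ∀ φ x, ‖φ x‖ ≤ q φ * (1 + ‖x‖) ^ (-r) := by
  set k := ⌈r⌉₊ with hk
  set p : Seminorm ℂ 𝓢(E, ℂ) := (Finset.Iic (k, 0)).sup fun m => SchwartzMap.seminorm ℂ m.1 m.2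
  refine ⟨fun φ => 2 ^ k * p φ, ⟨?_, by simp, fun φ => by positivity⟩, fun φ x => ?_⟩
  · refine Continuous.const_mul ?_ _
    refine Seminorm.continuous (r := 1) ?_
    exact (schwartz_withSeminorms ℂ E ℂ).mem_nhds_iff _ _ |>.2 ⟨Finset.Iic (k, 0), 1, one_pos,
      le_rfl⟩
  · have h := one_add_le_sup_seminorm_apply (𝕜 := ℂ) (m := (k, 0)) (k := k) (n := 0) le_rfl le_rfl φ x
    rw [norm_iteratedFDeriv_zero] at h
    have h1 : (1 : ℝ) ≤ 1 + ‖x‖ := by linarith [norm_nonneg x]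
    have h0 : (0 : ℝ) < 1 + ‖x‖ := by linarith
    have h2 : (1 + ‖x‖) ^ r ≤ (1 + ‖x‖) ^ k := by
      rw [← Real.rpow_natCast]
      exact Real.rpow_le_rpow_of_exponent_le h1 (Nat.le_ceil r)
    rw [Real.rpow_neg h0.le, ← div_eq_mul_inv, le_div_iff₀ (Real.rpow_pos_of_pos h0 _), mul_comm]
    exact (mul_le_mul_of_nonneg_right h2 (norm_nonneg _)).trans h

lemma exists_decay_prod {r r' : ℝ} (hr : 0 ≤ r) (hr' : 0 ≤ r') :
    ∃ q : 𝓢(ℝ × ℝ, ℂ) → ℝ, IsSchwartzBound q ∧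
      ∀ φ x t, ‖φ (x, t)‖ ≤ q φ * ((1 + |x|) ^ (-r) * (1 + |t|) ^ (-r')) := by
  obtain ⟨q, hq, h⟩ := exists_decay (ℝ × ℝ) (r + r')
  refine ⟨q, hq, fun φ x t => (h φ (x, t)).trans (mul_le_mul_of_nonneg_left ?_ (hq.nonneg φ))⟩
  have h1 : |x| ≤ ‖(x, t)‖ := norm_fst_le (x, t)
  have h2 : |t| ≤ ‖(x, t)‖ := norm_snd_le (x, t)
  rw [neg_add, Real.rpow_add (by positivity)]
  exact mul_le_mul
    (Real.rpow_le_rpow_of_nonpos (Weight.pos x) (by linarith) (by linarith))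
    (Real.rpow_le_rpow_of_nonpos (Weight.pos t) (by linarith) (by linarith))
    (by positivity) (by positivity)

end IsSchwartzBound

end SchwartzBound

lemma Weight.integrable {r : ℝ} (hr : 1 < r) : Integrable fun x : ℝ => (1 + |x|) ^ (-r) :=
  integrable_one_add_norm (E := ℝ) (by simpa using hr)

/-! ### One dimensional Fourier transform -/

/-- `∫ e^{iτt} h(t) dt`. -/
noncomputable def conjFT (h : ℝ → ℂ) (τ : ℝ) : ℂ :=
  ∫ t : ℝ, Complex.exp (Complex.I * ((τ * t : ℝ) : ℂ)) * h t

lemma norm_exp_I_mul (x : ℝ) : ‖Complex.exp (Complex.I * (x : ℂ))‖ = 1 := by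
  rw [mul_comm, Complex.norm_exp_ofReal_mul_I]

lemma norm_conjFT_le (h : ℝ → ℂ) (τ : ℝ) : ‖conjFT h τ‖ ≤ ∫ t, ‖h t‖ := by
  refine (norm_integral_le_integral_norm _).trans (le_of_eq ?_)
  simp only [norm_mul, norm_exp_I_mul, one_mul]

lemma conjFT_eq_fourierInv (h : ℝ → ℂ) (τ : ℝ) : conjFT h τ = 𝓕⁻ h (τ / (2 * Real.pi)) := by
  rw [Real.fourierInv_eq', conjFT]
  refine integral_congr_ae (Filter.Eventually.of_forall fun t => ?_)
  simp only [smul_eq_mul]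
  congr 2
  rw [mul_comm]
  congr 2
  simp only [RCLike.inner_apply, conj_trivial]
  field_simp

/-- Schwartz regularity is not assumed, so that inversion applies also to the time slices
`conjFourierSpace φ ξ`. -/
lemma conjFT_inversion {h : ℝ → ℂ} (hi : Integrable h) (hc : Continuous h)
    (hi' : Integrable (conjFT h)) (t : ℝ) :
    h t = ((2 * Real.pi : ℝ) : ℂ)⁻¹ *
      ∫ lam : ℝ, Complex.exp (Complex.I * ((-lam * t : ℝ) : ℂ)) * conjFT h lam := by
  have hpi : (0 : ℝ) < 2 * Real.pi := by positivity
  have hF : Integrable (𝓕⁻ h) := by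
    have := hi'.comp_mul_right' hpi.ne'
    refine this.congr (Filter.Eventually.of_forall fun x => ?_)
    simp only [conjFT_eq_fourierInv]
    rw [mul_div_cancel_right₀ _ hpi.ne']
  have hF' : Integrable (𝓕 h) := by
    have := hF.comp_neg
    refine this.congr (Filter.Eventually.of_forall fun x => ?_)
    simp [Real.fourierInv_eq_fourier_neg]
  have h1 := hi.fourier_fourierInv_eq hF' (v := t) hc.continuousAt
  conv_lhs => rw [← h1]
  rw [Real.fourier_eq']
  have h2 := Measure.integral_comp_div (fun x => Complex.exp (Complex.I * ((-(x * (2 * Real.pi)) * t : ℝ) : ℂ)) *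
    𝓕⁻ h x) (2 * Real.pi)
  have h3 : ∀ lam : ℝ, Complex.exp (Complex.I * ((-lam * t : ℝ) : ℂ)) * conjFT h lam =
      Complex.exp (Complex.I * ((-(lam / (2 * Real.pi) * (2 * Real.pi)) * t : ℝ) : ℂ)) *
        𝓕⁻ h (lam / (2 * Real.pi)) := by
    intro lam
    rw [conjFT_eq_fourierInv, div_mul_cancel₀ _ hpi.ne']
  simp only [h3]
  rw [h2, abs_of_pos hpi, Complex.real_smul, ← mul_assoc, inv_mul_cancel₀ (by exact_mod_cast hpi.ne'),
    one_mul]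
  refine integral_congr_ae (Filter.Eventually.of_forall fun x => ?_)
  simp only [smul_eq_mul]
  congr 2
  rw [mul_comm]
  congr 2
  simp only [RCLike.inner_apply, conj_trivial]
  ring

namespace KdVm

lemma conjFourier₁_eq (φ : 𝓢(ℝ, ℂ)) : conjFourier₁ φ = conjFT φ := rfl

lemma exists_conjFourier₁_decay (r : ℝ) : ∃ q : 𝓢(ℝ, ℂ) → ℝ, IsSchwartzBound q ∧
    ∀ φ τ, ‖conjFourier₁ φ τ‖ ≤ q φ * (1 + |τ|) ^ (-r) := by
  -- With |r| the exponent is nonpositive, so the rescaling of τ by 2π costs only the factor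
  -- (2π)^{|r|}.
  obtain ⟨q, hq, h⟩ := IsSchwartzBound.exists_decay ℝ |r|
  have hpi : (1 : ℝ) ≤ 2 * Real.pi := by linarith [Real.pi_gt_three]
  refine ⟨fun φ => (2 * Real.pi) ^ |r| * q (FourierTransform.fourierInvCLM ℂ 𝓢(ℝ, ℂ) φ), (hq.comp _).const_mul (by positivity),
    fun φ τ => ?_⟩
  have h1 := h (FourierTransform.fourierInvCLM ℂ 𝓢(ℝ, ℂ) φ) (τ / (2 * Real.pi))
  rw [conjFourier₁_eq, conjFT_eq_fourierInv]
  have e : (FourierTransform.fourierInvCLM ℂ 𝓢(ℝ, ℂ) φ) (τ / (2 * Real.pi)) = 𝓕⁻ (φ : ℝ → ℂ) (τ / (2 * Real.pi)) := by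
    rw [FourierTransform.fourierInvCLM_apply, SchwartzMap.fourierInv_coe]
  rw [← e]
  refine h1.trans ?_
  beta_reduce
  rw [mul_comm ((2 * Real.pi) ^ |r|), mul_assoc]
  refine mul_le_mul_of_nonneg_left ?_ (hq.nonneg _)
  calc (1 + ‖τ / (2 * Real.pi)‖) ^ (-|r|) ≤ ((1 + |τ|) / (2 * Real.pi)) ^ (-|r|) := by
        refine Real.rpow_le_rpow_of_nonpos (by positivity) ?_ (by simp)
        rw [norm_div, Real.norm_eq_abs, Real.norm_of_nonneg (by positivity), add_div]
        gcongr
        exact div_le_one_of_le₀ hpi (by positivity)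
    _ = (2 * Real.pi) ^ |r| * (1 + |τ|) ^ (-|r|) := by
        rw [Real.div_rpow (by positivity) (by positivity), Real.rpow_neg (x := 2 * Real.pi) (by positivity)]
        field_simp
    _ ≤ _ := by
        exact mul_le_mul_of_nonneg_left (Weight.rpow_mono (neg_le_neg (le_abs_self r))) (by positivity)

lemma continuous_conjFT {h : ℝ → ℂ} (hi : Integrable h) : Continuous (conjFT h) := by
  refine continuous_of_dominated (bound := fun t => ‖h t‖) (fun τ => ?_) (fun τ => ?_) hi.norm ?_
  · exact (Continuous.aestronglyMeasurable (by fun_prop)).mul hi.aestronglyMeasurable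
  · refine Filter.Eventually.of_forall fun t => ?_
    rw [norm_mul, norm_exp_I_mul, one_mul]
  · exact Filter.Eventually.of_forall fun t => by fun_prop

lemma continuous_conjFourier₁ (φ : 𝓢(ℝ, ℂ)) : Continuous (conjFourier₁ φ) :=
  continuous_conjFT φ.integrable

lemma integrable_conjFourier₁ (φ : 𝓢(ℝ, ℂ)) : Integrable (conjFourier₁ φ) := by
  obtain ⟨q, hq, h⟩ := exists_conjFourier₁_decay 2
  exact ((Weight.integrable (r := 2) (by norm_num)).const_mul (q φ)).mono'
    (continuous_conjFourier₁ φ).aestronglyMeasurable (Filter.Eventually.of_forall (h φ))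

/-! ### Two dimensional Fourier transform -/

/-- Scaling by `a`, as an automorphism of the plane. -/
noncomputable def planeScale (a : ℝ) (ha : a ≠ 0) : (ℝ × ℝ) ≃L[ℝ] ℂ :=
  (ContinuousLinearEquiv.smulLeft (Units.mk0 a ha)).trans Complex.equivRealProdCLM.symm

/-- The product ℝ × ℝ carries the sup norm; ℂ serves as the Euclidean plane on which the Fourier
transform is taken. -/
lemma conjFourier₂_eq_fourierInv (φ : 𝓢(ℝ × ℝ, ℂ)) (p : ℝ × ℝ) :
    conjFourier₂ φ p = 𝓕⁻ (fun z : ℂ => φ (z.re, z.im))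
      (Complex.equivRealProdCLM.symm ((2 * Real.pi)⁻¹ • p)) := by
  rw [Real.fourierInv_eq', conjFourier₂,
    ← Complex.volume_preserving_equiv_real_prod.integral_comp
      Complex.measurableEquivRealProd.measurableEmbedding]
  refine integral_congr_ae (Filter.Eventually.of_forall fun z => ?_)
  simp only [smul_eq_mul, Complex.measurableEquivRealProd_apply]
  congr 2
  rw [mul_comm]
  congr 2
  have hpi : Real.pi ≠ 0 := Real.pi_ne_zero
  simp [Complex.inner]
  field_simp

/-- The Fourier transform `conjFourier₂`, as a map from Schwartz space to itself. -/
lemma exists_conjFourier₂_eq (φ : 𝓢(ℝ × ℝ, ℂ)) : ∃ Φ : 𝓢(ℝ × ℝ, ℂ), conjFourier₂ φ = Φ := by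
  have hpi : (2 * Real.pi)⁻¹ ≠ 0 := by positivity
  refine ⟨compCLMOfContinuousLinearEquiv ℂ (planeScale _ hpi)
    (𝓕⁻ (compCLMOfContinuousLinearEquiv ℂ Complex.equivRealProdCLM φ)), ?_⟩
  ext p
  rw [conjFourier₂_eq_fourierInv, compCLMOfContinuousLinearEquiv_apply, Function.comp_apply,
    SchwartzMap.fourierInv_coe]
  rfl

/-- Surjectivity allows a distribution to be tested against any bump function in frequency space,
which yields the uniqueness of its transform. -/
lemma exists_eq_conjFourier₂ (Φ : 𝓢(ℝ × ℝ, ℂ)) : ∃ φ : 𝓢(ℝ × ℝ, ℂ), conjFourier₂ φ = Φ := by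
  have hpi : (2 * Real.pi)⁻¹ ≠ 0 := by positivity
  refine ⟨compCLMOfContinuousLinearEquiv ℂ Complex.equivRealProdCLM.symm
    (𝓕 (compCLMOfContinuousLinearEquiv ℂ (planeScale _ hpi).symm Φ)), ?_⟩
  ext p
  rw [conjFourier₂_eq_fourierInv]
  have e : (fun z : ℂ => (compCLMOfContinuousLinearEquiv ℂ Complex.equivRealProdCLM.symm
    (𝓕 (compCLMOfContinuousLinearEquiv ℂ (planeScale _ hpi).symm Φ))) (z.re, z.im)) =
    𝓕 (compCLMOfContinuousLinearEquiv ℂ (planeScale _ hpi).symm Φ) := by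
    ext z
    rw [compCLMOfContinuousLinearEquiv_apply, Function.comp_apply]
    congr 1
  rw [e, ← SchwartzMap.fourierInv_coe, FourierTransform.fourierInv_fourier_eq,
    compCLMOfContinuousLinearEquiv_apply, Function.comp_apply]
  congr 1
  exact (planeScale _ hpi).symm_apply_apply p

/-- The Fourier transform of a tempered distribution is unique up to a null set. -/
lemma HasFourier₂.ae_eq {u : 𝓢'(ℝ × ℝ, ℂ)} {f g : ℝ × ℝ → ℂ} (hf : HasFourier₂ u f)
    (hg : HasFourier₂ u g) : f =ᵐ[volume] g := by
  -- The transform is integrable against a Schwartz function that equals 1 on a given compact set,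
  -- hence integrable on that set.
  have hloc : ∀ {h}, HasFourier₂ u h → LocallyIntegrable h volume := by
    intro h hh
    rw [locallyIntegrable_iff]
    intro K hK
    obtain ⟨R, hR⟩ := hK.isBounded.subset_closedBall 0
    let B : ContDiffBump (0 : ℝ × ℝ) := ⟨max R 1, max R 1 + 1, by positivity, by linarith⟩
    have hB : ContDiff ℝ ((⊤ : ℕ∞) : WithTop ℕ∞) fun p : ℝ × ℝ => (B p : ℂ) :=
      Complex.ofRealCLM.contDiff.comp B.contDiff
    have hBs : HasCompactSupport fun p : ℝ × ℝ => (B p : ℂ) :=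
      B.hasCompactSupport.comp_left (g := fun x : ℝ => (x : ℂ)) (by simp)
    obtain ⟨φ, hφ⟩ := exists_eq_conjFourier₂ (hBs.toSchwartzMap hB)
    have hi := (hh.2 φ).1.integrableOn (s := K)
    refine hi.congr_fun_ae ?_
    refine (ae_restrict_iff' hK.measurableSet).2 (Filter.Eventually.of_forall fun p hp => ?_)
    rw [hφ]
    have h1 : B p = 1 := B.one_of_mem_closedBall
      (Metric.closedBall_subset_closedBall (le_max_left _ _) (hR hp))
    change h p * (B p : ℂ) = h p
    simp [h1]
  refine ae_eq_of_integral_contDiff_smul_eq (hloc hf) (hloc hg) fun η hη hηs => ?_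
  have hB : ContDiff ℝ ((⊤ : ℕ∞) : WithTop ℕ∞) fun p : ℝ × ℝ => (η p : ℂ) :=
    Complex.ofRealCLM.contDiff.comp hη
  have hBs : HasCompactSupport fun p : ℝ × ℝ => (η p : ℂ) :=
    hηs.comp_left (g := fun x : ℝ => (x : ℂ)) (by simp)
  obtain ⟨φ, hφ⟩ := exists_eq_conjFourier₂ (hBs.toSchwartzMap hB)
  have h1 := (hf.2 φ).2.symm.trans (hg.2 φ).2
  have hpi : ((2 * Real.pi : ℝ) : ℂ)⁻¹ ^ 2 ≠ 0 := by
    have : (2 * Real.pi : ℝ) ≠ 0 := by positivity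
    exact pow_ne_zero _ (inv_ne_zero (by exact_mod_cast this))
  have h2 := mul_left_cancel₀ hpi h1
  rw [hφ] at h2
  have h3 : ∀ h : ℝ × ℝ → ℂ, ∀ p, h p * (hBs.toSchwartzMap hB) p = η p • h p := fun h p => by
    change h p * (η p : ℂ) = _
    rw [mul_comm, Complex.real_smul]
  simpa only [h3] using h2

lemma weightedNorm₂_eq {ω : ℝ × ℝ → ℝ} {u : 𝓢'(ℝ × ℝ, ℂ)} {f : ℝ × ℝ → ℂ} (hf : HasFourier₂ u f) :
    weightedNorm₂ ω u = (∫⁻ p, ENNReal.ofReal (ω p) * ‖f p‖ₑ ^ 2) ^ (1 / 2 : ℝ) := by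
  refine le_antisymm (iInf₂_le f hf) (le_iInf₂ fun g hg => le_of_eq ?_)
  congr 1
  refine lintegral_congr_ae ?_
  filter_upwards [hf.ae_eq hg] with p hp
  rw [hp]

lemma exists_hasFourier₂ {ω : ℝ × ℝ → ℝ} {u : 𝓢'(ℝ × ℝ, ℂ)} (h : weightedNorm₂ ω u < ∞) :
    ∃ f, HasFourier₂ u f := by
  obtain ⟨f, hf⟩ := iInf_lt_iff.1 h
  obtain ⟨hf, -⟩ := iInf_lt_iff.1 hf
  exact ⟨f, hf⟩

end KdVm

namespace KdVm

/-! ### The Fourier transform of test functions in the space variable -/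

lemma integrable_slice (φ : 𝓢(ℝ × ℝ, ℂ)) (t : ℝ) : Integrable fun x => φ (x, t) := by
  obtain ⟨q, hq, h⟩ := IsSchwartzBound.exists_decay_prod (r := 2) (r' := 0) (by norm_num) le_rfl
  refine ((Weight.integrable (r := 2) (by norm_num)).const_mul (q φ)).mono'
    (Continuous.aestronglyMeasurable (by fun_prop)) (Filter.Eventually.of_forall fun x => ?_)
  simpa using h φ x t

lemma conjFourierSpace_lineDeriv (φ : 𝓢(ℝ × ℝ, ℂ)) (ξ t : ℝ) :
    conjFourierSpace (∂_{((1 : ℝ), (0 : ℝ))} φ) ξ t =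
      -(Complex.I * ξ) * conjFourierSpace φ ξ t := by
  have hu : ∀ x : ℝ, HasDerivAt (fun x : ℝ => Complex.exp (Complex.I * ((ξ * x : ℝ) : ℂ)))
      (Complex.I * ξ * Complex.exp (Complex.I * ((ξ * x : ℝ) : ℂ))) x := by
    intro x
    have h1 : HasDerivAt (fun x : ℝ => Complex.I * ((ξ * x : ℝ) : ℂ)) (Complex.I * ξ) x := by
      have h2 : HasDerivAt (fun x : ℝ => ((ξ * x : ℝ) : ℂ)) (ξ : ℂ) x := by
        have := ((hasDerivAt_id x).const_mul ξ).ofReal_comp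
        simpa using this
      exact h2.const_mul _
    have := h1.cexp
    rwa [mul_comm] at this
  have hv : ∀ x : ℝ, HasDerivAt (fun x : ℝ => φ (x, t)) ((∂_{((1 : ℝ), (0 : ℝ))} φ) (x, t)) x := by
    intro x
    rw [SchwartzMap.lineDerivOp_apply_eq_fderiv]
    have h1 := (φ.differentiableAt (x := (x, t))).hasFDerivAt
    have h2 : HasDerivAt (fun x : ℝ => (x, t)) ((1 : ℝ), (0 : ℝ)) x :=
      (hasDerivAt_id x).prodMk (hasDerivAt_const x t)
    exact h1.comp_hasDerivAt x h2
  have hexp : ∀ {h : ℝ → ℂ}, Integrable h →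
      Integrable fun x => Complex.exp (Complex.I * ((ξ * x : ℝ) : ℂ)) * h x := by
    intro h hh
    refine hh.mono ((Continuous.aestronglyMeasurable (by fun_prop)).mul hh.aestronglyMeasurable) ?_
    exact Filter.Eventually.of_forall fun x => by rw [norm_mul, norm_exp_I_mul, one_mul]
  have hi := hexp (integrable_slice φ t)
  have := integral_mul_deriv_eq_deriv_mul_of_integrable (fun x _ => hu x) (fun x _ => hv x)
    (hexp (integrable_slice (∂_{((1 : ℝ), (0 : ℝ))} φ) t))
    ((hi.const_mul (Complex.I * ξ)).congr (Filter.Eventually.of_forall fun x => by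
      simp only [Pi.mul_apply]; ring)) hi
  rw [conjFourierSpace, this, conjFourierSpace, neg_mul, ← integral_const_mul]
  congr 2
  ext x
  ring

lemma conjFourierSpace_iterate_lineDeriv (n : ℕ) (φ : 𝓢(ℝ × ℝ, ℂ)) (ξ t : ℝ) :
    conjFourierSpace ((fun φ : 𝓢(ℝ × ℝ, ℂ) => ∂_{((1 : ℝ), (0 : ℝ))} φ)^[n] φ) ξ t =
      (-(Complex.I * ξ)) ^ n * conjFourierSpace φ ξ t := by
  induction n with
  | zero => simp
  | succ n ih => rw [Function.iterate_succ_apply', conjFourierSpace_lineDeriv, ih]; ring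

/-- Decay in t is inherited from the test function. Decay in ξ comes from k = ⌈r⌉₊ derivatives in x,
each of which multiplies the transform by -iξ. -/
lemma exists_conjFourierSpace_decay (r : ℝ) {r' : ℝ} (hr' : 0 ≤ r') :
    ∃ q : 𝓢(ℝ × ℝ, ℂ) → ℝ, IsSchwartzBound q ∧ ∀ φ ξ t,
      ‖conjFourierSpace φ ξ t‖ ≤ q φ * ((1 + |ξ|) ^ (-r) * (1 + |t|) ^ (-r')) := by
  obtain ⟨q, hq, h⟩ := IsSchwartzBound.exists_decay_prod (r := 2) (r' := r') (by norm_num) hr'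
  set A : ℝ := ∫ x : ℝ, (1 + |x|) ^ (-2 : ℝ)
  have hA : 0 ≤ A := integral_nonneg fun x => by positivity
  have h0 : ∀ φ ξ t, ‖conjFourierSpace φ ξ t‖ ≤ A * q φ * (1 + |t|) ^ (-r') := by
    intro φ ξ t
    refine (norm_conjFT_le _ _).trans ?_
    calc _ ≤ ∫ x : ℝ, q φ * (1 + |t|) ^ (-r') * (1 + |x|) ^ (-2 : ℝ) := by
          refine integral_mono (integrable_slice φ t).norm
            ((Weight.integrable (r := 2) (by norm_num)).const_mul _) fun x => ?_
          refine (h φ x t).trans (le_of_eq (by ring))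
      _ = _ := by rw [integral_const_mul]; ring
  set k := ⌈r⌉₊
  set D : 𝓢(ℝ × ℝ, ℂ) →L[ℂ] 𝓢(ℝ × ℝ, ℂ) :=
    LineDeriv.lineDerivOpCLM ℂ 𝓢(ℝ × ℝ, ℂ) ((1 : ℝ), (0 : ℝ)) with hD
  have hDk : ∀ φ, (D ^ k) φ = (fun φ : 𝓢(ℝ × ℝ, ℂ) => ∂_{((1 : ℝ), (0 : ℝ))} φ)^[k] φ := by
    intro φ
    rw [FunLike.coe_pow_eq_iterate]
    rfl
  refine ⟨fun φ => 2 ^ k * A * (q φ + q ((D ^ k) φ)),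
    (hq.add (hq.comp (D ^ k))).const_mul (by positivity), fun φ ξ t => ?_⟩
  have h1 := h0 φ ξ t
  have h2 := h0 ((D ^ k) φ) ξ t
  rw [hDk, conjFourierSpace_iterate_lineDeriv, norm_mul, norm_pow, norm_neg, norm_mul,
    Complex.norm_I, one_mul, Complex.norm_real, Real.norm_eq_abs, ← hDk] at h2
  have h3 : (1 + |ξ|) ^ r ≤ 2 ^ k * (1 + |ξ| ^ k) := by
    calc (1 + |ξ|) ^ r ≤ (1 + |ξ|) ^ k := by
          rw [← Real.rpow_natCast]; exact Weight.rpow_mono (Nat.le_ceil r)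
      _ ≤ _ := by
          have := Weight.pow_le_one_add_abs_pow k ξ
          rwa [abs_pow] at this
  have h4 : (1 + |ξ|) ^ r * ‖conjFourierSpace φ ξ t‖ ≤
      2 ^ k * A * (q φ + q ((D ^ k) φ)) * (1 + |t|) ^ (-r') := by
    calc _ ≤ 2 ^ k * (1 + |ξ| ^ k) * ‖conjFourierSpace φ ξ t‖ := by gcongr
      _ = 2 ^ k * (‖conjFourierSpace φ ξ t‖ + |ξ| ^ k * ‖conjFourierSpace φ ξ t‖) := by ring
      _ ≤ 2 ^ k * (A * q φ * (1 + |t|) ^ (-r') + A * q ((D ^ k) φ) * (1 + |t|) ^ (-r')) := by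
          gcongr
      _ = _ := by ring
  rw [Real.rpow_neg (Weight.pos ξ).le, mul_left_comm, ← div_eq_inv_mul,
    le_div_iff₀ (Real.rpow_pos_of_pos (Weight.pos ξ) _), mul_comm]
  exact h4

lemma continuous_conjFourierSpace (φ : 𝓢(ℝ × ℝ, ℂ)) :
    Continuous fun p : ℝ × ℝ => conjFourierSpace φ p.1 p.2 := by
  obtain ⟨q, hq, h⟩ := IsSchwartzBound.exists_decay_prod (r := 2) (r' := 0) (by norm_num) le_rfl
  refine continuous_of_dominated (bound := fun x => q φ * (1 + |x|) ^ (-2 : ℝ)) (fun p => ?_)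
    (fun p => ?_) ((Weight.integrable (r := 2) (by norm_num)).const_mul _) ?_
  · exact Continuous.aestronglyMeasurable (by fun_prop)
  · refine Filter.Eventually.of_forall fun x => ?_
    rw [norm_mul, norm_exp_I_mul, one_mul]
    simpa using h φ x p.2
  · exact Filter.Eventually.of_forall fun x => by fun_prop

lemma integrable_conjFourierSpace (φ : 𝓢(ℝ × ℝ, ℂ)) (ξ : ℝ) :
    Integrable (conjFourierSpace φ ξ) := by
  obtain ⟨q, hq, h⟩ := exists_conjFourierSpace_decay 0 (r' := 2) (by norm_num)
  refine ((Weight.integrable (r := 2) (by norm_num)).const_mul (q φ)).mono' ?_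
    (Filter.Eventually.of_forall fun t => by simpa using h φ ξ t)
  exact ((continuous_conjFourierSpace φ).comp (Continuous.prodMk_right ξ)).aestronglyMeasurable

lemma conjFourier₂_eq_conjFT (φ : 𝓢(ℝ × ℝ, ℂ)) (ξ τ : ℝ) :
    conjFourier₂ φ (ξ, τ) = conjFT (conjFourierSpace φ ξ) τ := by
  rw [conjFourier₂, Measure.volume_eq_prod, integral_prod_symm]
  · rw [conjFT]
    congr 1
    ext t
    rw [conjFourierSpace, ← integral_const_mul]
    congr 1
    ext x
    rw [← mul_assoc, ← Complex.exp_add]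
    congr 2
    push_cast
    ring
  · have hi : Integrable (φ : ℝ × ℝ → ℂ) (volume.prod volume) := φ.integrable
    refine hi.mono ((Continuous.aestronglyMeasurable (by fun_prop)).mul hi.aestronglyMeasurable) ?_
    exact Filter.Eventually.of_forall fun x => by rw [norm_mul, norm_exp_I_mul, one_mul]

lemma exists_conjFourier₂_decay (φ : 𝓢(ℝ × ℝ, ℂ)) {r r' : ℝ} (hr : 0 ≤ r) (hr' : 0 ≤ r') :
    ∃ C : ℝ, 0 ≤ C ∧ ∀ ξ τ,
      ‖conjFourier₂ φ (ξ, τ)‖ ≤ C * ((1 + |ξ|) ^ (-r) * (1 + |τ|) ^ (-r')) := by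
  obtain ⟨Φ, hΦ⟩ := exists_conjFourier₂_eq φ
  obtain ⟨q, hq, h⟩ := IsSchwartzBound.exists_decay_prod hr hr'
  exact ⟨q Φ, hq.nonneg Φ, fun ξ τ => by rw [hΦ]; exact h Φ ξ τ⟩

lemma continuous_conjFourier₂ (φ : 𝓢(ℝ × ℝ, ℂ)) : Continuous (conjFourier₂ φ) := by
  obtain ⟨Φ, hΦ⟩ := exists_conjFourier₂_eq φ
  rw [hΦ]; exact Φ.continuous

lemma integrable_conjFourier₂_slice (φ : 𝓢(ℝ × ℝ, ℂ)) (ξ : ℝ) :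
    Integrable fun τ => conjFourier₂ φ (ξ, τ) := by
  obtain ⟨C, -, h⟩ := exists_conjFourier₂_decay φ (r := 0) (r' := 2) le_rfl (by norm_num)
  refine ((Weight.integrable (r := 2) (by norm_num)).const_mul C).mono' ?_
    (Filter.Eventually.of_forall fun t => by simpa using h ξ t)
  exact ((continuous_conjFourier₂ φ).comp (Continuous.prodMk_right ξ)).aestronglyMeasurable

lemma conjFourierSpace_inversion (φ : 𝓢(ℝ × ℝ, ℂ)) (ξ t : ℝ) :
    conjFourierSpace φ ξ t = ((2 * Real.pi : ℝ) : ℂ)⁻¹ *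
      ∫ lam : ℝ, Complex.exp (Complex.I * ((-lam * t : ℝ) : ℂ)) * conjFourier₂ φ (ξ, lam) := by
  simp only [conjFourier₂_eq_conjFT]
  refine conjFT_inversion (integrable_conjFourierSpace φ ξ)
    ((continuous_conjFourierSpace φ).comp (Continuous.prodMk_right ξ)) ?_ t
  simpa only [conjFourier₂_eq_conjFT] using integrable_conjFourier₂_slice φ ξ

/-! ### The Duhamel kernel -/

lemma duhamelKernel_eq (m : ℕ) (ξ τ t : ℝ) :
    duhamelKernel m ξ τ t = Complex.exp (Complex.I * ((ξ ^ m * t : ℝ) : ℂ)) *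
      ∫ t' in (0 : ℝ)..t, Complex.exp (Complex.I * (((τ - ξ ^ m) * t' : ℝ) : ℂ)) := by
  rw [duhamelKernel, ← intervalIntegral.integral_const_mul]
  congr 1
  ext t'
  rw [← Complex.exp_add, ← Complex.exp_add]
  congr 1
  push_cast
  ring

/-- Scaling the time integral to [0,1] isolates a factor t, which the cutoff absorbs, and leaves no
singularity at τ = ξ^m. -/
lemma duhamelKernel_eq_unit (m : ℕ) (ξ τ t : ℝ) :
    duhamelKernel m ξ τ t = Complex.exp (Complex.I * ((ξ ^ m * t : ℝ) : ℂ)) *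
      (t * ∫ θ in (0 : ℝ)..1, Complex.exp (Complex.I * (((τ - ξ ^ m) * (t * θ) : ℝ) : ℂ))) := by
  rw [duhamelKernel_eq]
  congr 1
  have := intervalIntegral.smul_integral_comp_mul_left (a := 0) (b := 1)
    (fun x : ℝ => Complex.exp (Complex.I * (((τ - ξ ^ m) * x : ℝ) : ℂ))) t
  rw [mul_zero, mul_one, Complex.real_smul] at this
  exact this.symm

lemma duhamelKernel_eq_of_ne (m : ℕ) (ξ τ t : ℝ) (h : τ - ξ ^ m ≠ 0) :
    duhamelKernel m ξ τ t = (Complex.exp (Complex.I * ((τ * t : ℝ) : ℂ)) -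
      Complex.exp (Complex.I * ((ξ ^ m * t : ℝ) : ℂ))) / (Complex.I * ((τ - ξ ^ m : ℝ) : ℂ)) := by
  have hc : Complex.I * ((τ - ξ ^ m : ℝ) : ℂ) ≠ 0 := mul_ne_zero Complex.I_ne_zero (by exact_mod_cast h)
  have := integral_exp_mul_complex (a := 0) (b := t) hc
  rw [duhamelKernel_eq]
  have e : ∀ x : ℝ, Complex.exp (Complex.I * (((τ - ξ ^ m) * x : ℝ) : ℂ)) =
      Complex.exp (Complex.I * ((τ - ξ ^ m : ℝ) : ℂ) * x) := fun x => by
    congr 1; push_cast; ring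
  simp only [e, this]
  rw [← mul_div_assoc, mul_sub, ← Complex.exp_add]
  congr 2
  · congr 1; push_cast; ring
  · simp

lemma continuous_duhamelKernel (m : ℕ) :
    Continuous fun p : ℝ × ℝ × ℝ => duhamelKernel m p.1 p.2.1 p.2.2 := by
  unfold duhamelKernel
  refine intervalIntegral.continuous_parametric_intervalIntegral_of_continuous ?_ (by fun_prop)
  fun_prop

/-- Near resonance the length |t| of the interval is the bound; away from it the explicit quotient
gives 2/|τ-ξ^m|. -/
lemma norm_duhamelKernel_le (m : ℕ) (ξ τ t : ℝ) :
    ‖duhamelKernel m ξ τ t‖ ≤ 2 * (1 + |t|) * (1 + |τ - ξ ^ m|) ^ (-1 : ℝ) := by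
  have h1 : ‖duhamelKernel m ξ τ t‖ ≤ |t| := by
    rw [duhamelKernel]
    have := intervalIntegral.norm_integral_le_of_norm_le_const (a := 0) (b := t) (C := 1)
      (f := fun t' : ℝ => Complex.exp (Complex.I * ((ξ ^ m * (t - t') : ℝ) : ℂ)) *
        Complex.exp (Complex.I * ((τ * t' : ℝ) : ℂ)))
      (fun x _ => by rw [norm_mul, norm_exp_I_mul, norm_exp_I_mul, one_mul])
    simpa using this
  have h2 : ‖duhamelKernel m ξ τ t‖ * |τ - ξ ^ m| ≤ 2 := by
    by_cases h : τ - ξ ^ m = 0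
    · simp [h]
    · rw [duhamelKernel_eq_of_ne m ξ τ t h, norm_div, norm_mul, Complex.norm_I, one_mul,
        Complex.norm_real, Real.norm_eq_abs, div_mul_cancel₀ _ (abs_ne_zero.2 h)]
      refine (norm_sub_le _ _).trans ?_
      rw [norm_exp_I_mul, norm_exp_I_mul]; norm_num
  rw [Real.rpow_neg_one, ← div_eq_mul_inv, le_div_iff₀ (Weight.pos _)]
  nlinarith [abs_nonneg t]

/-- The response of the mode `ξ` to the forcing `e^{iτt}`, cut off by `φ`, at the frequency `lam`. -/
noncomputable def response (φ : 𝓢(ℝ, ℂ)) (m : ℕ) (ξ τ lam : ℝ) : ℂ :=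
  ∫ t : ℝ, Complex.exp (Complex.I * ((-lam * t : ℝ) : ℂ)) * (φ t * duhamelKernel m ξ τ t)

lemma response_eq_of_ne (φ : 𝓢(ℝ, ℂ)) (m : ℕ) (ξ τ lam : ℝ) (h : τ - ξ ^ m ≠ 0) :
    response φ m ξ τ lam = (conjFourier₁ φ (τ - lam) - conjFourier₁ φ (ξ ^ m - lam)) /
      (Complex.I * ((τ - ξ ^ m : ℝ) : ℂ)) := by
  have hexp : ∀ y : ℝ, Integrable fun x => Complex.exp (Complex.I * ((y * x : ℝ) : ℂ)) * φ x := by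
    intro y
    refine φ.integrable.mono (Continuous.aestronglyMeasurable (by fun_prop)) ?_
    exact Filter.Eventually.of_forall fun x => by rw [norm_mul, norm_exp_I_mul, one_mul]
  rw [conjFourier₁, conjFourier₁, ← integral_sub (hexp _) (hexp _), ← integral_div, response]
  congr 1
  ext t
  rw [duhamelKernel_eq_of_ne m ξ τ t h, mul_div_assoc', mul_div_assoc', ← sub_mul]
  congr 1
  have e : ∀ y : ℝ, Complex.exp (Complex.I * (((y - lam) * t : ℝ) : ℂ)) =
      Complex.exp (Complex.I * ((-lam * t : ℝ) : ℂ)) * Complex.exp (Complex.I * ((y * t : ℝ) : ℂ)) := by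
    intro y; rw [← Complex.exp_add]; congr 1; push_cast; ring
  rw [e, e]; ring

/-- Multiplication of test functions by the variable. -/
noncomputable def mulVar : 𝓢(ℝ, ℂ) →L[ℂ] 𝓢(ℝ, ℂ) :=
  SchwartzMap.smulLeftCLM ℂ (fun t : ℝ => (t : ℂ))

lemma mulVar_apply (φ : 𝓢(ℝ, ℂ)) (t : ℝ) : mulVar φ t = t * φ t := by
  exact SchwartzMap.smulLeftCLM_apply_apply (g := fun t : ℝ => (t : ℂ))
    Complex.ofRealCLM.hasTemperateGrowth φ t

/-- The integral mean value form of the difference quotient in `response_eq_of_ne`: up to a factor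
i, the derivative of the transform of φ is the transform of tφ. It remains valid at τ = ξ^m. -/
lemma response_eq_integral (φ : 𝓢(ℝ, ℂ)) (m : ℕ) (ξ τ lam : ℝ) :
    response φ m ξ τ lam =
      ∫ θ in (0 : ℝ)..1, conjFourier₁ (mulVar φ) (ξ ^ m - lam + (τ - ξ ^ m) * θ) := by
  have hF : Integrable (Function.uncurry fun (t θ : ℝ) => Complex.exp (Complex.I *
      (((ξ ^ m - lam + (τ - ξ ^ m) * θ) * t : ℝ) : ℂ)) * mulVar φ t)
      ((volume : Measure ℝ).prod (volume.restrict (uIoc 0 1))) := by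
    have : IsFiniteMeasure ((volume : Measure ℝ).restrict (uIoc 0 1)) := ⟨by simp [uIoc]⟩
    have h1 : Integrable (fun p : ℝ × ℝ => mulVar φ p.1 * (1 : ℂ))
        ((volume : Measure ℝ).prod (volume.restrict (uIoc 0 1))) :=
      (mulVar φ).integrable.mul_prod (integrable_const (1 : ℂ))
    refine h1.mono (Continuous.aestronglyMeasurable (by fun_prop)) ?_
    refine Filter.Eventually.of_forall fun p => ?_
    simp only [Function.uncurry]
    rw [norm_mul, norm_exp_I_mul, one_mul, mul_one]
  simp only [response, conjFourier₁, intervalIntegral.intervalIntegral_eq_integral_uIoc,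
    zero_le_one, if_true, one_smul]
  rw [← integral_integral_swap hF]
  congr 1
  ext t
  rw [duhamelKernel_eq_unit, intervalIntegral.intervalIntegral_eq_integral_uIoc, if_pos zero_le_one,
    one_smul, integral_mul_const]
  have e : ∀ θ : ℝ, Complex.exp (Complex.I * (((ξ ^ m - lam + (τ - ξ ^ m) * θ) * t : ℝ) : ℂ)) =
      Complex.exp (Complex.I * ((-lam * t : ℝ) : ℂ)) * Complex.exp (Complex.I * ((ξ ^ m * t : ℝ) : ℂ)) *
        Complex.exp (Complex.I * (((τ - ξ ^ m) * (t * θ) : ℝ) : ℂ)) := by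
    intro θ; rw [← Complex.exp_add, ← Complex.exp_add]; congr 1; push_cast; ring
  simp only [e]
  rw [integral_const_mul, mulVar_apply]
  ring

/-- For |τ-ξ^m| ≥ 1 both terms of the quotient are bounded by the decay of the transform of φ. For
|τ-ξ^m| ≤ 1 the mean value form is bounded by the decay of the transform of tφ. The bound q does not
involve m or the frequencies. -/
lemma exists_response_le (r : ℝ) : ∃ q : 𝓢(ℝ, ℂ) → ℝ, IsSchwartzBound q ∧ ∀ φ m ξ τ lam,
    ‖response φ m ξ τ lam‖ ≤ q φ * (((1 + |lam - τ|) ^ (-r) + (1 + |lam - ξ ^ m|) ^ (-r)) *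
      (1 + |τ - ξ ^ m|) ^ (-1 : ℝ)) := by
  obtain ⟨q, hq, h⟩ := exists_conjFourier₁_decay r
  refine ⟨fun φ => 2 * q φ + 2 * (2 ^ |r| * q (mulVar φ)), (hq.const_mul (by norm_num)).add
    (((hq.comp mulVar).const_mul (by positivity)).const_mul (by norm_num)), fun φ m ξ τ lam => ?_⟩
  have hq0 := hq.nonneg φ
  have hq1 := hq.nonneg (mulVar φ)
  have hσ := Weight.pos (τ - ξ ^ m)
  have p1 : 0 ≤ (1 + |lam - τ|) ^ (-r) := by positivity
  have p2 : 0 ≤ (1 + |lam - ξ ^ m|) ^ (-r) := by positivity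
  have p3 : 0 ≤ (2 : ℝ) ^ |r| := by positivity
  rw [Real.rpow_neg_one, ← div_eq_mul_inv, mul_div_assoc', le_div_iff₀ hσ]
  rcases le_total 1 |τ - ξ ^ m| with h1 | h1
  · have hne : τ - ξ ^ m ≠ 0 := fun h0 => by rw [h0] at h1; simp at h1; linarith
    have h2 : ‖response φ m ξ τ lam‖ * |τ - ξ ^ m| ≤
        q φ * ((1 + |lam - τ|) ^ (-r) + (1 + |lam - ξ ^ m|) ^ (-r)) := by
      rw [response_eq_of_ne φ m ξ τ lam hne, norm_div, norm_mul, Complex.norm_I, one_mul,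
        Complex.norm_real, Real.norm_eq_abs, div_mul_cancel₀ _ (abs_ne_zero.2 hne)]
      refine (norm_sub_le _ _).trans ?_
      rw [mul_add, abs_sub_comm lam, abs_sub_comm lam]
      exact add_le_add (h _ _) (h _ _)
    calc _ ≤ ‖response φ m ξ τ lam‖ * (2 * |τ - ξ ^ m|) := by gcongr; linarith
      _ = 2 * (‖response φ m ξ τ lam‖ * |τ - ξ ^ m|) := by ring
      _ ≤ 2 * (q φ * ((1 + |lam - τ|) ^ (-r) + (1 + |lam - ξ ^ m|) ^ (-r))) := by gcongr
      _ = 2 * q φ * ((1 + |lam - τ|) ^ (-r) + (1 + |lam - ξ ^ m|) ^ (-r)) := by ring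
      _ ≤ _ := by
        refine mul_le_mul_of_nonneg_right ?_ (by positivity)
        have : 0 ≤ 2 * (2 ^ |r| * q (mulVar φ)) := by positivity
        linarith
  · have h2 : ‖response φ m ξ τ lam‖ ≤ 2 ^ |r| * q (mulVar φ) * (1 + |lam - ξ ^ m|) ^ (-r) := by
      rw [response_eq_integral]
      have := intervalIntegral.norm_integral_le_of_norm_le_const (a := 0) (b := 1)
        (C := 2 ^ |r| * q (mulVar φ) * (1 + |lam - ξ ^ m|) ^ (-r))
        (f := fun θ : ℝ => conjFourier₁ (mulVar φ) (ξ ^ m - lam + (τ - ξ ^ m) * θ))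
        (fun θ hθ => ?_)
      · simpa using this
      · rw [uIoc_of_le zero_le_one] at hθ
        refine (h _ _).trans ?_
        have hp := Weight.peetre (-r) (ξ ^ m - lam + (τ - ξ ^ m) * θ) (ξ ^ m - lam)
        rw [add_sub_cancel_left, abs_neg] at hp
        -- The intermediate point lies within distance 1 of ξ^m - `lam`, so Peetre's inequality
        -- loses only 2^{|r|}.
        have hsmall : (1 + |(τ - ξ ^ m) * θ|) ^ |r| ≤ 2 ^ |r| := by
          refine Real.rpow_le_rpow (by positivity) ?_ (abs_nonneg r)
          rw [abs_mul, abs_of_pos hθ.1]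
          nlinarith [abs_nonneg (τ - ξ ^ m), hθ.1, hθ.2]
        rw [abs_sub_comm lam]
        calc _ ≤ q (mulVar φ) * ((1 + |ξ ^ m - lam|) ^ (-r) * 2 ^ |r|) := by
              gcongr; exact hp.trans (by gcongr)
          _ = _ := by ring
    calc _ ≤ 2 ^ |r| * q (mulVar φ) * (1 + |lam - ξ ^ m|) ^ (-r) * 2 := by gcongr; linarith
      _ = 2 * (2 ^ |r| * q (mulVar φ)) * (1 + |lam - ξ ^ m|) ^ (-r) := by ring
      _ ≤ (2 * q φ + 2 * (2 ^ |r| * q (mulVar φ))) *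
          ((1 + |lam - τ|) ^ (-r) + (1 + |lam - ξ ^ m|) ^ (-r)) := by
        gcongr <;> linarith

end KdVm

namespace KdVm

lemma inv_two_pi_norm_le : ‖((2 * Real.pi : ℝ) : ℂ)⁻¹‖ ≤ 1 / 2 := by
  rw [norm_inv, Complex.norm_real, Real.norm_of_nonneg (by positivity), one_div]
  exact inv_anti₀ (by norm_num) (by linarith [Real.pi_gt_three])

/-! ### Forcings for which the Duhamel integral converges -/

/-- The weighted integrability of the forcing in frequency space under which the Duhamel solution is
a well defined tempered distribution. -/
structure DuhamelAdmissible (m : ℕ) (k : ℝ) (f : ℝ × ℝ → ℂ) : Prop where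
  nonneg : 0 ≤ k
  measurable : Measurable f
  integrable : Integrable fun p : ℝ × ℝ =>
    (1 + |p.1|) ^ (-k) * (‖f p‖ * (1 + |p.2 - p.1 ^ m|) ^ (-1 : ℝ))

/-- The forcing in the space mode `ξ` is integrable against the Duhamel kernel. -/
def GoodMode (m : ℕ) (f : ℝ × ℝ → ℂ) (ξ : ℝ) : Prop :=
  Integrable fun τ : ℝ => ‖f (ξ, τ)‖ * (1 + |τ - ξ ^ m|) ^ (-1 : ℝ)

/-- The size of the forcing in the space mode `ξ`. -/
noncomputable def modeSize (m : ℕ) (f : ℝ × ℝ → ℂ) (ξ : ℝ) : ℝ :=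
  ∫ τ : ℝ, ‖f (ξ, τ)‖ * (1 + |τ - ξ ^ m|) ^ (-1 : ℝ)

lemma modeSize_nonneg (m : ℕ) (f : ℝ × ℝ → ℂ) (ξ : ℝ) : 0 ≤ modeSize m f ξ :=
  integral_nonneg fun τ => by positivity

/-- The time Fourier transform of the Duhamel solution in the space mode `ξ`, cut off by `φ`. -/
noncomputable def cutHat (φ : 𝓢(ℝ, ℂ)) (m : ℕ) (f : ℝ × ℝ → ℂ) (ξ lam : ℝ) : ℂ :=
  ∫ t : ℝ, Complex.exp (Complex.I * ((-lam * t : ℝ) : ℂ)) * (φ t * duhamelHat m f ξ t)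

section Measurability

variable {m : ℕ} {f : ℝ × ℝ → ℂ}

lemma measurable_duhamelHat (hf : Measurable f) :
    Measurable fun p : ℝ × ℝ => duhamelHat m f p.1 p.2 := by
  unfold duhamelHat
  refine Measurable.const_mul ?_ _
  have h : StronglyMeasurable (Function.uncurry fun (p : ℝ × ℝ) (τ : ℝ) =>
      f (p.1, τ) * duhamelKernel m p.1 τ p.2) := by
    refine Measurable.stronglyMeasurable (Measurable.mul (hf.comp (by fun_prop)) ?_)
    exact (continuous_duhamelKernel m).measurable.comp
      (g := fun q : ℝ × ℝ × ℝ => duhamelKernel m q.1 q.2.1 q.2.2)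
      (f := fun q : (ℝ × ℝ) × ℝ => (q.1.1, q.2, q.1.2)) (by fun_prop)
  exact h.integral_prod_right.measurable

lemma measurable_cutHat (φ : 𝓢(ℝ, ℂ)) (hf : Measurable f) :
    Measurable fun p : ℝ × ℝ => cutHat φ m f p.1 p.2 := by
  have h : StronglyMeasurable (Function.uncurry fun (p : ℝ × ℝ) (t : ℝ) =>
      Complex.exp (Complex.I * ((-p.2 * t : ℝ) : ℂ)) * (φ t * duhamelHat m f p.1 t)) := by
    refine Measurable.stronglyMeasurable (Measurable.mul ?_ (Measurable.mul ?_ ?_))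
    · exact Continuous.measurable (by fun_prop)
    · exact Continuous.measurable (by fun_prop)
    · exact (measurable_duhamelHat (m := m) hf).comp
        (g := fun q : ℝ × ℝ => duhamelHat m f q.1 q.2)
        (f := fun q : (ℝ × ℝ) × ℝ => (q.1.1, q.2)) (by fun_prop)
  exact h.integral_prod_right.measurable

end Measurability

lemma integrable_one_add_abs_mul (φ : 𝓢(ℝ, ℂ)) : Integrable fun t : ℝ => (1 + |t|) * ‖φ t‖ := by
  obtain ⟨q, hq, h⟩ := IsSchwartzBound.exists_decay ℝ 3
  refine ((Weight.integrable (r := 2) (by norm_num)).const_mul (q φ)).mono'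
    (Continuous.aestronglyMeasurable (by fun_prop)) (Filter.Eventually.of_forall fun t => ?_)
  rw [norm_mul, norm_norm, Real.norm_of_nonneg (Weight.pos t).le]
  calc (1 + |t|) * ‖φ t‖ ≤ (1 + |t|) * (q φ * (1 + |t|) ^ (-3 : ℝ)) := by
        have := h φ t
        rw [Real.norm_eq_abs] at this
        gcongr
    _ = q φ * ((1 + |t|) ^ (1 : ℝ) * (1 + |t|) ^ (-3 : ℝ)) := by rw [Real.rpow_one]; ring
    _ = _ := by rw [Weight.rpow_mul_rpow]; norm_num

namespace GoodMode

variable {m : ℕ} {f : ℝ × ℝ → ℂ} {ξ : ℝ}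

lemma integrable_mul_kernel (hf : Measurable f) (h : GoodMode m f ξ) (t : ℝ) :
    Integrable fun τ => f (ξ, τ) * duhamelKernel m ξ τ t := by
  refine (h.const_mul (2 * (1 + |t|))).mono' ?_ (Filter.Eventually.of_forall fun τ => ?_)
  · refine ((hf.comp (by fun_prop)).mul ?_).aestronglyMeasurable
    exact (continuous_duhamelKernel m).measurable.comp
      (g := fun q : ℝ × ℝ × ℝ => duhamelKernel m q.1 q.2.1 q.2.2)
      (f := fun τ : ℝ => (ξ, τ, t)) (by fun_prop)
  · rw [norm_mul]
    calc _ ≤ ‖f (ξ, τ)‖ * (2 * (1 + |t|) * (1 + |τ - ξ ^ m|) ^ (-1 : ℝ)) := by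
          gcongr; exact norm_duhamelKernel_le m ξ τ t
      _ = _ := by ring

lemma norm_duhamelHat_le (h : GoodMode m f ξ) (t : ℝ) :
    ‖duhamelHat m f ξ t‖ ≤ (1 + |t|) * modeSize m f ξ := by
  rw [duhamelHat, norm_mul]
  calc _ ≤ 1 / 2 * ∫ τ, 2 * (1 + |t|) * (‖f (ξ, τ)‖ * (1 + |τ - ξ ^ m|) ^ (-1 : ℝ)) := by
        refine mul_le_mul inv_two_pi_norm_le ?_ (norm_nonneg _) (by norm_num)
        refine norm_integral_le_of_norm_le (h.const_mul _) (Filter.Eventually.of_forall fun τ => ?_)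
        rw [norm_mul]
        calc _ ≤ ‖f (ξ, τ)‖ * (2 * (1 + |t|) * (1 + |τ - ξ ^ m|) ^ (-1 : ℝ)) := by
              gcongr; exact norm_duhamelKernel_le m ξ τ t
          _ = _ := by ring
    _ = _ := by rw [integral_const_mul, modeSize]; ring

lemma integrable_mul_duhamelHat (hf : Measurable f) (h : GoodMode m f ξ) (φ : 𝓢(ℝ, ℂ)) :
    Integrable fun t => φ t * duhamelHat m f ξ t := by
  refine ((integrable_one_add_abs_mul φ).mul_const (modeSize m f ξ)).mono' ?_
    (Filter.Eventually.of_forall fun t => ?_)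
  · exact (φ.continuous.measurable.mul
      ((measurable_duhamelHat hf).comp (g := fun q : ℝ × ℝ => duhamelHat m f q.1 q.2)
      (f := fun t : ℝ => (ξ, t)) (by fun_prop))).aestronglyMeasurable
  · rw [norm_mul]
    calc _ ≤ ‖φ t‖ * ((1 + |t|) * modeSize m f ξ) := by gcongr; exact h.norm_duhamelHat_le t
      _ = _ := by ring

lemma norm_cutHat_le (h : GoodMode m f ξ) (φ : 𝓢(ℝ, ℂ)) (lam : ℝ) :
    ‖cutHat φ m f ξ lam‖ ≤ (∫ t, (1 + |t|) * ‖φ t‖) * modeSize m f ξ := by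
  rw [cutHat, ← integral_mul_const]
  refine norm_integral_le_of_norm_le ((integrable_one_add_abs_mul φ).mul_const _)
    (Filter.Eventually.of_forall fun t => ?_)
  rw [norm_mul, norm_exp_I_mul, one_mul, norm_mul]
  calc _ ≤ ‖φ t‖ * ((1 + |t|) * modeSize m f ξ) := by gcongr; exact h.norm_duhamelHat_le t
    _ = _ := by ring

/-- Fubini is justified by the kernel bound: its linear growth in t is absorbed by φ, and its decay
in τ is what `GoodMode` requires. -/
lemma cutHat_eq (hf : Measurable f) (h : GoodMode m f ξ) (φ : 𝓢(ℝ, ℂ)) (lam : ℝ) :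
    cutHat φ m f ξ lam = ((2 * Real.pi : ℝ) : ℂ)⁻¹ * ∫ τ, f (ξ, τ) * response φ m ξ τ lam := by
  have hF : Integrable (Function.uncurry fun (t τ : ℝ) =>
      Complex.exp (Complex.I * ((-lam * t : ℝ) : ℂ)) * (φ t * (f (ξ, τ) * duhamelKernel m ξ τ t)))
      (volume.prod volume) := by
    refine (((integrable_one_add_abs_mul φ).const_mul 2).mul_prod h).mono' ?_
      (Filter.Eventually.of_forall fun p => ?_)
    · refine Measurable.aestronglyMeasurable ?_
      refine Measurable.mul (Continuous.measurable (by fun_prop)) (Measurable.mul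
        (Continuous.measurable (by fun_prop)) (Measurable.mul (hf.comp (by fun_prop)) ?_))
      exact (continuous_duhamelKernel m).measurable.comp
        (g := fun q : ℝ × ℝ × ℝ => duhamelKernel m q.1 q.2.1 q.2.2)
        (f := fun p : ℝ × ℝ => (ξ, p.2, p.1)) (by fun_prop)
    · simp only [Function.uncurry]
      rw [norm_mul, norm_exp_I_mul, one_mul, norm_mul, norm_mul]
      calc _ ≤ ‖φ p.1‖ * (‖f (ξ, p.2)‖ * (2 * (1 + |p.1|) * (1 + |p.2 - ξ ^ m|) ^ (-1 : ℝ))) := by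
            gcongr; exact norm_duhamelKernel_le m ξ _ _
        _ = _ := by ring
  have hs := integral_integral_swap hF
  simp only [integral_const_mul] at hs
  have e1 : cutHat φ m f ξ lam = ((2 * Real.pi : ℝ) : ℂ)⁻¹ *
      ∫ t, Complex.exp (Complex.I * ((-lam * t : ℝ) : ℂ)) *
        (φ t * ∫ τ, f (ξ, τ) * duhamelKernel m ξ τ t) := by
    rw [cutHat, ← integral_const_mul]
    congr 1
    ext t
    rw [duhamelHat]
    ring
  rw [e1, hs]
  congr 2
  ext τ
  rw [response, ← integral_const_mul]
  congr 1
  ext t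
  ring

/-- Parseval's identity for the cut-off solution in a space mode. -/
lemma integral_mul_eq (hf : Measurable f) (hg : GoodMode m f ξ) (φ : 𝓢(ℝ, ℂ)) {h h' : ℝ → ℂ}
    (hi : Integrable h') (hinv : ∀ t, h t = ((2 * Real.pi : ℝ) : ℂ)⁻¹ *
      ∫ lam : ℝ, Complex.exp (Complex.I * ((-lam * t : ℝ) : ℂ)) * h' lam) :
    ∫ t, duhamelHat m f ξ t * (φ t * h t) =
      ((2 * Real.pi : ℝ) : ℂ)⁻¹ * ∫ lam, cutHat φ m f ξ lam * h' lam := by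
  have hF : Integrable (Function.uncurry fun (t lam : ℝ) =>
      Complex.exp (Complex.I * ((-lam * t : ℝ) : ℂ)) * ((φ t * duhamelHat m f ξ t) * h' lam))
      (volume.prod volume) := by
    refine ((hg.integrable_mul_duhamelHat hf φ).mul_prod hi).mono ?_
      (Filter.Eventually.of_forall fun p => ?_)
    · exact (Continuous.aestronglyMeasurable (by fun_prop)).mul
        ((hg.integrable_mul_duhamelHat hf φ).mul_prod hi).aestronglyMeasurable
    · simp only [Function.uncurry]
      rw [norm_mul, norm_exp_I_mul, one_mul]
  have hs := integral_integral_swap hF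
  have e1 : ∫ t, duhamelHat m f ξ t * (φ t * h t) = ((2 * Real.pi : ℝ) : ℂ)⁻¹ * ∫ t, ∫ lam,
      Complex.exp (Complex.I * ((-lam * t : ℝ) : ℂ)) * ((φ t * duhamelHat m f ξ t) * h' lam) := by
    rw [← integral_const_mul]
    congr 1
    ext t
    rw [hinv]
    have : ∀ lam : ℝ, Complex.exp (Complex.I * ((-lam * t : ℝ) : ℂ)) *
        ((φ t * duhamelHat m f ξ t) * h' lam) = (φ t * duhamelHat m f ξ t) *
        (Complex.exp (Complex.I * ((-lam * t : ℝ) : ℂ)) * h' lam) := fun lam => by ring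
    simp only [this]
    rw [integral_const_mul]
    ring
  rw [e1, hs]
  congr 2
  ext lam
  rw [cutHat, ← integral_mul_const]
  congr 1
  ext t
  ring

end GoodMode

namespace DuhamelAdmissible

variable {m : ℕ} {k : ℝ} {f : ℝ × ℝ → ℂ}

lemma ae_goodMode (h : DuhamelAdmissible m k f) : ∀ᵐ ξ : ℝ, GoodMode m f ξ := by
  have h1 := h.integrable
  rw [Measure.volume_eq_prod] at h1
  filter_upwards [h1.prod_right_ae] with ξ hξ
  have h2 := hξ.const_mul ((1 + |ξ|) ^ k)
  refine h2.congr (Filter.Eventually.of_forall fun τ => ?_)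
  simp only
  rw [← mul_assoc, Weight.rpow_mul_rpow]
  simp

lemma ae_prod_goodMode (h : DuhamelAdmissible m k f) : ∀ᵐ p : ℝ × ℝ, GoodMode m f p.1 :=
  Measure.quasiMeasurePreserving_fst.ae h.ae_goodMode

lemma integrable_modeSize (h : DuhamelAdmissible m k f) :
    Integrable fun ξ : ℝ => (1 + |ξ|) ^ (-k) * modeSize m f ξ := by
  have h1 := h.integrable
  rw [Measure.volume_eq_prod] at h1
  refine h1.integral_prod_left.congr (Filter.Eventually.of_forall fun ξ => ?_)
  simp only
  rw [integral_const_mul, modeSize]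

/-- The second variable is time when the solution is defined and time frequency when its cut-off is
transformed. -/
lemma integrable_of_norm_le (h : DuhamelAdmissible m k f) {g : ℝ × ℝ → ℂ} (hg : Measurable g)
    {G : ℝ → ℝ} (hG : Integrable G)
    (hle : ∀ ξ t, GoodMode m f ξ → ‖g (ξ, t)‖ ≤ (1 + |ξ|) ^ (-k) * modeSize m f ξ * G t) :
    Integrable g := by
  have h1 : Integrable (fun p : ℝ × ℝ => (1 + |p.1|) ^ (-k) * modeSize m f p.1 * G p.2)
      (volume.prod volume) := h.integrable_modeSize.mul_prod hG
  rw [Measure.volume_eq_prod]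
  refine h1.mono' hg.aestronglyMeasurable ?_
  rw [← Measure.volume_eq_prod]
  filter_upwards [h.ae_prod_goodMode] with p hp using hle p.1 p.2 hp

lemma exists_norm_duhamelHat_mul_le (m : ℕ) (k : ℝ) (f : ℝ × ℝ → ℂ) : ∃ q : 𝓢(ℝ × ℝ, ℂ) → ℝ, IsSchwartzBound q ∧
    ∀ φ ξ t, GoodMode m f ξ → ‖duhamelHat m f ξ t * conjFourierSpace φ ξ t‖ ≤
      (1 + |ξ|) ^ (-k) * modeSize m f ξ * (q φ * (1 + |t|) ^ (-2 : ℝ)) := by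
  obtain ⟨q, hq, hd⟩ := exists_conjFourierSpace_decay k (r' := 3) (by norm_num)
  refine ⟨q, hq, fun φ ξ t hξ => ?_⟩
  rw [norm_mul]
  have h0 := modeSize_nonneg m f ξ
  calc _ ≤ (1 + |t|) * modeSize m f ξ * (q φ * ((1 + |ξ|) ^ (-k) * (1 + |t|) ^ (-3 : ℝ))) := by
        gcongr
        · exact hξ.norm_duhamelHat_le t
        · exact hd φ ξ t
    _ = (1 + |ξ|) ^ (-k) * modeSize m f ξ * (q φ * ((1 + |t|) ^ (1 : ℝ) * (1 + |t|) ^ (-3 : ℝ))) := by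
        rw [Real.rpow_one]; ring
    _ = _ := by rw [Weight.rpow_mul_rpow]; norm_num

lemma integrable_mul_conjFourierSpace (h : DuhamelAdmissible m k f) (φ : 𝓢(ℝ × ℝ, ℂ)) :
    Integrable fun p : ℝ × ℝ => duhamelHat m f p.1 p.2 * conjFourierSpace φ p.1 p.2 := by
  obtain ⟨q, hq, hb⟩ := exists_norm_duhamelHat_mul_le m k f
  exact h.integrable_of_norm_le ((measurable_duhamelHat h.measurable).mul
    (continuous_conjFourierSpace φ).measurable)
    ((Weight.integrable (r := 2) (by norm_num)).const_mul (q φ)) fun ξ t => hb φ ξ t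

/-- The Duhamel solution exists. -/
lemma exists_hasSpaceFourier (h : DuhamelAdmissible m k f) :
    ∃ W : 𝓢'(ℝ × ℝ, ℂ), HasSpaceFourier W (duhamelHat m f) := by
  obtain ⟨q, hq, hb⟩ := exists_norm_duhamelHat_mul_le m k f
  have hi := h.integrable_mul_conjFourierSpace
  have hadd : ∀ φ φ' : 𝓢(ℝ × ℝ, ℂ), ∀ ξ t, conjFourierSpace (φ + φ') ξ t =
      conjFourierSpace φ ξ t + conjFourierSpace φ' ξ t := by
    intro φ φ' ξ t
    have hexp : ∀ φ : 𝓢(ℝ × ℝ, ℂ), Integrable fun x =>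
        Complex.exp (Complex.I * ((ξ * x : ℝ) : ℂ)) * φ (x, t) := by
      intro φ
      refine (integrable_slice φ t).mono (Continuous.aestronglyMeasurable (by fun_prop)) ?_
      exact Filter.Eventually.of_forall fun x => by rw [norm_mul, norm_exp_I_mul, one_mul]
    simp only [conjFourierSpace]
    rw [← integral_add (hexp φ) (hexp φ')]
    congr 1
    ext x
    rw [add_apply, mul_add]
  have hsmul : ∀ (c : ℂ) (φ : 𝓢(ℝ × ℝ, ℂ)), ∀ ξ t, conjFourierSpace (c • φ) ξ t =
      c * conjFourierSpace φ ξ t := by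
    intro c φ ξ t
    simp only [conjFourierSpace]
    rw [← integral_const_mul]
    congr 1
    ext x
    rw [smul_apply, smul_eq_mul]
    ring
  let L : 𝓢(ℝ × ℝ, ℂ) →ₗ[ℂ] ℂ :=
    { toFun := fun φ => ((2 * Real.pi : ℝ) : ℂ)⁻¹ *
        ∫ p : ℝ × ℝ, duhamelHat m f p.1 p.2 * conjFourierSpace φ p.1 p.2
      map_add' := fun φ φ' => by
        simp only [hadd, mul_add]
        rw [integral_add (hi φ) (hi φ'), mul_add]
      map_smul' := fun c φ => by
        simp only [hsmul, RingHom.id_apply, smul_eq_mul, mul_left_comm _ c]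
        rw [integral_const_mul]
        ring }
  set A : ℝ := ∫ p : ℝ × ℝ, (1 + |p.1|) ^ (-k) * modeSize m f p.1 * (1 + |p.2|) ^ (-2 : ℝ) with hA
  have hA0 : 0 ≤ A := integral_nonneg fun p => by
    have := modeSize_nonneg m f p.1; positivity
  have hAi : Integrable fun p : ℝ × ℝ =>
      (1 + |p.1|) ^ (-k) * modeSize m f p.1 * (1 + |p.2|) ^ (-2 : ℝ) := by
    rw [Measure.volume_eq_prod]
    exact h.integrable_modeSize.mul_prod (Weight.integrable (r := 2) (by norm_num))
  obtain ⟨W, hW⟩ := (hq.const_mul hA0).exists_distribution L fun φ => by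
    change ‖((2 * Real.pi : ℝ) : ℂ)⁻¹ * _‖ ≤ _
    rw [norm_mul]
    calc _ ≤ 1 * ∫ p : ℝ × ℝ, (1 + |p.1|) ^ (-k) * modeSize m f p.1 * (1 + |p.2|) ^ (-2 : ℝ) * q φ := by
          refine mul_le_mul (inv_two_pi_norm_le.trans (by norm_num)) ?_ (norm_nonneg _) (by norm_num)
          refine norm_integral_le_of_norm_le (hAi.mul_const _) ?_
          filter_upwards [h.ae_prod_goodMode] with p hp
          exact (hb φ p.1 p.2 hp).trans (le_of_eq (by ring))
      _ = _ := by rw [integral_mul_const, one_mul]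
  exact ⟨W, (measurable_duhamelHat h.measurable).aestronglyMeasurable, fun φ => ⟨hi φ, hW φ⟩⟩

lemma ae_integrable_mul_kernel (h : DuhamelAdmissible m k f) :
    ∀ᵐ ξ : ℝ, ∀ t : ℝ, Integrable (fun τ : ℝ => f (ξ, τ) * duhamelKernel m ξ τ t) volume := by
  filter_upwards [h.ae_goodMode] with ξ hξ t using hξ.integrable_mul_kernel h.measurable t

lemma exists_isDuhamel (h : DuhamelAdmissible m k f) {w : 𝓢'(ℝ × ℝ, ℂ)} (hw : HasFourier₂ w f) :
    ∃ W, IsDuhamel m w W := by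
  obtain ⟨W, hW⟩ := h.exists_hasSpaceFourier
  exact ⟨W, f, hw, h.ae_integrable_mul_kernel, hW⟩

/-- The Fourier transform of the cut-off Duhamel solution. -/
lemma hasFourier₂_cutTime₂ (h : DuhamelAdmissible m k f) {W : 𝓢'(ℝ × ℝ, ℂ)}
    (hW : HasSpaceFourier W (duhamelHat m f)) {ψ : ℝ → ℝ} {φ : 𝓢(ℝ, ℂ)} (hφ : ∀ t, φ t = ψ t)
    (hψ : Function.HasTemperateGrowth fun p : ℝ × ℝ => (ψ p.2 : ℂ)) :
    HasFourier₂ (cutTime₂ ψ W) fun p => cutHat φ m f p.1 p.2 := by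
  have hm := measurable_cutHat (m := m) φ h.measurable
  refine ⟨hm.aestronglyMeasurable, fun Φ => ?_⟩
  have hi : Integrable (fun p : ℝ × ℝ => cutHat φ m f p.1 p.2 * conjFourier₂ Φ p) volume := by
    obtain ⟨C, hC, hd⟩ := exists_conjFourier₂_decay Φ h.nonneg (r' := 2) (by norm_num)
    refine h.integrable_of_norm_le (hm.mul (continuous_conjFourier₂ Φ).measurable)
      ((Weight.integrable (r := 2) (by norm_num)).const_mul ((∫ t, (1 + |t|) * ‖φ t‖) * C))
      fun ξ lam hξ => ?_
    rw [norm_mul]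
    have h0 := modeSize_nonneg m f ξ
    have h1 : 0 ≤ ∫ t, (1 + |t|) * ‖φ t‖ := integral_nonneg fun t => by positivity
    calc _ ≤ ((∫ t, (1 + |t|) * ‖φ t‖) * modeSize m f ξ) *
          (C * ((1 + |ξ|) ^ (-k) * (1 + |lam|) ^ (-2 : ℝ))) := by
          gcongr
          · exact hξ.norm_cutHat_le φ lam
          · exact hd ξ lam
      _ = _ := by ring
  refine ⟨hi, ?_⟩
  -- The cutoff is moved to the test function. As ψ does not depend on x, it commutes with the
  -- transform in x, and Parseval applies in almost every mode.
  set Φ' : 𝓢(ℝ × ℝ, ℂ) := SchwartzMap.smulLeftCLM ℂ (fun p : ℝ × ℝ => (ψ p.2 : ℂ)) Φ with hΦ'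
  have e1 : cutTime₂ ψ W Φ = W Φ' := rfl
  have e2 : ∀ ξ t, conjFourierSpace Φ' ξ t = φ t * conjFourierSpace Φ ξ t := by
    intro ξ t
    rw [conjFourierSpace, conjFourierSpace, ← integral_const_mul]
    congr 1
    ext x
    rw [hΦ', SchwartzMap.smulLeftCLM_apply_apply hψ, smul_eq_mul, hφ]
    ring
  have hi2 := (hW.2 Φ').1
  rw [e1, (hW.2 Φ').2, pow_two, mul_assoc]
  congr 1
  rw [Measure.volume_eq_prod] at hi hi2 ⊢
  rw [integral_prod _ hi2, integral_prod _ hi, ← integral_const_mul]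
  refine integral_congr_ae ?_
  filter_upwards [h.ae_goodMode] with ξ hξ
  simp only [e2]
  exact hξ.integral_mul_eq h.measurable φ (integrable_conjFourier₂_slice Φ ξ)
    (conjFourierSpace_inversion Φ ξ)

/-- Forcings in a Bourgain space `X^{s,-b}` with `b < 1/2` are admissible. -/
lemma of_lintegral_lt_top (hf : Measurable f) {s b : ℝ} (hb : b < 1 / 2)
    (h : ∫⁻ p : ℝ × ℝ, ENNReal.ofReal ((1 + |p.1|) ^ (2 * s) * (1 + |p.2 - p.1 ^ m|) ^ (2 * -b)) *
      ‖f p‖ₑ ^ 2 < ∞) : DuhamelAdmissible m (|s| + 1) f := by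
  refine ⟨by positivity, hf, ?_⟩
  have m1 := fun t => Weight.measurable_rpow_comp (g := fun p : ℝ × ℝ => p.1) (by fun_prop) t
  have m3 := fun t => Weight.measurable_rpow_comp (g := fun p : ℝ × ℝ => p.2 - p.1 ^ m)
    (by fun_prop) t
  -- Of the loss |s| + 1 in ξ, the part |s| dominates the weight of the norm, and the part 1 makes
  -- the complementary factor square integrable.
  have hcs := sq_lintegral_mul_weight_le (μ := (volume : Measure (ℝ × ℝ))) (F := fun p => ‖f p‖ₑ)
    (a := fun p => (1 + |p.1|) ^ (-(|s| + 1)) * (1 + |p.2 - p.1 ^ m|) ^ (-1 : ℝ))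
    (u := fun p => (1 + |p.1|) ^ s * (1 + |p.2 - p.1 ^ m|) ^ (-b))
    (v := fun p => (1 + |p.1|) ^ (-1 : ℝ) * (1 + |p.2 - p.1 ^ m|) ^ (b - 1))
    hf.enorm ((m1 _).mul (m3 _)) ((m1 _).mul (m3 _)) (fun _ => by positivity) (fun p => by
      have e1 := Weight.rpow_mul_rpow p.1 s (-1)
      have e2 := Weight.rpow_mul_rpow (p.2 - p.1 ^ m) (-b) (b - 1)
      rw [show -b + (b - 1) = -1 by ring] at e2
      rw [mul_mul_mul_comm, e1, e2]
      refine mul_le_mul_of_nonneg_right (Weight.rpow_mono ?_) (by positivity)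
      linarith [neg_abs_le s])
  simp only [mul_pow, Weight.sq_rpow] at hcs
  have hv : ∫⁻ p : ℝ × ℝ, ENNReal.ofReal ((1 + |p.1|) ^ (-1 : ℝ) *
      (1 + |p.2 - p.1 ^ m|) ^ (b - 1)) ^ 2 < ∞ := by
    obtain ⟨C, hC⟩ := Weight.exists_lintegral_le (κ := 2 - 2 * b) (by linarith)
    rw [Measure.volume_eq_prod, lintegral_prod]
    · calc _ ≤ ∫⁻ ξ : ℝ, ENNReal.ofReal ((1 + |ξ|) ^ (-2 : ℝ)) * C := by
            refine lintegral_mono fun ξ => ?_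
            calc _ = ∫⁻ τ, ENNReal.ofReal ((1 + |ξ|) ^ (-2 : ℝ)) *
                  ENNReal.ofReal ((1 + |τ - ξ ^ m|) ^ (-(2 - 2 * b))) := by
                  refine lintegral_congr fun τ => ?_
                  rw [← ENNReal.ofReal_pow (by positivity), ← ENNReal.ofReal_mul (by positivity),
                    mul_pow, Weight.sq_rpow, Weight.sq_rpow]
                  ring_nf
              _ ≤ _ := by
                  rw [lintegral_const_mul' _ _ (by finiteness)]
                  gcongr
                  exact (hC _).1
        _ = (∫⁻ ξ : ℝ, ENNReal.ofReal ((1 + |ξ|) ^ (-2 : ℝ))) * C :=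
            lintegral_mul_const' _ _ (by finiteness)
        _ < ∞ := ENNReal.mul_lt_top (Weight.lintegral_lt_top (by norm_num)) (by finiteness)
    · exact (((m1 _).mul (m3 _)).ennreal_ofReal.pow_const 2).aemeasurable
  have hfin := hcs.trans_lt (ENNReal.mul_lt_top h hv)
  refine ⟨((m1 _).mul (hf.norm.mul (m3 _))).aestronglyMeasurable, ?_⟩
  rw [hasFiniteIntegral_iff_enorm]
  refine lt_of_le_of_lt (le_of_eq (lintegral_congr fun p => ?_))
    ((ENNReal.pow_lt_top_iff (n := 2)).1 hfin |>.resolve_right (by norm_num))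
  rw [enorm_mul, enorm_mul, enorm_norm, Real.enorm_of_nonneg (by positivity),
    Real.enorm_of_nonneg (by positivity), ENNReal.ofReal_mul (by positivity)]
  ring

end DuhamelAdmissible

/-! ### Measurable representatives -/

lemma HasFourier₂.congr {u : 𝓢'(ℝ × ℝ, ℂ)} {f g : ℝ × ℝ → ℂ} (hf : HasFourier₂ u f)
    (h : f =ᵐ[volume] g) : HasFourier₂ u g := by
  refine ⟨hf.1.congr h, fun φ => ?_⟩
  have h1 : (fun p => f p * conjFourier₂ φ p) =ᵐ[volume] fun p => g p * conjFourier₂ φ p := by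
    filter_upwards [h] with p hp
    rw [hp]
  exact ⟨(hf.2 φ).1.congr h1, by rw [(hf.2 φ).2, integral_congr_ae h1]⟩

lemma HasSpaceFourier.congr {u : 𝓢'(ℝ × ℝ, ℂ)} {f g : ℝ → ℝ → ℂ} (hf : HasSpaceFourier u f)
    (h : ∀ᵐ ξ : ℝ, ∀ t, f ξ t = g ξ t) : HasSpaceFourier u g := by
  have h0 : ∀ᵐ p : ℝ × ℝ, ∀ t, f p.1 t = g p.1 t := Measure.quasiMeasurePreserving_fst.ae h
  refine ⟨hf.1.congr (by filter_upwards [h0] with p hp using hp p.2), fun φ => ?_⟩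
  have h1 : (fun p : ℝ × ℝ => f p.1 p.2 * conjFourierSpace φ p.1 p.2) =ᵐ[volume]
      fun p => g p.1 p.2 * conjFourierSpace φ p.1 p.2 := by
    filter_upwards [h0] with p hp
    rw [hp]
  exact ⟨(hf.2 φ).1.congr h1, by rw [(hf.2 φ).2, integral_congr_ae h1]⟩

/-- The exceptional set of ξ does not depend on t, since t enters only through the kernel. -/
lemma duhamelHat_congr_ae (m : ℕ) {f g : ℝ × ℝ → ℂ} (h : f =ᵐ[volume] g) :
    ∀ᵐ ξ : ℝ, ∀ t, duhamelHat m f ξ t = duhamelHat m g ξ t := by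
  rw [Measure.volume_eq_prod] at h
  filter_upwards [Measure.ae_ae_of_ae_prod h] with ξ hξ t
  rw [duhamelHat, duhamelHat]
  congr 1
  refine integral_congr_ae ?_
  filter_upwards [hξ] with τ hτ
  rw [hτ]

lemma HasFourier₂.exists_measurable {u : 𝓢'(ℝ × ℝ, ℂ)} {f : ℝ × ℝ → ℂ} (hf : HasFourier₂ u f) :
    ∃ g, Measurable g ∧ HasFourier₂ u g :=
  ⟨hf.1.mk f, hf.1.measurable_mk, hf.congr hf.1.ae_eq_mk⟩

/-- Every Duhamel solution may thus be computed from one chosen measurable representative, so that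
an estimate for that representative covers all of them. -/
lemma IsDuhamel.hasSpaceFourier {m : ℕ} {w W : 𝓢'(ℝ × ℝ, ℂ)} (h : IsDuhamel m w W)
    {f : ℝ × ℝ → ℂ} (hf : HasFourier₂ w f) : HasSpaceFourier W (duhamelHat m f) := by
  obtain ⟨g, hg, -, hW⟩ := h
  exact hW.congr (duhamelHat_congr_ae m (hg.ae_eq hf))

end KdVm

namespace KdVm

/-! ### Cut-offs -/

namespace IsCutoff

variable {ψ : ℝ → ℝ}

lemma contDiff_ofReal (h : IsCutoff ψ) :
    ContDiff ℝ ((⊤ : ℕ∞) : WithTop ℕ∞) fun t : ℝ => (ψ t : ℂ) :=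
  Complex.ofRealCLM.contDiff.comp h.contDiff

lemma hasCompactSupport_ofReal (h : IsCutoff ψ) : HasCompactSupport fun t : ℝ => (ψ t : ℂ) := by
  have h1 : HasCompactSupport ψ :=
    isCompact_Icc.of_isClosed_subset (isClosed_tsupport ψ)
      (h.tsupport_subset.trans Ioo_subset_Icc_self)
  exact h1.comp_left (g := fun x : ℝ => (x : ℂ)) (by simp)

lemma hasTemperateGrowth (h : IsCutoff ψ) : Function.HasTemperateGrowth fun t : ℝ => (ψ t : ℂ) :=
  h.hasCompactSupport_ofReal.hasTemperateGrowth h.contDiff_ofReal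

lemma hasTemperateGrowth_snd (h : IsCutoff ψ) :
    Function.HasTemperateGrowth fun p : ℝ × ℝ => (ψ p.2 : ℂ) :=
  h.hasTemperateGrowth.comp (ContinuousLinearMap.snd ℝ ℝ ℝ).hasTemperateGrowth

lemma exists_schwartz (h : IsCutoff ψ) : ∃ φ : 𝓢(ℝ, ℂ), ∀ t, φ t = ψ t :=
  ⟨h.hasCompactSupport_ofReal.toSchwartzMap h.contDiff_ofReal, fun _ => rfl⟩

end IsCutoff

/-! ### The estimate in Bourgain spaces -/

lemma GoodMode.enorm_cutHat_le {m : ℕ} {f : ℝ × ℝ → ℂ} {ξ : ℝ} (h : GoodMode m f ξ)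
    (hf : Measurable f) {φ : 𝓢(ℝ, ℂ)} {c r : ℝ} (hc : 0 ≤ c) (hφ : ∀ ξ τ lam,
      ‖response φ m ξ τ lam‖ ≤ c * (((1 + |lam - τ|) ^ (-r) + (1 + |lam - ξ ^ m|) ^ (-r)) *
        (1 + |τ - ξ ^ m|) ^ (-1 : ℝ))) (lam : ℝ) :
    ‖cutHat φ m f ξ lam‖ₑ ≤ ENNReal.ofReal c * ∫⁻ τ, ‖f (ξ, τ)‖ₑ * ENNReal.ofReal
      (((1 + |lam - τ|) ^ (-r) + (1 + |lam - ξ ^ m|) ^ (-r)) * (1 + |τ - ξ ^ m|) ^ (-1 : ℝ)) := by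
  rw [h.cutHat_eq hf, enorm_mul]
  calc _ ≤ 1 * ∫⁻ τ, ‖f (ξ, τ) * response φ m ξ τ lam‖ₑ := by
        gcongr
        · rw [← ofReal_norm, ← ENNReal.ofReal_one]
          exact ENNReal.ofReal_le_ofReal (inv_two_pi_norm_le.trans (by norm_num))
        · exact enorm_integral_le_lintegral_enorm _
    _ ≤ ∫⁻ τ, ENNReal.ofReal c * (‖f (ξ, τ)‖ₑ * ENNReal.ofReal
      (((1 + |lam - τ|) ^ (-r) + (1 + |lam - ξ ^ m|) ^ (-r)) * (1 + |τ - ξ ^ m|) ^ (-1 : ℝ))) := by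
        rw [one_mul]
        refine lintegral_mono fun τ => ?_
        rw [enorm_mul, mul_left_comm, ← ENNReal.ofReal_mul hc]
        gcongr
        rw [← ofReal_norm]
        exact ENNReal.ofReal_le_ofReal (hφ ξ τ lam)
    _ = _ := lintegral_const_mul' _ _ (by finiteness)

lemma exists_lintegral_cutHat_le {a β : ℝ} (ha0 : 0 ≤ a) (ha : a < 1 / 2) (hab : a + β ≤ 1) :
    ∃ C : ℝ≥0, ∀ (m : ℕ) (f : ℝ × ℝ → ℂ) (ξ : ℝ) (φ : 𝓢(ℝ, ℂ)) (c : ℝ), GoodMode m f ξ →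
      Measurable f → 0 ≤ c → (∀ ξ τ lam, ‖response φ m ξ τ lam‖ ≤
        c * (((1 + |lam - τ|) ^ (-3 : ℝ) + (1 + |lam - ξ ^ m|) ^ (-3 : ℝ)) *
          (1 + |τ - ξ ^ m|) ^ (-1 : ℝ))) →
      ∫⁻ lam, ENNReal.ofReal ((1 + |lam - ξ ^ m|) ^ (2 * β)) * ‖cutHat φ m f ξ lam‖ₑ ^ 2 ≤
        C * ENNReal.ofReal c ^ 2 *
          ∫⁻ τ, ENNReal.ofReal ((1 + |τ - ξ ^ m|) ^ (2 * -a)) * ‖f (ξ, τ)‖ₑ ^ 2 := by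
  obtain ⟨C, hC⟩ := Weight.exists_duhamel_le ha0 ha hab
  refine ⟨C, fun m f ξ φ c h hf hc hφ => ?_⟩
  have hF : Measurable fun τ => ‖f (ξ, τ)‖ₑ := (hf.comp (by fun_prop)).enorm
  calc _ ≤ ∫⁻ lam, ENNReal.ofReal c ^ 2 * (ENNReal.ofReal ((1 + |lam - ξ ^ m|) ^ (2 * β)) *
        (∫⁻ τ, ‖f (ξ, τ)‖ₑ * ENNReal.ofReal (((1 + |lam - τ|) ^ (-3 : ℝ) +
          (1 + |lam - ξ ^ m|) ^ (-3 : ℝ)) * (1 + |τ - ξ ^ m|) ^ (-1 : ℝ))) ^ 2) := by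
        refine lintegral_mono fun lam => ?_
        rw [mul_left_comm, ← mul_pow]
        gcongr
        exact h.enorm_cutHat_le hf hc hφ lam
    _ ≤ _ := by
        rw [lintegral_const_mul' _ _ (by finiteness), mul_comm (C : ℝ≥0∞), mul_assoc]
        gcongr
        exact hC _ hF _

/-- The two summands of the modified norm are estimated separately: (a, β) = (b, b) is admissible as
b < 1/2, and (1-α, α) as α > 1/2. -/
lemma exists_lintegral_mode_le {b α : ℝ} (s : ℝ) (hb0 : 0 < b) (hb : b < 1 / 2) (hα : 1 / 2 < α)
    (hα1 : α < 1) :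
    ∃ C : ℝ≥0, ∀ (m : ℕ) (f : ℝ × ℝ → ℂ) (ξ : ℝ) (φ : 𝓢(ℝ, ℂ)) (c : ℝ), GoodMode m f ξ →
      Measurable f → 0 ≤ c → (∀ ξ τ lam, ‖response φ m ξ τ lam‖ ≤
        c * (((1 + |lam - τ|) ^ (-3 : ℝ) + (1 + |lam - ξ ^ m|) ^ (-3 : ℝ)) *
          (1 + |τ - ξ ^ m|) ^ (-1 : ℝ))) →
      ∫⁻ lam, ENNReal.ofReal ((1 + |ξ|) ^ (2 * s) * (1 + |lam - ξ ^ m|) ^ (2 * b)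
        + (Icc (-1 : ℝ) 1).indicator (fun _ => (1 + |lam|) ^ (2 * α)) ξ) *
          ‖cutHat φ m f ξ lam‖ₑ ^ 2 ≤
        C * ENNReal.ofReal c ^ 2 *
          ∫⁻ τ, ENNReal.ofReal ((1 + |ξ|) ^ (2 * s) * (1 + |τ - ξ ^ m|) ^ (2 * -b)
        + (Icc (-1 : ℝ) 1).indicator (fun _ => (1 + |τ|) ^ (2 * (α - 1))) ξ) * ‖f (ξ, τ)‖ₑ ^ 2 := by
  obtain ⟨C₁, hC₁⟩ := exists_lintegral_cutHat_le (a := b) (β := b) hb0.le hb (by linarith)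
  obtain ⟨C₂, hC₂⟩ := exists_lintegral_cutHat_le (a := 1 - α) (β := α) (by linarith) (by linarith)
    (by linarith)
  refine ⟨C₁ + 16 * C₂, fun m f ξ φ c h hf hc hφ => ?_⟩
  have hG : Measurable fun lam => ‖cutHat φ m f ξ lam‖ₑ ^ 2 :=
    (((measurable_cutHat φ hf).comp (g := fun q : ℝ × ℝ => cutHat φ m f q.1 q.2)
      (f := fun lam : ℝ => (ξ, lam)) (by fun_prop)).enorm).pow_const 2
  have hF : Measurable fun τ => ‖f (ξ, τ)‖ₑ ^ 2 := (hf.comp (by fun_prop)).enorm.pow_const 2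
  have m1 : ∀ t : ℝ, Measurable fun x : ℝ => ENNReal.ofReal ((1 + |x - ξ ^ m|) ^ t) := fun t =>
    (Weight.measurable_rpow_comp (g := fun x : ℝ => x - ξ ^ m) (by fun_prop) t).ennreal_ofReal
  have m2 : ∀ t : ℝ, Measurable fun x : ℝ => ENNReal.ofReal ((1 + |x|) ^ t) := fun t =>
    (Weight.measurable_rpow t).ennreal_ofReal
  have hX : ENNReal.ofReal ((1 + |ξ|) ^ (2 * s)) *
      ∫⁻ lam, ENNReal.ofReal ((1 + |lam - ξ ^ m|) ^ (2 * b)) * ‖cutHat φ m f ξ lam‖ₑ ^ 2 ≤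
      C₁ * ENNReal.ofReal c ^ 2 * (ENNReal.ofReal ((1 + |ξ|) ^ (2 * s)) *
        ∫⁻ τ, ENNReal.ofReal ((1 + |τ - ξ ^ m|) ^ (2 * -b)) * ‖f (ξ, τ)‖ₑ ^ 2) := by
    rw [mul_left_comm]
    gcongr
    exact hC₁ m f ξ φ c h hf hc hφ
  have hsplit : ∀ (t u : ℝ) (H : ℝ → ℝ≥0∞), Measurable H →
      ∫⁻ x, ENNReal.ofReal ((1 + |ξ|) ^ (2 * s) * (1 + |x - ξ ^ m|) ^ t +
        (Icc (-1 : ℝ) 1).indicator (fun _ => (1 + |x|) ^ u) ξ) * H x =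
      ENNReal.ofReal ((1 + |ξ|) ^ (2 * s)) * (∫⁻ x, ENNReal.ofReal ((1 + |x - ξ ^ m|) ^ t) * H x) +
        (Icc (-1 : ℝ) 1).indicator (fun _ => ∫⁻ x, ENNReal.ofReal ((1 + |x|) ^ u) * H x) ξ := by
    intro t u H hH
    rw [← lintegral_const_mul' _ _ (by finiteness)]
    by_cases hξ : ξ ∈ Icc (-1 : ℝ) 1
    · simp only [indicator_of_mem hξ]
      have hm : Measurable fun x => ENNReal.ofReal ((1 + |ξ|) ^ (2 * s)) *
          (ENNReal.ofReal ((1 + |x - ξ ^ m|) ^ t) * H x) := ((m1 t).mul hH).const_mul _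
      rw [← lintegral_add_left hm]
      refine lintegral_congr fun x => ?_
      rw [ENNReal.ofReal_add (by positivity) (by positivity), ENNReal.ofReal_mul (by positivity)]
      ring
    · simp only [indicator_of_notMem hξ, add_zero]
      refine lintegral_congr fun x => ?_
      rw [ENNReal.ofReal_mul (by positivity)]
      ring
  rw [hsplit _ _ _ hG, hsplit _ _ _ hF]
  by_cases hξ : ξ ∈ Icc (-1 : ℝ) 1
  · simp only [indicator_of_mem hξ]
    have hη : |ξ ^ m| ≤ 1 := by rw [abs_pow]; exact pow_le_one₀ (abs_nonneg _) (abs_le.2 hξ)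
    -- For |ξ| ≤ 1 the shift by ξ^m is at most 1 and changes the weights by a factor of at most 2² =
    -- 4. It is made once in the output and once in the input, whence the 16.
    have hcmp : ∀ (x y t : ℝ), |y - x| ≤ 1 → |t| ≤ 2 →
        ENNReal.ofReal ((1 + |x|) ^ t) ≤ 4 * ENNReal.ofReal ((1 + |y|) ^ t) := by
      intro x y t hxy ht
      have h4 : (4 : ℝ≥0∞) = ENNReal.ofReal 4 := by norm_num
      rw [h4, ← ENNReal.ofReal_mul (by norm_num)]
      refine ENNReal.ofReal_le_ofReal ?_
      have hp := Weight.peetre t x y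
      have h5 : (1 + |x - y|) ^ |t| ≤ 4 := by
        rw [abs_sub_comm]
        calc (1 + |y - x|) ^ |t| ≤ (1 + |y - x|) ^ (2 : ℝ) := Weight.rpow_mono ht
          _ = (1 + |y - x|) ^ 2 := by rw [← Real.rpow_natCast]; norm_num
          _ ≤ 4 := by nlinarith [abs_nonneg (y - x)]
      calc _ ≤ _ := hp
        _ ≤ (1 + |y|) ^ t * 4 := by gcongr
        _ = _ := by ring
    have hY : ∫⁻ lam, ENNReal.ofReal ((1 + |lam|) ^ (2 * α)) * ‖cutHat φ m f ξ lam‖ₑ ^ 2 ≤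
        16 * C₂ * ENNReal.ofReal c ^ 2 *
          ∫⁻ τ, ENNReal.ofReal ((1 + |τ|) ^ (2 * (α - 1))) * ‖f (ξ, τ)‖ₑ ^ 2 := by
      calc _ ≤ ∫⁻ lam, 4 * (ENNReal.ofReal ((1 + |lam - ξ ^ m|) ^ (2 * α)) *
            ‖cutHat φ m f ξ lam‖ₑ ^ 2) := by
            refine lintegral_mono fun lam => ?_
            rw [← mul_assoc]
            gcongr
            refine hcmp _ _ _ (by simpa using hη) ?_
            rw [abs_of_pos (by linarith)]; linarith
        _ ≤ 4 * (C₂ * ENNReal.ofReal c ^ 2 *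
            ∫⁻ τ, ENNReal.ofReal ((1 + |τ - ξ ^ m|) ^ (2 * -(1 - α))) * ‖f (ξ, τ)‖ₑ ^ 2) := by
            rw [lintegral_const_mul' _ _ (by finiteness)]
            gcongr
            exact hC₂ m f ξ φ c h hf hc hφ
        _ ≤ 4 * (C₂ * ENNReal.ofReal c ^ 2 *
            ∫⁻ τ, 4 * (ENNReal.ofReal ((1 + |τ|) ^ (2 * (α - 1))) * ‖f (ξ, τ)‖ₑ ^ 2)) := by
            refine mul_le_mul' le_rfl (mul_le_mul' le_rfl (lintegral_mono fun τ => ?_))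
            rw [← mul_assoc]
            gcongr
            rw [show 2 * -(1 - α) = 2 * (α - 1) by ring]
            refine hcmp _ _ _ (by simpa using hη) ?_
            rw [abs_of_neg (by linarith)]; linarith
        _ = _ := by
            rw [lintegral_const_mul' _ _ (by finiteness)]
            ring
    refine (add_le_add hX hY).trans ?_
    set A := ENNReal.ofReal ((1 + |ξ|) ^ (2 * s)) *
        ∫⁻ τ, ENNReal.ofReal ((1 + |τ - ξ ^ m|) ^ (2 * -b)) * ‖f (ξ, τ)‖ₑ ^ 2
    set B := ∫⁻ τ, ENNReal.ofReal ((1 + |τ|) ^ (2 * (α - 1))) * ‖f (ξ, τ)‖ₑ ^ 2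
    push_cast
    calc _ ≤ (C₁ + 16 * C₂) * ENNReal.ofReal c ^ 2 * A +
          (C₁ + 16 * C₂) * ENNReal.ofReal c ^ 2 * B := by
          gcongr
          · exact le_self_add
          · exact le_add_self
      _ = _ := by ring
  · simp only [indicator_of_notMem hξ, add_zero]
    refine hX.trans ?_
    gcongr
    exact le_self_add

lemma ENNReal_sqrt_le {A N : ℝ≥0∞} {K c : ℝ≥0} (h : A ≤ K * (c : ℝ≥0∞) ^ 2 * N) :
    A ^ (1 / 2 : ℝ) ≤ (K ^ (1 / 2 : ℝ) : ℝ≥0) * c * N ^ (1 / 2 : ℝ) := by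
  refine (ENNReal.rpow_le_rpow h (by norm_num)).trans (le_of_eq ?_)
  rw [ENNReal.mul_rpow_of_nonneg _ _ (by norm_num), ENNReal.mul_rpow_of_nonneg _ _ (by norm_num),
    ← ENNReal.rpow_natCast, ← ENNReal.rpow_mul, ENNReal.coe_rpow_of_nonneg _ (by norm_num)]
  norm_num

/-- The estimate of the cut-off Duhamel solution in the modified Bourgain spaces. -/
theorem bourgain_estimate :
    ∃ cψ : (ℝ → ℝ) → ℝ≥0, ∀ m : ℕ, ∀ s b α : ℝ,
      0 < b → b < 1 / 2 → 1 / 2 < α → α < 1 →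
      ∃ C : ℝ≥0, ∀ ψ : ℝ → ℝ, IsCutoff ψ →
        ∀ w : 𝓢'(ℝ × ℝ, ℂ), XModNorm m s (-b) (α - 1) w < ∞ →
          (∃ W, IsDuhamel m w W) ∧
          ∀ W, IsDuhamel m w W →
            XModNorm m s b α (cutTime₂ ψ W) ≤ C * cψ ψ * XModNorm m s (-b) (α - 1) w := by
  -- The decay exponent 3 suffices for all parameters, so q, and with it `cψ`, is fixed before m, s,
  -- b and α.
  obtain ⟨q, hq, hresp⟩ := exists_response_le 3
  have hex : ∀ ψ : ℝ → ℝ, ∃ c : ℝ≥0, IsCutoff ψ → ∃ φ : 𝓢(ℝ, ℂ), (∀ t, φ t = ψ t) ∧ (c : ℝ) = q φ := by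
    intro ψ
    by_cases h : IsCutoff ψ
    · obtain ⟨φ, hφ⟩ := h.exists_schwartz
      exact ⟨⟨q φ, hq.nonneg φ⟩, fun _ => ⟨φ, hφ, rfl⟩⟩
    · exact ⟨0, fun h' => absurd h' h⟩
  choose cψ hcψ using hex
  refine ⟨cψ, fun m s b α hb0 hb hα hα1 => ?_⟩
  obtain ⟨K, hK⟩ := exists_lintegral_mode_le s hb0 hb hα hα1
  refine ⟨K ^ (1 / 2 : ℝ), fun ψ hψ w hw => ?_⟩
  obtain ⟨φ, hφ, hc⟩ := hcψ ψ hψ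
  obtain ⟨f₀, hf₀⟩ := exists_hasFourier₂ hw
  obtain ⟨f, hfm, hf⟩ := hf₀.exists_measurable
  have hnorm := weightedNorm₂_eq (ω := fun p => (1 + |p.1|) ^ (2 * s) *
    (1 + |p.2 - p.1 ^ m|) ^ (2 * -b)
    + (Icc (-1 : ℝ) 1).indicator (fun _ => (1 + |p.2|) ^ (2 * (α - 1))) p.1) hf
  have hind : ∀ (x y : ℝ) (u : ℝ),
      0 ≤ (Icc (-1 : ℝ) 1).indicator (fun _ => (1 + |y|) ^ u) x := fun x y u =>
    indicator_nonneg (fun _ _ => by positivity) x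
  have hadm : DuhamelAdmissible m (|s| + 1) f := by
    refine DuhamelAdmissible.of_lintegral_lt_top hfm hb ?_
    rw [XModNorm, hnorm] at hw
    refine lt_of_le_of_lt (lintegral_mono fun p => ?_)
      ((ENNReal.rpow_lt_top_iff_of_pos (by norm_num)).1 hw)
    gcongr
    exact le_add_of_nonneg_right (hind _ _ _)
  refine ⟨hadm.exists_isDuhamel hf, fun W hW => ?_⟩
  have hcut := hadm.hasFourier₂_cutTime₂ (hW.hasSpaceFourier hf) hφ hψ.hasTemperateGrowth_snd
  rw [XModNorm, XModNorm, weightedNorm₂_eq hcut, hnorm]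
  refine ENNReal_sqrt_le ?_
  have mind : ∀ u : ℝ, Measurable fun p : ℝ × ℝ =>
      (Icc (-1 : ℝ) 1).indicator (fun _ => (1 + |p.2|) ^ u) p.1 := by
    intro u
    have h1 : (fun p : ℝ × ℝ => (Icc (-1 : ℝ) 1).indicator (fun _ => (1 + |p.2|) ^ u) p.1) =
        (Prod.fst ⁻¹' Icc (-1 : ℝ) 1).indicator fun p : ℝ × ℝ => (1 + |p.2|) ^ u := by
      ext p
      simp only [indicator, mem_preimage]
    rw [h1]
    exact (Weight.measurable_rpow_comp (by fun_prop) u).indicator (measurable_fst measurableSet_Icc)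
  have m1 := fun t => Weight.measurable_rpow_comp (g := fun p : ℝ × ℝ => p.1) (by fun_prop) t
  have m3 := fun t => Weight.measurable_rpow_comp (g := fun p : ℝ × ℝ => p.2 - p.1 ^ m)
    (by fun_prop) t
  have hω : ∀ t u : ℝ, Measurable fun p : ℝ × ℝ => ENNReal.ofReal ((1 + |p.1|) ^ (2 * s) *
      (1 + |p.2 - p.1 ^ m|) ^ t + (Icc (-1 : ℝ) 1).indicator (fun _ => (1 + |p.2|) ^ u) p.1) :=
    fun t u => (((m1 _).mul (m3 _)).add (mind u)).ennreal_ofReal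
  have hprod : ∀ (t u : ℝ) (G : ℝ × ℝ → ℝ≥0∞), Measurable G →
      ∫⁻ p : ℝ × ℝ, ENNReal.ofReal ((1 + |p.1|) ^ (2 * s) * (1 + |p.2 - p.1 ^ m|) ^ t +
        (Icc (-1 : ℝ) 1).indicator (fun _ => (1 + |p.2|) ^ u) p.1) * G p =
      ∫⁻ ξ : ℝ, ∫⁻ lam : ℝ, ENNReal.ofReal ((1 + |ξ|) ^ (2 * s) * (1 + |lam - ξ ^ m|) ^ t +
        (Icc (-1 : ℝ) 1).indicator (fun _ => (1 + |lam|) ^ u) ξ) * G (ξ, lam) := fun t u G hG =>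
    lintegral_prod (μ := volume) (ν := volume) _ ((hω t u).mul hG).aemeasurable
  rw [hprod _ _ _ ((measurable_cutHat φ hfm).enorm.pow_const 2),
    hprod _ _ _ (hfm.enorm.pow_const 2), ← lintegral_const_mul' _ _ (by finiteness)]
  refine lintegral_mono_ae ?_
  filter_upwards [hadm.ae_goodMode] with ξ hξ
  have := hK m f ξ φ (q φ) hξ hfm (hq.nonneg φ) (hresp φ m)
  rwa [← hc, ENNReal.ofReal_coe_nnreal] at this

end KdVm

/-! ### Tensor products of test functions and uniqueness of traces -/

/-- The tensor product of two test functions. -/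
lemma SchwartzMap.exists_prod_eq (χ φ : 𝓢(ℝ, ℂ)) :
    ∃ Φ : 𝓢(ℝ × ℝ, ℂ), ∀ x t, Φ (x, t) = χ x * φ t := by
  have h1 : ContDiff ℝ ((⊤ : ℕ∞) : WithTop ℕ∞) fun p : ℝ × ℝ => χ p.1 :=
    (χ.smooth ⊤).comp contDiff_fst
  have h2 : ContDiff ℝ ((⊤ : ℕ∞) : WithTop ℕ∞) fun p : ℝ × ℝ => φ p.2 :=
    (φ.smooth ⊤).comp contDiff_snd
  -- Each factor is a one-variable Schwartz function composed with a coordinate projection, and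
  -- composition with a linear map of norm at most 1 does not increase derivatives.
  have hbd : ∀ (η : 𝓢(ℝ, ℂ)) (k i : ℕ), ∃ C : ℝ, ∀ (L : ℝ × ℝ →L[ℝ] ℝ), ‖L‖ ≤ 1 → ∀ p,
      (1 + |L p|) ^ k * ‖iteratedFDeriv ℝ i (fun p => η (L p)) p‖ ≤ C := by
    intro η k i
    refine ⟨_, fun L hL p => le_trans ?_ (one_add_le_sup_seminorm_apply (𝕜 := ℂ) (m := (k, i))
      (k := k) (n := i) le_rfl le_rfl η (L p))⟩
    rw [Real.norm_eq_abs]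
    refine mul_le_mul_of_nonneg_left ?_ (by positivity)
    have e := L.iteratedFDeriv_comp_right (f := η) (n := ((⊤ : ℕ∞) : WithTop ℕ∞)) (η.smooth ⊤) p
      (i := i) (by exact_mod_cast le_top)
    have e' : iteratedFDeriv ℝ i (fun p => η (L p)) p =
      (iteratedFDeriv ℝ i η (L p)).compContinuousLinearMap fun _ => L := e
    rw [e']
    refine (ContinuousMultilinearMap.norm_compContinuousLinearMap_le _ _).trans ?_
    refine mul_le_of_le_one_right (norm_nonneg _) ?_
    exact Finset.prod_le_one (fun _ _ => norm_nonneg _) fun _ _ => hL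
  refine ⟨⟨fun p => χ p.1 * φ p.2, h1.mul h2, fun k n => ?_⟩, fun _ _ => rfl⟩
  choose C hC using fun i => hbd χ k i
  choose D hD using fun i => hbd φ k i
  refine ⟨∑ i ∈ Finset.range (n + 1), (n.choose i : ℝ) * (C i * D (n - i)), fun p => ?_⟩
  have hk : ‖p‖ ^ k ≤ (1 + |p.1|) ^ k * (1 + |p.2|) ^ k := by
    rw [← mul_pow]
    refine pow_le_pow_left₀ (norm_nonneg _) ?_ k
    rw [Prod.norm_def, Real.norm_eq_abs, Real.norm_eq_abs]
    have := mul_nonneg (abs_nonneg p.1) (abs_nonneg p.2)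
    exact max_le (by nlinarith [abs_nonneg p.2]) (by nlinarith [abs_nonneg p.1])
  have hmul := norm_iteratedFDeriv_mul_le (𝕜 := ℝ) h1 h2 p (n := n) (by exact_mod_cast le_top)
  refine (mul_le_mul_of_nonneg_left hmul (by positivity)).trans ?_
  rw [Finset.mul_sum]
  refine Finset.sum_le_sum fun i _ => ?_
  have a1 := hC i (ContinuousLinearMap.fst ℝ ℝ ℝ) (ContinuousLinearMap.norm_fst_le ..) p
  have a2 := hD (n - i) (ContinuousLinearMap.snd ℝ ℝ ℝ) (ContinuousLinearMap.norm_snd_le ..) p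
  simp only [ContinuousLinearMap.coe_fst', ContinuousLinearMap.coe_snd'] at a1 a2
  have hC0 : 0 ≤ C i := le_trans (by positivity) a1
  calc _ ≤ ((1 + |p.1|) ^ k * (1 + |p.2|) ^ k) * ((n.choose i : ℝ) *
        ‖iteratedFDeriv ℝ i (fun p : ℝ × ℝ => χ p.1) p‖ *
        ‖iteratedFDeriv ℝ (n - i) (fun p : ℝ × ℝ => φ p.2) p‖) := by gcongr
    _ = (n.choose i : ℝ) *
        (((1 + |p.1|) ^ k * ‖iteratedFDeriv ℝ i (fun p : ℝ × ℝ => χ p.1) p‖) *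
        ((1 + |p.2|) ^ k * ‖iteratedFDeriv ℝ (n - i) (fun p : ℝ × ℝ => φ p.2) p‖)) := by ring
    _ ≤ _ := by gcongr

namespace KdVm

lemma xDeriv_apply (ℓ : ℕ) (W : 𝓢'(ℝ × ℝ, ℂ)) (Φ : 𝓢(ℝ × ℝ, ℂ)) :
    xDeriv ℓ W Φ = (-1 : ℂ) ^ ℓ * W ((fun φ : 𝓢(ℝ × ℝ, ℂ) => ∂_{((1 : ℝ), (0 : ℝ))} φ)^[ℓ] Φ) := by
  induction ℓ generalizing Φ with
  | zero => simp [xDeriv]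
  | succ n ih =>
    rw [xDeriv, Function.iterate_succ_apply', TemperedDistribution.lineDerivOp_apply_apply,
      ← xDeriv, map_neg, ih, Function.iterate_succ_apply, pow_succ]
    ring

/-- The trace of a distribution is unique. -/
lemma IsTrace.unique {V : 𝓢'(ℝ × ℝ, ℂ)} {T T' : ℝ → 𝓢'(ℝ, ℂ)} (h : IsTrace V T)
    (h' : IsTrace V T') : T = T' := by
  funext x
  ext φ
  have hc : Continuous fun x => T x φ - T' x φ := (h.1 φ).sub (h'.1 φ)
  -- Tensor products with compactly supported smooth functions of x give equality almost everywhere;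
  -- weak continuity then gives it for every x.
  have h0 : (fun x => T x φ - T' x φ) =ᵐ[volume] fun _ => 0 := by
    refine ae_eq_zero_of_integral_contDiff_smul_eq_zero hc.locallyIntegrable fun g hg hgs => ?_
    have hB : ContDiff ℝ ((⊤ : ℕ∞) : WithTop ℕ∞) fun p : ℝ => (g p : ℂ) :=
      Complex.ofRealCLM.contDiff.comp hg
    have hBs : HasCompactSupport fun p : ℝ => (g p : ℂ) :=
      hgs.comp_left (g := fun x : ℝ => (x : ℂ)) (by simp)
    obtain ⟨Φ, hΦ⟩ := SchwartzMap.exists_prod_eq (hBs.toSchwartzMap hB) φ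
    have e1 := h.2 (hBs.toSchwartzMap hB) φ Φ hBs hΦ
    have e2 := h'.2 (hBs.toSchwartzMap hB) φ Φ hBs hΦ
    have hi : ∀ {u : ℝ → ℂ}, Continuous u → Integrable fun x => (g x : ℂ) * u x := fun hu =>
      (hB.continuous.mul hu).integrable_of_hasCompactSupport hBs.mul_right
    have e3 : ∫ x, (g x : ℂ) * T x φ = ∫ x, (g x : ℂ) * T' x φ := e1.symm.trans e2
    simp only [Complex.real_smul, mul_sub]
    rw [integral_sub (hi (h.1 φ)) (hi (h'.1 φ)), e3, sub_self]
  have := congrFun (hc.ae_eq_iff_eq volume continuous_const |>.1 h0) x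
  exact sub_eq_zero.1 this

end KdVm

namespace KdVm

/-! ### Traces of the Duhamel solution -/

/-- A bound, up to a constant, for the temporal Fourier transform at `lam` of the cut-off traces. -/
noncomputable def traceBound (m ℓ : ℕ) (r : ℝ) (f : ℝ × ℝ → ℂ) (lam : ℝ) : ℝ≥0∞ :=
  ∫⁻ p : ℝ × ℝ, ‖f p‖ₑ * ENNReal.ofReal ((1 + |p.1|) ^ (ℓ : ℝ) *
    ((1 + |lam - p.2|) ^ (-r) + (1 + |lam - p.1 ^ m|) ^ (-r)) * (1 + |p.2 - p.1 ^ m|) ^ (-1 : ℝ))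

/-- The Fourier transform in time of the trace `∂ₓ^ℓ S[0;w](x,·)`, cut off by `φ`. -/
noncomputable def traceHat (φ : 𝓢(ℝ, ℂ)) (m ℓ : ℕ) (f : ℝ × ℝ → ℂ) (x lam : ℝ) : ℂ :=
  ((2 * Real.pi : ℝ) : ℂ)⁻¹ * ∫ ξ : ℝ, Complex.exp (Complex.I * ((ξ * x : ℝ) : ℂ)) *
    ((Complex.I * ξ) ^ ℓ * cutHat φ m f ξ lam)

/-- The Schwartz function `φ` has responses of size `c` which decay with exponent `r`. -/
def HasResponseBound (m : ℕ) (r : ℝ) (φ : 𝓢(ℝ, ℂ)) (c : ℝ) : Prop :=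
  ∀ ξ τ lam, ‖response φ m ξ τ lam‖ ≤ c * (((1 + |lam - τ|) ^ (-r) + (1 + |lam - ξ ^ m|) ^ (-r)) *
    (1 + |τ - ξ ^ m|) ^ (-1 : ℝ))

section

variable {m ℓ : ℕ} {r k c : ℝ} {f : ℝ × ℝ → ℂ} {φ : 𝓢(ℝ, ℂ)}

lemma measurable_traceWeight (m ℓ : ℕ) (r : ℝ) : Measurable fun q : ℝ × ℝ × ℝ =>
    ENNReal.ofReal ((1 + |q.2.1|) ^ (ℓ : ℝ) *
      ((1 + |q.1 - q.2.2|) ^ (-r) + (1 + |q.1 - q.2.1 ^ m|) ^ (-r)) *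
        (1 + |q.2.2 - q.2.1 ^ m|) ^ (-1 : ℝ)) := by
  have m1 := fun t : ℝ => Weight.measurable_rpow_comp (g := fun q : ℝ × ℝ × ℝ => q.2.1)
    (by fun_prop) t
  have m2 := fun t : ℝ => Weight.measurable_rpow_comp (g := fun q : ℝ × ℝ × ℝ => q.1 - q.2.2)
    (by fun_prop) t
  have m3 := fun t : ℝ => Weight.measurable_rpow_comp (g := fun q : ℝ × ℝ × ℝ => q.1 - q.2.1 ^ m)
    (by fun_prop) t
  have m4 := fun t : ℝ => Weight.measurable_rpow_comp
    (g := fun q : ℝ × ℝ × ℝ => q.2.2 - q.2.1 ^ m) (by fun_prop) t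
  exact (((m1 _).mul ((m2 _).add (m3 _))).mul (m4 _)).ennreal_ofReal

lemma measurable_traceBound (hf : Measurable f) : Measurable (traceBound m ℓ r f) := by
  have h : Measurable fun q : ℝ × ℝ × ℝ => ‖f q.2‖ₑ * ENNReal.ofReal ((1 + |q.2.1|) ^ (ℓ : ℝ) *
      ((1 + |q.1 - q.2.2|) ^ (-r) + (1 + |q.1 - q.2.1 ^ m|) ^ (-r)) *
        (1 + |q.2.2 - q.2.1 ^ m|) ^ (-1 : ℝ)) :=
    (hf.comp measurable_snd).enorm.mul (measurable_traceWeight m ℓ r)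
  exact h.lintegral_prod_right'

namespace DuhamelAdmissible

lemma lintegral_cutHat_le (h : DuhamelAdmissible m k f) (hc : 0 ≤ c)
    (hφ : HasResponseBound m r φ c) (lam : ℝ) :
    ∫⁻ ξ : ℝ, ‖(Complex.I * ξ) ^ ℓ * cutHat φ m f ξ lam‖ₑ ≤
      ENNReal.ofReal c * traceBound m ℓ r f lam := by
  have hm : Measurable fun p : ℝ × ℝ => ‖f p‖ₑ * ENNReal.ofReal ((1 + |p.1|) ^ (ℓ : ℝ) *
      ((1 + |lam - p.2|) ^ (-r) + (1 + |lam - p.1 ^ m|) ^ (-r)) *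
        (1 + |p.2 - p.1 ^ m|) ^ (-1 : ℝ)) :=
    h.measurable.enorm.mul ((measurable_traceWeight m ℓ r).comp
      (f := fun p : ℝ × ℝ => (lam, p)) (by fun_prop))
  have e := lintegral_prod (μ := (volume : Measure ℝ)) (ν := (volume : Measure ℝ)) _ hm.aemeasurable
  rw [traceBound, Measure.volume_eq_prod, e, ← lintegral_const_mul' _ _ (by finiteness)]
  refine lintegral_mono_ae ?_
  filter_upwards [h.ae_goodMode] with ξ hξ
  have h1 : ‖(Complex.I * (ξ : ℂ)) ^ ℓ‖ₑ ≤ ENNReal.ofReal ((1 + |ξ|) ^ (ℓ : ℝ)) := by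
    rw [← ofReal_norm, norm_pow, norm_mul, Complex.norm_I, one_mul, Complex.norm_real,
      Real.norm_eq_abs, Real.rpow_natCast]
    exact ENNReal.ofReal_le_ofReal (pow_le_pow_left₀ (abs_nonneg _) (by linarith) _)
  rw [enorm_mul]
  calc _ ≤ ENNReal.ofReal ((1 + |ξ|) ^ (ℓ : ℝ)) * (ENNReal.ofReal c *
        ∫⁻ τ, ‖f (ξ, τ)‖ₑ * ENNReal.ofReal (((1 + |lam - τ|) ^ (-r) +
          (1 + |lam - ξ ^ m|) ^ (-r)) * (1 + |τ - ξ ^ m|) ^ (-1 : ℝ))) :=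
        mul_le_mul' h1 (hξ.enorm_cutHat_le h.measurable hc hφ lam)
    _ = _ := by
        rw [mul_left_comm, ← lintegral_const_mul' _ _ (by finiteness)]
        congr 1
        refine lintegral_congr fun τ => ?_
        rw [mul_left_comm, ← ENNReal.ofReal_mul (by positivity), mul_assoc]

lemma integrable_pow_mul_cutHat (h : DuhamelAdmissible m k f) (hc : 0 ≤ c)
    (hφ : HasResponseBound m r φ c) {lam : ℝ} (hM : traceBound m ℓ r f lam < ∞) :
    Integrable fun ξ : ℝ => (Complex.I * ξ) ^ ℓ * cutHat φ m f ξ lam := by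
  refine ⟨?_, hasFiniteIntegral_iff_enorm.2 ((h.lintegral_cutHat_le hc hφ lam).trans_lt
    (ENNReal.mul_lt_top (by finiteness) hM))⟩
  exact ((Measurable.pow_const (by fun_prop) ℓ).mul ((measurable_cutHat φ h.measurable).comp
    (g := fun q : ℝ × ℝ => cutHat φ m f q.1 q.2) (f := fun ξ : ℝ => (ξ, lam))
      (by fun_prop))).aestronglyMeasurable

/-- The point x enters only through the unimodular factor e^{iξx}, so the bound is uniform in x;
this is the source of the supremum in the time estimate. -/
lemma enorm_traceHat_le (h : DuhamelAdmissible m k f) (hc : 0 ≤ c)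
    (hφ : HasResponseBound m r φ c) (x lam : ℝ) :
    ‖traceHat φ m ℓ f x lam‖ₑ ≤ ENNReal.ofReal c * traceBound m ℓ r f lam := by
  rw [traceHat, enorm_mul]
  calc _ ≤ 1 * ∫⁻ ξ : ℝ, ‖(Complex.I * ξ) ^ ℓ * cutHat φ m f ξ lam‖ₑ := by
        refine mul_le_mul' ?_ ((enorm_integral_le_lintegral_enorm _).trans (le_of_eq ?_))
        · rw [← ofReal_norm, ← ENNReal.ofReal_one]
          exact ENNReal.ofReal_le_ofReal (inv_two_pi_norm_le.trans (by norm_num))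
        · refine lintegral_congr fun ξ => ?_
          rw [enorm_mul, ← ofReal_norm, norm_exp_I_mul, ENNReal.ofReal_one, one_mul]
    _ ≤ _ := by rw [one_mul]; exact h.lintegral_cutHat_le hc hφ lam

lemma integrable_exp_mul (h : DuhamelAdmissible m k f) (hc : 0 ≤ c)
    (hφ : HasResponseBound m r φ c) {lam : ℝ} (hM : traceBound m ℓ r f lam < ∞) (x : ℝ) :
    Integrable fun ξ : ℝ => Complex.exp (Complex.I * ((ξ * x : ℝ) : ℂ)) *
      ((Complex.I * ξ) ^ ℓ * cutHat φ m f ξ lam) := by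
  have hi := h.integrable_pow_mul_cutHat hc hφ hM
  refine hi.mono ((Continuous.aestronglyMeasurable (by fun_prop)).mul hi.aestronglyMeasurable) ?_
  exact Filter.Eventually.of_forall fun ξ => by rw [norm_mul, norm_exp_I_mul, one_mul]

end DuhamelAdmissible

/-- The value at frequency zero is the pairing of the mode with φ, so `traceHat φ m ℓ f x 0` is the
pairing of the trace at x with φ. -/
lemma cutHat_zero (φ : 𝓢(ℝ, ℂ)) (m : ℕ) (f : ℝ × ℝ → ℂ) (ξ : ℝ) :
    cutHat φ m f ξ 0 = ∫ t, φ t * duhamelHat m f ξ t := by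
  simp [cutHat]

namespace DuhamelAdmissible

/-- The traces of the Duhamel solution are tempered distributions. -/
lemma exists_trace (h : DuhamelAdmissible m k f) (hM : traceBound m ℓ r f 0 < ∞) :
    ∃ T : ℝ → 𝓢'(ℝ, ℂ), ∀ x φ, T x φ = traceHat φ m ℓ f x 0 := by
  obtain ⟨q, hq, hresp⟩ := exists_response_le r
  have hR : ∀ φ, HasResponseBound m r φ (q φ) := fun φ => hresp φ m
  have hT : ∀ x : ℝ, ∃ T : 𝓢'(ℝ, ℂ), ∀ φ, T φ = traceHat φ m ℓ f x 0 := by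
    intro x
    have hi := fun φ => h.integrable_exp_mul (hq.nonneg φ) (hR φ) hM x
    let L : 𝓢(ℝ, ℂ) →ₗ[ℂ] ℂ :=
      { toFun := fun φ => traceHat φ m ℓ f x 0
        map_add' := fun φ φ' => by
          rw [traceHat, traceHat, traceHat, ← mul_add, ← integral_add (hi φ) (hi φ')]
          congr 1
          refine integral_congr_ae ?_
          filter_upwards [h.ae_goodMode] with ξ hξ
          rw [cutHat_zero, cutHat_zero, cutHat_zero, ← mul_add, ← mul_add,
            ← integral_add (hξ.integrable_mul_duhamelHat h.measurable φ)
              (hξ.integrable_mul_duhamelHat h.measurable φ')]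
          simp only [add_apply, add_mul]
        map_smul' := fun a φ => by
          rw [traceHat, traceHat, RingHom.id_apply, smul_eq_mul, mul_left_comm,
            ← integral_const_mul a]
          congr 1
          refine integral_congr_ae (Filter.Eventually.of_forall fun ξ => ?_)
          beta_reduce
          rw [cutHat_zero, cutHat_zero, mul_left_comm a, mul_left_comm a,
            ← integral_const_mul a]
          simp only [smul_apply, smul_eq_mul, mul_assoc] }
    refine (hq.const_mul (c := (traceBound m ℓ r f 0).toReal) ENNReal.toReal_nonneg).exists_distribution
      L fun φ => ?_
    have h1 : ‖traceHat φ m ℓ f x 0‖ₑ ≤ _ := h.enorm_traceHat_le (hq.nonneg φ) (hR φ) x 0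
    have h2 := ENNReal.toReal_mono (by finiteness) h1
    rw [ENNReal.toReal_mul, ENNReal.toReal_ofReal (hq.nonneg φ), toReal_enorm, mul_comm] at h2
    exact h2
  choose T hT using hT
  exact ⟨T, hT⟩

/-- Finiteness of the bound at frequency zero dominates the ξ-integral for all x at once: this gives
continuity in x and, with an integrable χ, Fubini. -/
lemma isTrace (h : DuhamelAdmissible m k f) (hM : traceBound m ℓ r f 0 < ∞) {W : 𝓢'(ℝ × ℝ, ℂ)}
    (hW : HasSpaceFourier W (duhamelHat m f)) {T : ℝ → 𝓢'(ℝ, ℂ)}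
    (hT : ∀ x φ, T x φ = traceHat φ m ℓ f x 0) : IsTrace (xDeriv ℓ W) T := by
  obtain ⟨q, hq, hresp⟩ := exists_response_le r
  have hi := fun φ => h.integrable_pow_mul_cutHat (hq.nonneg φ) (fun ξ τ lam => hresp φ m ξ τ lam) hM
  refine ⟨fun φ => ?_, fun χ φ Φ _ hΦ => ?_⟩
  · simp only [hT, traceHat]
    refine Continuous.const_mul ?_ _
    refine continuous_of_dominated (bound := fun ξ => ‖(Complex.I * (ξ : ℂ)) ^ ℓ * cutHat φ m f ξ 0‖)
      (fun x => ?_) (fun x => ?_) (hi φ).norm ?_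
    · exact (Continuous.aestronglyMeasurable (by fun_prop)).mul (hi φ).aestronglyMeasurable
    · exact Filter.Eventually.of_forall fun ξ => by rw [norm_mul, norm_exp_I_mul, one_mul]
    · exact Filter.Eventually.of_forall fun ξ => by fun_prop
  · have e1 : ∀ ξ t, conjFourierSpace Φ ξ t = conjFourier₁ χ ξ * φ t := by
      intro ξ t
      rw [conjFourierSpace, conjFourier₁, ← integral_mul_const]
      simp only [hΦ, mul_assoc]
    have hi1 := h.integrable_mul_conjFourierSpace
      ((fun φ : 𝓢(ℝ × ℝ, ℂ) => ∂_{((1 : ℝ), (0 : ℝ))} φ)^[ℓ] Φ)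
    have e2 : xDeriv ℓ W Φ = ((2 * Real.pi : ℝ) : ℂ)⁻¹ *
        ∫ ξ, conjFourier₁ χ ξ * ((Complex.I * ξ) ^ ℓ * cutHat φ m f ξ 0) := by
      rw [xDeriv_apply, (hW.2 _).2, mul_left_comm]
      congr 1
      rw [Measure.volume_eq_prod] at hi1 ⊢
      rw [integral_prod _ hi1, ← integral_const_mul]
      congr 1
      ext ξ
      rw [cutHat_zero, ← mul_assoc, ← integral_const_mul, ← integral_const_mul]
      congr 1
      ext t
      rw [conjFourierSpace_iterate_lineDeriv, e1, neg_pow]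
      -- One sign comes from the transposed derivative, the other from the symbol -iξ on test
      -- functions.
      have h1 : ((-1 : ℂ) ^ ℓ) * (-1) ^ ℓ = 1 := by rw [← mul_pow]; simp
      linear_combination (duhamelHat m f ξ t * (Complex.I * ξ) ^ ℓ * conjFourier₁ χ ξ * φ t) * h1
    have hF : Integrable (Function.uncurry fun x ξ : ℝ => χ x *
        (Complex.exp (Complex.I * ((ξ * x : ℝ) : ℂ)) * ((Complex.I * ξ) ^ ℓ * cutHat φ m f ξ 0)))
        (volume.prod volume) := by
      have h1 := χ.integrable (μ := volume) |>.mul_prod (hi φ)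
      refine h1.mono ?_ (Filter.Eventually.of_forall fun p => ?_)
      · refine (Continuous.aestronglyMeasurable (by fun_prop)).mul
          ((Continuous.aestronglyMeasurable (by fun_prop)).mul (hi φ).aestronglyMeasurable.comp_snd)
      · simp only [Function.uncurry]
        rw [norm_mul, norm_mul (Complex.exp _), norm_exp_I_mul, one_mul, ← norm_mul]
    have hs := integral_integral_swap hF
    rw [e2]
    have e3 : ∀ x, χ x * T x φ = ((2 * Real.pi : ℝ) : ℂ)⁻¹ * ∫ ξ : ℝ, χ x *
        (Complex.exp (Complex.I * ((ξ * x : ℝ) : ℂ)) *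
          ((Complex.I * ξ) ^ ℓ * cutHat φ m f ξ 0)) := by
      intro x
      rw [hT, traceHat, integral_const_mul]
      ring
    simp only [e3]
    rw [integral_const_mul, hs]
    congr 2
    ext ξ
    rw [conjFourier₁, ← integral_mul_const]
    congr 1
    ext x
    ring

/-- The Fourier transform of the cut-off traces. -/
lemma hasFourier₁_cutTime₁ (h : DuhamelAdmissible m k f) {ρ : ℝ}
    (hMi : ∫⁻ lam, traceBound m ℓ r f lam * ENNReal.ofReal ((1 + |lam|) ^ (-ρ)) < ∞)
    {T : 𝓢'(ℝ, ℂ)} {x : ℝ} (hT : ∀ φ, T φ = traceHat φ m ℓ f x 0) {ψ : ℝ → ℝ} (hφ : ∀ t, φ t = ψ t)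
    (hψ : Function.HasTemperateGrowth fun t : ℝ => (ψ t : ℂ)) :
    HasFourier₁ (cutTime₁ ψ T) (traceHat φ m ℓ f x) := by
  obtain ⟨q, hq, hresp⟩ := exists_response_le r
  obtain ⟨q', hq', hd⟩ := exists_conjFourier₁_decay ρ
  have hmeas : Measurable fun p : ℝ × ℝ => Complex.exp (Complex.I * ((p.1 * x : ℝ) : ℂ)) *
      ((Complex.I * p.1) ^ ℓ * cutHat φ m f p.1 p.2) :=
    (Continuous.measurable (by fun_prop)).mul
      ((Continuous.measurable (by fun_prop)).mul (measurable_cutHat φ h.measurable))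
  have hF : ∀ Φ : 𝓢(ℝ, ℂ), Integrable (Function.uncurry fun ξ lam : ℝ =>
      Complex.exp (Complex.I * ((ξ * x : ℝ) : ℂ)) *
      ((Complex.I * ξ) ^ ℓ * cutHat φ m f ξ lam) * conjFourier₁ Φ lam) (volume.prod volume) := by
    intro Φ
    have hm : Measurable (Function.uncurry fun ξ lam : ℝ =>
      Complex.exp (Complex.I * ((ξ * x : ℝ) : ℂ)) *
      ((Complex.I * ξ) ^ ℓ * cutHat φ m f ξ lam) * conjFourier₁ Φ lam) :=
      hmeas.mul ((continuous_conjFourier₁ Φ).measurable.comp measurable_snd)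
    refine ⟨hm.aestronglyMeasurable, hasFiniteIntegral_iff_enorm.2 ?_⟩
    rw [lintegral_prod_symm _ hm.enorm.aemeasurable]
    calc _ ≤ ∫⁻ lam, ENNReal.ofReal (q φ) * ENNReal.ofReal (q' Φ) *
          (traceBound m ℓ r f lam * ENNReal.ofReal ((1 + |lam|) ^ (-ρ))) := by
          refine lintegral_mono fun lam => ?_
          have h1 : ‖conjFourier₁ Φ lam‖ₑ ≤
              ENNReal.ofReal (q' Φ) * ENNReal.ofReal ((1 + |lam|) ^ (-ρ)) := by
            rw [← ENNReal.ofReal_mul (hq'.nonneg Φ), ← ofReal_norm]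
            exact ENNReal.ofReal_le_ofReal (hd Φ lam)
          calc _ = ∫⁻ ξ : ℝ, ‖(Complex.I * ξ) ^ ℓ * cutHat φ m f ξ lam‖ₑ * ‖conjFourier₁ Φ lam‖ₑ := by
                refine lintegral_congr fun ξ => ?_
                simp only [Function.uncurry]
                rw [enorm_mul, enorm_mul, ← ofReal_norm (Complex.exp _), norm_exp_I_mul,
                  ENNReal.ofReal_one, one_mul]
            _ ≤ (ENNReal.ofReal (q φ) * traceBound m ℓ r f lam) *
                (ENNReal.ofReal (q' Φ) * ENNReal.ofReal ((1 + |lam|) ^ (-ρ))) := by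
                rw [lintegral_mul_const' _ _ (by finiteness)]
                exact mul_le_mul' (h.lintegral_cutHat_le (hq.nonneg φ) (hresp φ m) lam) h1
            _ = _ := by ring
      _ < ∞ := by
          rw [lintegral_const_mul' _ _ (by finiteness)]
          exact ENNReal.mul_lt_top (by finiteness) hMi
  have e0 : ∀ (Φ : 𝓢(ℝ, ℂ)) lam, traceHat φ m ℓ f x lam * conjFourier₁ Φ lam =
      ((2 * Real.pi : ℝ) : ℂ)⁻¹ * ∫ ξ : ℝ, Complex.exp (Complex.I * ((ξ * x : ℝ) : ℂ)) *
        ((Complex.I * ξ) ^ ℓ * cutHat φ m f ξ lam) * conjFourier₁ Φ lam := by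
    intro Φ lam
    rw [traceHat, integral_mul_const, mul_assoc]
  refine ⟨?_, fun Φ => ⟨?_, ?_⟩⟩
  · have h1 : StronglyMeasurable (Function.uncurry fun lam ξ : ℝ =>
        Complex.exp (Complex.I * ((ξ * x : ℝ) : ℂ)) *
          ((Complex.I * ξ) ^ ℓ * cutHat φ m f ξ lam)) :=
      (hmeas.comp measurable_swap).stronglyMeasurable
    exact (h1.integral_prod_right.measurable.const_mul _).aestronglyMeasurable
  · simp only [e0]
    exact (hF Φ).integral_prod_right.const_mul _
  · set Φ' : 𝓢(ℝ, ℂ) := SchwartzMap.smulLeftCLM ℂ (fun t : ℝ => (ψ t : ℂ)) Φ with hΦ'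
    have e1 : cutTime₁ ψ T Φ = T Φ' := rfl
    rw [e1, hT, traceHat]
    congr 1
    simp only [e0]
    rw [integral_const_mul, ← integral_integral_swap (hF Φ), ← integral_const_mul]
    refine integral_congr_ae ?_
    filter_upwards [h.ae_goodMode] with ξ hξ
    -- Pairing a mode with the product of φ and Φ is, by Parseval, pairing the transform of its
    -- cut-off by φ with that of Φ.
    have e2 : cutHat Φ' m f ξ 0 = ((2 * Real.pi : ℝ) : ℂ)⁻¹ *
        ∫ lam, cutHat φ m f ξ lam * conjFourier₁ Φ lam := by
      rw [← hξ.integral_mul_eq h.measurable φ (integrable_conjFourier₁ Φ)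
        (conjFT_inversion Φ.integrable Φ.continuous (integrable_conjFourier₁ Φ)), cutHat_zero]
      congr 1
      ext t
      rw [hΦ', SchwartzMap.smulLeftCLM_apply_apply hψ, smul_eq_mul, hφ]
      ring
    rw [e2]
    have e3 : ∀ lam, Complex.exp (Complex.I * ((ξ * x : ℝ) : ℂ)) *
        ((Complex.I * ξ) ^ ℓ * cutHat φ m f ξ lam) * conjFourier₁ Φ lam =
        Complex.exp (Complex.I * ((ξ * x : ℝ) : ℂ)) * (Complex.I * ξ) ^ ℓ *
          (cutHat φ m f ξ lam * conjFourier₁ Φ lam) := fun lam => by ring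
    simp only [e3]
    rw [integral_const_mul]
    ring

end DuhamelAdmissible

end

end KdVm

/-! ### The time estimates -/

namespace KdVm

/-- The weight `(1+|ξ|)^{2s'} (1+|τ|)^{2(s-s')/m} (1+|τ-ξ^m|)^{-2b}`, which interpolates between those
of the two Bourgain norms. -/
noncomputable def mixedWeight (j : ℕ) (s s' b : ℝ) (p : ℝ × ℝ) : ℝ :=
  (1 + |p.1|) ^ (2 * s') * (1 + |p.2|) ^ (2 * (s - s') / (2 * j + 1)) *
    (1 + |p.2 - p.1 ^ (2 * j + 1)|) ^ (2 * -b)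

/-- A function of finite Sobolev type norm is integrable against a decaying weight. -/
lemma lintegral_mul_weight_lt_top {M : ℝ → ℝ≥0∞} (hM : Measurable M) {μ : ℝ}
    (h : ∫⁻ lam, ENNReal.ofReal ((1 + |lam|) ^ (2 * μ)) * M lam ^ 2 < ∞) :
    ∫⁻ lam, M lam * ENNReal.ofReal ((1 + |lam|) ^ (-(1 - μ))) < ∞ := by
  have hcs := sq_lintegral_mul_weight_le (μ := volume) (F := M)
    (a := fun x : ℝ => (1 + |x|) ^ (-(1 - μ))) (u := fun x : ℝ => (1 + |x|) ^ μ)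
    (v := fun x : ℝ => (1 + |x|) ^ (-1 : ℝ)) hM (Weight.measurable_rpow _)
    (Weight.measurable_rpow _) (fun _ => by positivity) (fun x => by
      rw [Weight.rpow_mul_rpow]; exact Weight.rpow_mono (by linarith))
  simp only [Weight.sq_rpow] at hcs
  have hv : ∫⁻ x : ℝ, ENNReal.ofReal ((1 + |x|) ^ (-1 : ℝ)) ^ 2 < ∞ := by
    refine lt_of_le_of_lt (le_of_eq (lintegral_congr fun x => ?_))
      (Weight.lintegral_lt_top (κ := 2) (by norm_num))
    rw [← ENNReal.ofReal_pow (by positivity), Weight.sq_rpow]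
    norm_num
  exact (ENNReal.pow_lt_top_iff (n := 2)).1 (hcs.trans_lt (ENNReal.mul_lt_top h hv))
    |>.resolve_right (by norm_num)

/-- The time estimates, with the forcing measured in an interpolated norm. -/
theorem time_estimate {j ℓ : ℕ} (hℓ : ℓ < j) {ψ : ℝ → ℝ} (hψ : IsCutoff ψ) (s : ℝ) {s' b : ℝ}
    (hb : b < 1 / 2) (hs1 : -1 ≤ s') (hs2 : s' ≤ 1 / 2) :
    ∃ C : ℝ≥0, ∀ w : 𝓢'(ℝ × ℝ, ℂ), XNorm (2 * j + 1) s (-b) w < ∞ →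
      weightedNorm₂ (mixedWeight j s s' b) w < ∞ →
      (∃ W, IsDuhamel (2 * j + 1) w W) ∧
      ∀ W, IsDuhamel (2 * j + 1) w W →
        (∃ T, IsTrace (xDeriv ℓ W) T) ∧
        ∀ T, IsTrace (xDeriv ℓ W) T →
          ⨆ x : ℝ, sobolevNorm ((s + j - ℓ) / (2 * j + 1)) (cutTime₁ ψ (T x))
            ≤ C * (XNorm (2 * j + 1) s (-b) w + weightedNorm₂ (mixedWeight j s s' b) w) := by
  set μ : ℝ := (s + j - ℓ) / (2 * j + 1) with hμ
  set r : ℝ := |μ| + 3 with hr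
  obtain ⟨K, hK⟩ := Weight.exists_trace_le hℓ hb hs1 hs2 hμ hr
  obtain ⟨q, hq, hresp⟩ := exists_response_le r
  obtain ⟨φ, hφ⟩ := hψ.exists_schwartz
  have hR : HasResponseBound (2 * j + 1) r φ (q φ) := hresp φ _
  obtain ⟨c, hc⟩ : ∃ c : ℝ≥0, (c : ℝ) = q φ := ⟨⟨q φ, hq.nonneg φ⟩, rfl⟩
  refine ⟨K ^ (1 / 2 : ℝ) * c, fun w hX hY => ?_⟩
  obtain ⟨f₀, hf₀⟩ := exists_hasFourier₂ hX
  obtain ⟨f, hfm, hf⟩ := hf₀.exists_measurable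
  have hnX : XNorm (2 * j + 1) s (-b) w = _ := weightedNorm₂_eq hf
  have hnY := weightedNorm₂_eq (ω := mixedWeight j s s' b) hf
  rw [hnX] at hX
  rw [hnY] at hY
  rw [hnX, hnY]
  have hX' := (ENNReal.rpow_lt_top_iff_of_pos (by norm_num)).1 hX
  have hY' := (ENNReal.rpow_lt_top_iff_of_pos (by norm_num)).1 hY
  have hadm := DuhamelAdmissible.of_lintegral_lt_top hfm hb hX'
  set IX := ∫⁻ p : ℝ × ℝ, ENNReal.ofReal ((1 + |p.1|) ^ (2 * s) *
    (1 + |p.2 - p.1 ^ (2 * j + 1)|) ^ (2 * -b)) * ‖f p‖ₑ ^ 2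
  set IY := ∫⁻ p, ENNReal.ofReal (mixedWeight j s s' b p) * ‖f p‖ₑ ^ 2
  obtain ⟨hpt, hint⟩ := hK (fun p => ‖f p‖ₑ) hfm.enorm (IY + IX) rfl
    (traceBound (2 * j + 1) ℓ r f) fun lam => rfl
  have hfin : K * (IY + IX) < ∞ := ENNReal.mul_lt_top (by finiteness) (ENNReal.add_lt_top.2 ⟨hY', hX'⟩)
  -- At `lam = 0` the Sobolev weight is 1, so the pointwise bound is finiteness itself.
  have hM0 : traceBound (2 * j + 1) ℓ r f 0 < ∞ := by
    have := (hpt 0).trans_lt hfin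
    simp only [abs_zero, add_zero, Real.one_rpow, ENNReal.ofReal_one, one_mul] at this
    exact (ENNReal.pow_lt_top_iff (n := 2)).1 this |>.resolve_right (by norm_num)
  have hMi := lintegral_mul_weight_lt_top (measurable_traceBound hfm) (hint.trans_lt hfin)
  refine ⟨hadm.exists_isDuhamel hf, fun W hW => ?_⟩
  obtain ⟨T, hT⟩ := hadm.exists_trace hM0
  have htr := hadm.isTrace hM0 (hW.hasSpaceFourier hf) hT
  refine ⟨⟨T, htr⟩, fun T' hT' => ?_⟩
  rw [← htr.unique hT']
  refine iSup_le fun x => ?_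
  have hFT := hadm.hasFourier₁_cutTime₁ hMi (hT x) hφ hψ.hasTemperateGrowth
  refine (iInf₂_le _ hFT).trans ?_
  have hmain : ∫⁻ lam, ENNReal.ofReal ((1 + |lam|) ^ (2 * μ)) *
      ‖traceHat φ (2 * j + 1) ℓ f x lam‖ₑ ^ 2 ≤ K * (c : ℝ≥0∞) ^ 2 * (IX + IY) := by
    calc _ ≤ ∫⁻ lam, (c : ℝ≥0∞) ^ 2 * (ENNReal.ofReal ((1 + |lam|) ^ (2 * μ)) *
          traceBound (2 * j + 1) ℓ r f lam ^ 2) := by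
          refine lintegral_mono fun lam => ?_
          rw [mul_left_comm, ← mul_pow]
          gcongr
          have := hadm.enorm_traceHat_le (ℓ := ℓ) (hq.nonneg φ) hR x lam
          rwa [← hc, ENNReal.ofReal_coe_nnreal] at this
      _ ≤ (c : ℝ≥0∞) ^ 2 * (K * (IY + IX)) := by
          rw [lintegral_const_mul' _ _ (by finiteness)]
          gcongr
      _ = _ := by ring
  refine (ENNReal_sqrt_le hmain).trans ?_
  push_cast
  gcongr
  -- Subadditivity of the square root turns the sum of squared norms into the sum of norms.
  exact ENNReal.rpow_add_le_add_rpow _ _ (by norm_num) (by norm_num)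

end KdVm

theorem theorem3p3 :
    -- the estimate in the modified Bourgain spaces
    (∃ cψ : (ℝ → ℝ) → ℝ≥0, ∀ j : ℕ, 1 ≤ j → ∀ s b α : ℝ,
      0 < b → b < 1 / 2 → 1 / 2 < α → α < 1 →
      ∃ C : ℝ≥0, ∀ ψ : ℝ → ℝ, KdVm.IsCutoff ψ →
        ∀ w : 𝓢'(ℝ × ℝ, ℂ), KdVm.XModNorm (2 * j + 1) s (-b) (α - 1) w < ∞ →
          (∃ W, KdVm.IsDuhamel (2 * j + 1) w W) ∧
          ∀ W, KdVm.IsDuhamel (2 * j + 1) w W →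
            KdVm.XModNorm (2 * j + 1) s b α (KdVm.cutTime₂ ψ W)
              ≤ C * cψ ψ * KdVm.XModNorm (2 * j + 1) s (-b) (α - 1) w) ∧
    -- the time estimates
    (∀ j : ℕ, 1 ≤ j → ∀ ψ : ℝ → ℝ, KdVm.IsCutoff ψ → ∀ ℓ : ℕ, ℓ < j →
      ∀ s b : ℝ, 0 < b → b < 1 / 2 →
      (-1 ≤ s → s ≤ 1 / 2 →
        ∃ C : ℝ≥0, ∀ w : 𝓢'(ℝ × ℝ, ℂ), KdVm.XNorm (2 * j + 1) s (-b) w < ∞ →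
          (∃ W, KdVm.IsDuhamel (2 * j + 1) w W) ∧
          ∀ W, KdVm.IsDuhamel (2 * j + 1) w W →
            (∃ T, KdVm.IsTrace (KdVm.xDeriv ℓ W) T) ∧
            ∀ T, KdVm.IsTrace (KdVm.xDeriv ℓ W) T →
              ⨆ x : ℝ, KdVm.sobolevNorm ((s + j - ℓ) / (2 * j + 1)) (KdVm.cutTime₁ ψ (T x))
                ≤ C * KdVm.XNorm (2 * j + 1) s (-b) w) ∧
      (∃ C : ℝ≥0, ∀ w : 𝓢'(ℝ × ℝ, ℂ), KdVm.XNorm (2 * j + 1) s (-b) w < ∞ →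
        KdVm.YNorm (2 * j + 1) s (-b) w < ∞ →
          (∃ W, KdVm.IsDuhamel (2 * j + 1) w W) ∧
          ∀ W, KdVm.IsDuhamel (2 * j + 1) w W →
            (∃ T, KdVm.IsTrace (KdVm.xDeriv ℓ W) T) ∧
            ∀ T, KdVm.IsTrace (KdVm.xDeriv ℓ W) T →
              ⨆ x : ℝ, KdVm.sobolevNorm ((s + j - ℓ) / (2 * j + 1)) (KdVm.cutTime₁ ψ (T x))
                ≤ C * (KdVm.XNorm (2 * j + 1) s (-b) w + KdVm.YNorm (2 * j + 1) s (-b) w))) := by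
  refine ⟨?_, fun j _ ψ hψ ℓ hℓ s b _ hb => ⟨fun hs1 hs2 => ?_, ?_⟩⟩
  · obtain ⟨cψ, h⟩ := KdVm.bourgain_estimate
    exact ⟨cψ, fun j _ => h (2 * j + 1)⟩
  · obtain ⟨C, hC⟩ := KdVm.time_estimate hℓ hψ s hb hs1 hs2
    -- For s' = s the power of ⟨τ⟩ disappears and both norms on the right coincide, hence the
    -- constant 2C.
    have e : ∀ w, KdVm.weightedNorm₂ (KdVm.mixedWeight j s s b) w =
        KdVm.XNorm (2 * j + 1) s (-b) w := by
      intro w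
      rw [KdVm.XNorm]
      congr 1
      ext p
      simp [KdVm.mixedWeight]
    simp only [e, ← two_mul, ← mul_assoc] at hC
    refine ⟨C * 2, fun w hw => ?_⟩
    push_cast
    exact hC w hw hw
  -- For s' = 0 the power of ⟨ξ⟩ disappears and the mixed weight is that of the temporal norm; 0
  -- lies in [-1, 1/2] whatever s is.
  · obtain ⟨C, hC⟩ := KdVm.time_estimate hℓ hψ s (s' := 0) hb (by norm_num) (by norm_num)
    have e : KdVm.weightedNorm₂ (KdVm.mixedWeight j s 0 b) = KdVm.YNorm (2 * j + 1) s (-b) := by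
      rw [KdVm.YNorm]
      congr 1
      ext p
      simp [KdVm.mixedWeight]
    rw [e] at hC
    exact ⟨C, hC⟩
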